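/- Let $b\ge 2$ be an integer and $H\in(1/2,1]$. Let $(\epsilon(w))_{w}$, indexed by all finite words $w$ over the alphabet $\{0,\dots,b-1\}$ (including the empty word), be independent random variables on a probability space with $\mathbb P(\epsilon(w)=1)=\frac{1+b^{H-1}}{2}$ and $\mathbb P(\epsilon(w)=-1)=1-\frac{1+b^{H-1}}{2}$. For a word $w=w_1\cdots w_n$ write $w|k=w_1\cdots w_k$, $t_w=\sum_{k=1}^n w_kb^{-k}$ and $I_w=[t_w,t_w+b^{-n}]$. For $n\ge 0$ let $B^H_n$ be the random continuous function on $[0,1]$ with $B_n^H(0)=0$ which, for every word $w$ of length $n$, is affine on $I_w$ with increment $\epsilon(w|1)\cdots\epsilon(w|n)\,b^{-nH}$ over $I_w$. Then $(B^H_n)_{n}$ is a $\mathcal C([0,1])$-valued martingale with respect to the filtration $\mathcal F_n=\sigma(\epsilon(w):|w|\le n)$, and there is a random continuous function $B^H$ on $[0,1]$ such that $B^H_n\to B^H$ uniformly on $[0,1]$ almost surely, $\mathbb E\|B_n^H\|_\infty^2<\infty$ for all $n$, $\mathbb E\|B^H\|_\infty^2<\infty$, and $\mathbb E\|B^H_n-B^H\|_\infty^2\to0$.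 Moreover, with probability $1$: 1. $B^H$ is uniformly $H'$-Hölder continuous on $[0,1]$ for every $H'\in(0,H)$; if $H<1$, the pointwise Hölder exponent of $B^H$ at every $t_0\in[0,1]$ equals $H$, where the pointwise Hölder exponent of $f$ at $t_0$ is $$h_f(t_0)=\sup\Big\{\alpha\ge0:\ \exists P\in\mathbb R[X],\ \sup_{t\in[0,1]\setminus\{t_0\}}\frac{|f(t)-f(t_0)-P(t)|}{|t-t_0|^{\alpha}}<\infty\Big\};$$ if $H=1$, then $B^1(t)=t$ for all $t\in[0,1]$. 2. The graph $\{(t,B^H(t)):t\in[0,1]\}\subset\mathbb R^2$ has Hausdorff dimension $2-H$, and its box dimension exists (lower and upper box dimensions coincide) and equals $2-H$. -/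

import Mathlib

open MeasureTheory ProbabilityTheory Filter Topology
open scoped NNReal ENNReal unitInterval

noncomputable section

namespace SignCascade

/-- The law `p⁺ δ₁ + p⁻ δ₋₁` on `{1, -1}`, with `p⁺ = (1 + b^(H-1)) / 2` and `p⁻ = 1 - p⁺`. -/
def signLaw (b : ℕ) (H : ℝ) : Measure ℝ :=
  ENNReal.ofReal ((1 + (b : ℝ) ^ (H - 1)) / 2) • Measure.dirac (1 : ℝ) +
    ENNReal.ofReal (1 - (1 + (b : ℝ) ^ (H - 1)) / 2) • Measure.dirac (-1 : ℝ)

/-- The left end point `t_w = ∑ w_k b^{-k}` of the `b`-adic interval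
`I_w = [t_w, t_w + b^{-n}]` coded by the word `w` of length `n`. -/
def leftEnd {b n : ℕ} (w : Fin n → Fin b) : ℝ :=
  ∑ k : Fin n, ((w k : ℕ) : ℝ) / (b : ℝ) ^ ((k : ℕ) + 1)

/-- The prefix `w|k` of a word `w` of length `n`. -/
def wordPrefix {b n : ℕ} (w : Fin n → Fin b) (k : ℕ) : List (Fin b) :=
  (List.ofFn w).take k

/-- The product `ε(w|1) ⋯ ε(w|n)` for a word `w` of length `n`. -/
def signProd {b n : ℕ} (e : List (Fin b) → ℝ) (w : Fin n → Fin b) : ℝ :=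
  ∏ k ∈ Finset.Icc 1 n, e (wordPrefix w k)

/-- The increment over `[0, t]` of the continuous function that is constant off
`I_w = [t_w, t_w + b^{-n}]` and grows linearly from `0` to `1` on `I_w`. It is
`∫_0^t b^n 1_{I_w}(u) du`. -/
def ramp {b n : ℕ} (w : Fin n → Fin b) (t : ℝ) : ℝ :=
  max 0 (min 1 ((b : ℝ) ^ n * (t - leftEnd w)))

/-- The continuous piecewise linear function on `[0, 1]` that vanishes at `0`, is affine on
every `b`-adic interval of generation `n`, and whose increment over `I_w` is
`ε(w|1) ⋯ ε(w|n) b^{-nH}` for every word `w` of length `n`. -/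
def path (b : ℕ) (H : ℝ) (e : List (Fin b) → ℝ) (n : ℕ) : C(I, ℝ) where
  toFun t := ∑ w : Fin n → Fin b, (b : ℝ) ^ (-((n : ℝ) * H)) * signProd e w * ramp w t
  continuous_toFun := by unfold ramp; fun_prop

/-- The cascade `B_n^H` as a sequence of random continuous functions. -/
def cascade {Ω : Type*} (b : ℕ) (H : ℝ) (ε : List (Fin b) → Ω → ℝ) (n : ℕ) (ω : Ω) :
    C(I, ℝ) :=
  path b H (fun w => ε w ω) n

/-- The filtration `σ(ε(w) : |w| ≤ n)`. -/
def cascadeFiltration {Ω : Type*} [m : MeasurableSpace Ω] {b : ℕ} (ε : List (Fin b) → Ω → ℝ)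
    (hε : ∀ w, Measurable (ε w)) : Filtration ℕ m where
  seq n := ⨆ w : {w : List (Fin b) // w.length ≤ n},
    MeasurableSpace.comap (ε w.1) (borel ℝ)
  mono' i j hij := iSup_le fun w =>
    le_iSup (fun v : {v : List (Fin b) // v.length ≤ j} =>
      MeasurableSpace.comap (ε v.1) (borel ℝ)) ⟨w.1, w.2.trans hij⟩
  le' n := iSup_le fun w => by
    have h := (hε w.1).comap_le
    rwa [BorelSpace.measurable_eq (α := ℝ)] at h

/-- The pointwise Hölder exponent of `f` at `t₀`: the supremum of the `α ≥ 0` such that for some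
polynomial `P` the quotient `|f t - f t₀ - P t| / |t - t₀|^α` is bounded over `t ≠ t₀`. -/
def pointwiseHolderExponent (f : C(I, ℝ)) (t₀ : I) : ℝ≥0∞ :=
  ⨆ (α : ℝ≥0) (_ : ∃ P : Polynomial ℝ, ∃ C : ℝ, ∀ t : I, t ≠ t₀ →
    |f t - f t₀ - P.eval (t : ℝ)| / |(t : ℝ) - t₀| ^ (α : ℝ) ≤ C), (α : ℝ≥0∞)

/-- The graph of `f`, in the Euclidean plane. -/
def graph (f : C(I, ℝ)) : Set (EuclideanSpace ℝ (Fin 2)) :=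
  Set.range fun t : I => !₂[(t : ℝ), f t]

/-- `log N(A, δ) / log (1/δ)`, where `N(A, δ)` is the least number of closed balls of radius `δ`
with centres in `A` that cover `A`. -/
def boxRatio {X : Type*} [PseudoEMetricSpace X] (A : Set X) (δ : ℝ≥0) : EReal :=
  ENNReal.log ((Metric.coveringNumber δ A : ℕ∞) : ℝ≥0∞) / ((-Real.log δ : ℝ) : EReal)

/-- The lower box (Minkowski) dimension. -/
def lowerBoxDim {X : Type*} [PseudoEMetricSpace X] (A : Set X) : EReal :=
  liminf (boxRatio A) (𝓝[>] 0)

/-- The upper box (Minkowski) dimension. -/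
def upperBoxDim {X : Type*} [PseudoEMetricSpace X] (A : Set X) : EReal :=
  limsup (boxRatio A) (𝓝[>] 0)

end SignCascade

end

/-! Self-similarity drives everything. With `c = b^(-H)`, splitting off the first letter of a word
writes the cascade as a sum over the `b` children of `[0, 1]` of `c`, times a sign, times an
independent copy of the cascade. It therefore suffices to work on the space of sign families with
the product law `signMeasure`, where passing to a subtree (`shift`) preserves the measure.

Convergence and regularity. The total increment over `[0, 1]` has mean `1`, because `b * c * b^(H-1)
= 1`. Its change from generation `n` to `n + 1` is sub-Gaussian with parameter `(b c²)^(n+1) =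
b^((1-2H)(n+1))` (`hasSubgaussianMGF_totalDiff`), which decays exactly when `H > 1/2`. One weighted
sum of moments of order `2p` controls all words and generations at once, with a square integrable
random constant and a loss of `b^(1/p)` per letter (`ae_tame`). For such "tame" signs the rest is
deterministic: uniform geometric convergence, and oscillations of order `b^(-n(H - 1/p))` on
intervals of generation `n`. Letting `p` grow gives every Hölder exponent below `H`.

Irregularity at every point. The limit total has mean `1`, so it is below `1/2` in modulus with
probability `q < 1`. All `b^m` descendants at depth `m` of a given word are small with probability
`q^(b^m)`, which beats the number `b^(km)` of words of length `km`. By Borel-Cantelli every such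
word eventually has a descendant `m` letters deeper over which the increment is at least `c^((k+1)m)
/ 2`. Taking `k` large excludes every pointwise exponent above `H`; when `H < 1` the polynomial in
the definition plays no role.

Dimensions. A Hölder function of exponent `h` has a graph covered by about `δ^(h-2)` balls of radius
`δ`, so the upper box dimension is at most `2 - H`. Conversely, for `H < 1` the characteristic
function `φ` of the limit total satisfies `φ(ξ) = (p φ(cξ) + (1-p) conj (φ(cξ)))^b`. Its modulus is
below `1` near `0` on the positive axis, and iteration yields the decay `(1 + ξ²)⁻¹`
(`exists_norm_fourier_limTotal_le`). Hence an increment over `[s, t]` has modulus at most `r` with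
probability at most of order `r (t-s)^(-H)`. An energy estimate for the Lebesgue measure lifted to
the graph then gives Hausdorff dimension at least `2 - H`, and the chain Hausdorff, lower box, upper
box closes. For `H = 1` all signs are `1` and the limit is the identity. -/

noncomputable section

namespace SignCascade

/-! ### The cascade as a recursively defined function of the signs -/

variable {b : ℕ}

/-- The signs seen from the word `w`. -/
def shift (w : List (Fin b)) (e : List (Fin b) → ℝ) : List (Fin b) → ℝ := fun u => e (w ++ u)

@[simp] lemma shift_nil (e : List (Fin b) → ℝ) : shift [] e = e := rfl

lemma shift_shift (w u : List (Fin b)) (e : List (Fin b) → ℝ) :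
    shift u (shift w e) = shift (w ++ u) e := by
  funext v; simp [shift]

lemma shift_cons (i : Fin b) (w : List (Fin b)) (e : List (Fin b) → ℝ) :
    shift w (shift [i] e) = shift (i :: w) e := shift_shift [i] w e

/-- The projection of the real line onto `[0, 1]`. -/
def clamp (x : ℝ) : ℝ := max 0 (min 1 x)

lemma clamp_nonneg (x : ℝ) : 0 ≤ clamp x := le_max_left _ _

lemma clamp_le_one (x : ℝ) : clamp x ≤ 1 := max_le zero_le_one (min_le_left _ _)

lemma clamp_of_nonpos {x : ℝ} (hx : x ≤ 0) : clamp x = 0 :=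
  max_eq_left ((min_le_right _ _).trans hx)

lemma clamp_of_one_le {x : ℝ} (hx : 1 ≤ x) : clamp x = 1 := by
  simp [clamp, min_eq_left hx]

/-- The cascade of generation `n` with ratio `c`, extended to the line by constants. -/
def cas (c : ℝ) : ℕ → (List (Fin b) → ℝ) → ℝ → ℝ
  | 0, _, x => clamp x
  | n + 1, e, x => ∑ i : Fin b, c * (shift [i] e []) * cas c n (shift [i] e) (b * x - (i : ℕ))

lemma cas_zero (c : ℝ) (e : List (Fin b) → ℝ) (x : ℝ) : cas c 0 e x = clamp x := rfl

lemma cas_succ (c : ℝ) (n : ℕ) (e : List (Fin b) → ℝ) (x : ℝ) : cas c (n + 1) e x =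
    ∑ i : Fin b, c * (shift [i] e []) * cas c n (shift [i] e) (b * x - (i : ℕ)) := rfl

lemma cas_of_nonpos (c : ℝ) (n : ℕ) (e : List (Fin b) → ℝ) {x : ℝ} (hx : x ≤ 0) :
    cas c n e x = 0 := by
  induction n generalizing e x with
  | zero => exact clamp_of_nonpos hx
  | succ n ih =>
    rw [cas_succ]
    refine Finset.sum_eq_zero fun i _ => ?_
    rw [ih, mul_zero]
    have : (b : ℝ) * x ≤ 0 := mul_nonpos_of_nonneg_of_nonpos (Nat.cast_nonneg _) hx
    have : (0 : ℝ) ≤ (i : ℕ) := Nat.cast_nonneg _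
    linarith

lemma cas_of_one_le (c : ℝ) (n : ℕ) (e : List (Fin b) → ℝ) {x : ℝ} (hx : 1 ≤ x) :
    cas c n e x = cas c n e 1 := by
  induction n generalizing e x with
  | zero => simp [cas_zero, clamp_of_one_le hx, clamp_of_one_le le_rfl]
  | succ n ih =>
    rw [cas_succ, cas_succ]
    refine Finset.sum_congr rfl fun i _ => ?_
    have h1 : ((i : ℕ) : ℝ) + 1 ≤ b := by exact_mod_cast i.2
    have h2 : (b : ℝ) * 1 ≤ b * x := mul_le_mul_of_nonneg_left hx (Nat.cast_nonneg _)
    rw [ih (x := b * x - (i : ℕ)), ih (x := b * 1 - (i : ℕ))] <;> linarith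

lemma measurable_shift (w : List (Fin b)) : Measurable (shift w) :=
  measurable_pi_lambda _ fun _ => measurable_pi_apply _

lemma measurable_cas (c : ℝ) (n : ℕ) :
    Measurable fun p : (List (Fin b) → ℝ) × ℝ => cas c n p.1 p.2 := by
  induction n with
  | zero => simp only [cas_zero, clamp]; fun_prop
  | succ n ih =>
    simp only [cas_succ]
    refine Finset.measurable_sum _ fun i _ => ?_
    have h : Measurable fun p : (List (Fin b) → ℝ) × ℝ => shift [i] p.1 :=
      (measurable_shift [i]).comp measurable_fst
    refine Measurable.mul (((measurable_pi_apply []).comp h).const_mul c) ?_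
    exact ih.comp (h.prodMk (by fun_prop))

/-- The total increment of the cascade of generation `n`. -/
def total (c : ℝ) (n : ℕ) (e : List (Fin b) → ℝ) : ℝ := cas c n e 1

lemma measurable_total (c : ℝ) (n : ℕ) : Measurable (total (b := b) c n) :=
  (measurable_cas c n).comp measurable_prodMk_right

lemma total_zero (c : ℝ) (e : List (Fin b) → ℝ) : total c 0 e = 1 := clamp_of_one_le le_rfl

lemma total_succ (c : ℝ) (n : ℕ) (e : List (Fin b) → ℝ) : total c (n + 1) e =
    ∑ i : Fin b, c * (shift [i] e []) * total c n (shift [i] e) := by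
  rw [total, cas_succ]
  refine Finset.sum_congr rfl fun i _ => ?_
  have h1 : ((i : ℕ) : ℝ) + 1 ≤ b := by exact_mod_cast i.2
  rw [cas_of_one_le _ _ _ (by linarith), total]

/-! ### Comparison with the explicit formula -/

lemma leftEnd_cons {n : ℕ} (i : Fin b) (w : Fin n → Fin b) :
    leftEnd (Fin.cons i w : Fin (n + 1) → Fin b) = ((i : ℕ) + leftEnd w) / b := by
  rw [leftEnd, Fin.sum_univ_succ, leftEnd, add_div, Finset.sum_div]
  simp only [Fin.cons_zero, Fin.cons_succ, Fin.val_zero, Fin.val_succ, zero_add, pow_one]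
  congr 1
  refine Finset.sum_congr rfl fun k _ => ?_
  rw [div_div, ← pow_succ]

lemma ramp_eq {n : ℕ} (w : Fin n → Fin b) (t : ℝ) :
    ramp w t = clamp ((b : ℝ) ^ n * (t - leftEnd w)) := rfl

lemma ramp_cons [NeZero b] {n : ℕ} (i : Fin b) (w : Fin n → Fin b) (t : ℝ) :
    ramp (Fin.cons i w : Fin (n + 1) → Fin b) t = ramp w (b * t - (i : ℕ)) := by
  have hb : (b : ℝ) ≠ 0 := Nat.cast_ne_zero.2 (NeZero.ne b)
  rw [ramp_eq, ramp_eq, leftEnd_cons]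
  congr 1
  field_simp
  ring

lemma wordPrefix_cons {n : ℕ} (i : Fin b) (w : Fin n → Fin b) (k : ℕ) :
    wordPrefix (Fin.cons i w : Fin (n + 1) → Fin b) (k + 1) = i :: wordPrefix w k := by
  simp [wordPrefix, List.ofFn_succ]

lemma signProd_cons {n : ℕ} (e : List (Fin b) → ℝ) (i : Fin b) (w : Fin n → Fin b) :
    signProd e (Fin.cons i w : Fin (n + 1) → Fin b) = shift [i] e [] * signProd (shift [i] e) w := by
  have h : ∀ (m : ℕ) (f : ℕ → ℝ), ∏ k ∈ Finset.Icc 1 m, f k = ∏ k ∈ Finset.range m, f (k + 1) := by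
    intro m f
    rw [Finset.range_eq_Ico, Finset.prod_Ico_add' f 0 m 1]
    congr 1
  rw [signProd, h, signProd, h, Finset.prod_range_succ']
  rw [mul_comm]
  congr 1
  · rw [zero_add, wordPrefix_cons]; simp [wordPrefix, shift]
  · refine Finset.prod_congr rfl fun k _ => ?_
    rw [wordPrefix_cons]; rfl

/-- The explicit sum grows words at their end, whereas self-similarity needs them split at their
first letter. Induction through `Fin.cons` passes from one to the other. -/
lemma sum_ramp_eq_cas [NeZero b] (H : ℝ) (n : ℕ) (e : List (Fin b) → ℝ) (x : ℝ) :
    ∑ w : Fin n → Fin b, (b : ℝ) ^ (-((n : ℝ) * H)) * signProd e w * ramp w x =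
      cas ((b : ℝ) ^ (-H)) n e x := by
  have hb : (0 : ℝ) < b := Nat.cast_pos.2 (NeZero.pos b)
  induction n generalizing e x with
  | zero => simp [cas_zero, signProd, ramp_eq, leftEnd]
  | succ n ih =>
    rw [cas_succ, ← (Fin.consEquiv fun _ : Fin (n + 1) => Fin b).sum_comp, Fintype.sum_prod_type]
    refine Finset.sum_congr rfl fun i _ => ?_
    rw [← ih, Finset.mul_sum]
    refine Finset.sum_congr rfl fun w _ => ?_
    simp only [Fin.consEquiv, Equiv.coe_fn_mk]
    rw [signProd_cons, ramp_cons]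
    have : (b : ℝ) ^ (-(((n + 1 : ℕ) : ℝ) * H)) = b ^ (-H) * b ^ (-((n : ℝ) * H)) := by
      rw [← Real.rpow_add hb]; congr 1; push_cast; ring
    rw [this]; ring

lemma path_apply [NeZero b] (H : ℝ) (n : ℕ) (e : List (Fin b) → ℝ) (t : I) :
    path b H e n t = cas ((b : ℝ) ^ (-H)) n e t := sum_ramp_eq_cas H n e t

end SignCascade

namespace SignCascade

variable {b : ℕ}

/-! ### Pathwise estimates -/

/-- The signs `e` have modulus one and, below every word, the increments of the totals decay
geometrically in the generation, with a constant growing geometrically in the word. -/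
structure Tame (c M s a : ℝ) (e : List (Fin b) → ℝ) : Prop where
  abs_eq : ∀ u, |e u| = 1
  diff_le : ∀ w n, |total c (n + 1) (shift w e) - total c n (shift w e)| ≤ M * s ^ n * a ^ w.length

lemma Tame.shift {c M s a : ℝ} {e : List (Fin b) → ℝ} (h : Tame c M s a e) (w : List (Fin b)) :
    Tame c (M * a ^ w.length) s a (shift w e) where
  abs_eq u := h.abs_eq _
  diff_le u n := by
    rw [shift_shift]
    refine (h.diff_le (w ++ u) n).trans (le_of_eq ?_)
    rw [List.length_append, pow_add]; ring

lemma Tame.abs_shift {c M s a : ℝ} {e : List (Fin b) → ℝ} (h : Tame c M s a e)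
    (w u : List (Fin b)) : |SignCascade.shift w e u| = 1 := h.abs_eq _

lemma sum_ite_floor_le {D : ℝ} (hD : 0 ≤ D) (k : ℤ) :
    ∑ j : Fin b, (if ((j : ℕ) : ℤ) = k then D else 0) ≤ D := by
  by_cases hk : ∃ j : Fin b, ((j : ℕ) : ℤ) = k
  · obtain ⟨j, rfl⟩ := hk
    rw [Finset.sum_eq_single j]
    · simp
    · intro i _ hi
      rw [if_neg]
      intro h
      exact hi (Fin.ext (by exact_mod_cast h))
    · simp
  · push Not at hk
    simp [hk, hD]

/-- Bookkeeping for sums over children: a point lies inside at most one child interval, so only one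
term can carry the extra cost `D`. -/
lemma sum_le_of_le_ite {A D : ℝ} (hD : 0 ≤ D) (k : ℤ) (g : Fin b → ℝ)
    (hg : ∀ j, g j ≤ A + if ((j : ℕ) : ℤ) = k then D else 0) : ∑ j, g j ≤ b * A + D := by
  calc ∑ j, g j ≤ ∑ j : Fin b, (A + if ((j : ℕ) : ℤ) = k then D else 0) :=
        Finset.sum_le_sum fun j _ => hg j
    _ = b * A + ∑ j : Fin b, (if ((j : ℕ) : ℤ) = k then D else 0) := by
        rw [Finset.sum_add_distrib]; simp
    _ ≤ b * A + D := by gcongr; exact sum_ite_floor_le hD k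

lemma floor_eq_of_sub_mem {x : ℝ} {j : ℕ} (h0 : ¬ x - j ≤ 0) (h1 : ¬ 1 ≤ x - j) :
    ((j : ℕ) : ℤ) = ⌊x⌋ := by
  symm
  rw [Int.floor_eq_iff]
  push_cast
  push Not at h0 h1
  constructor <;> linarith

variable {c s a ρ : ℝ}

lemma abs_clamp_le (x : ℝ) : |clamp x| ≤ 1 := by
  rw [abs_of_nonneg (clamp_nonneg x)]; exact clamp_le_one x

/-- The constant in the geometric bound of the increments of the cascade. -/
def diffConst (b : ℕ) (c a ρ : ℝ) : ℝ := max (c * b * a / (ρ - c * a)) (c * b + 1)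

/-- Children to the right of `x` contribute nothing, those to the left contribute a difference of
totals, bounded by tameness, and only the child around `x` needs the induction hypothesis, with `M`
replaced by `M * a`. The induction closes when `c b a + c a K ≤ K ρ`, which is the first entry of
`diffConst`; the second entry covers `n = 0`. -/
lemma Tame.abs_cas_succ_sub_le (hc : 0 < c) (hs : 0 ≤ s) (hsρ : s ≤ ρ)
    (hρ : c * a < ρ) {M : ℝ} (hM : 1 ≤ M) (n : ℕ) {e : List (Fin b) → ℝ} (he : Tame c M s a e)
    (ha1 : 1 ≤ a) (x : ℝ) :
    |cas c (n + 1) e x - cas c n e x| ≤ diffConst b c a ρ * M * ρ ^ n := by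
  have hρ0 : 0 ≤ ρ := hs.trans hsρ
  set K := diffConst b c a ρ with hKdef
  have hK1 : c * b + 1 ≤ K := le_max_right _ _
  have hK0 : 0 ≤ K := le_trans (by positivity) hK1
  have hK2 : c * b * a + c * a * K ≤ K * ρ := by
    have h : c * b * a / (ρ - c * a) ≤ K := le_max_left _ _
    rw [div_le_iff₀ (by linarith)] at h
    linarith
  induction n generalizing e x M with
  | zero =>
    have h1 : |cas c 1 e x| ≤ c * b := by
      rw [cas_succ]
      refine (Finset.abs_sum_le_sum_abs _ _).trans ?_
      calc ∑ i : Fin b, |c * (SignCascade.shift [i] e []) * cas c 0 (SignCascade.shift [i] e)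
            (b * x - (i : ℕ))| ≤ ∑ i : Fin b, c := by
            refine Finset.sum_le_sum fun i _ => ?_
            rw [abs_mul, abs_mul, he.abs_shift, abs_of_pos hc, mul_one, cas_zero]
            exact mul_le_of_le_one_right hc.le (abs_clamp_le _)
        _ = c * b := by simp [mul_comm]
    have h2 : |cas c 0 e x| ≤ 1 := abs_clamp_le x
    calc |cas c (0 + 1) e x - cas c 0 e x| ≤ |cas c 1 e x| + |cas c 0 e x| := abs_sub _ _
      _ ≤ c * b + 1 := add_le_add h1 h2
      _ ≤ K := hK1
      _ ≤ K * M * ρ ^ 0 := by rw [pow_zero, mul_one]; exact le_mul_of_one_le_right hK0 hM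
  | succ n ih =>
    have hMa : 1 ≤ M * a := one_le_mul_of_one_le_of_one_le hM ha1
    rw [cas_succ, cas_succ, ← Finset.sum_sub_distrib]
    refine (Finset.abs_sum_le_sum_abs _ _).trans ?_
    refine (sum_le_of_le_ite (A := c * (M * s ^ n * a)) (D := c * (K * (M * a) * ρ ^ n))
      (by positivity) ⌊(b : ℝ) * x⌋ _ fun j => ?_).trans ?_
    · rw [← mul_sub, abs_mul, abs_mul, he.abs_shift, abs_of_pos hc, mul_one]
      have htame : Tame c (M * a) s a (SignCascade.shift [j] e) := by
        simpa using he.shift [j]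
      by_cases h0 : (b : ℝ) * x - (j : ℕ) ≤ 0
      · rw [cas_of_nonpos _ _ _ h0, cas_of_nonpos _ _ _ h0, sub_zero, abs_zero, mul_zero]
        positivity
      by_cases h1 : 1 ≤ (b : ℝ) * x - (j : ℕ)
      · rw [cas_of_one_le _ _ _ h1, cas_of_one_le c n _ h1]
        have := he.diff_le [j] n
        simp only [List.length_singleton, pow_one] at this
        refine le_add_of_le_of_nonneg (mul_le_mul_of_nonneg_left this hc.le) (by positivity)
      rw [if_pos (floor_eq_of_sub_mem h0 h1)]
      refine le_add_of_nonneg_of_le (by positivity) (mul_le_mul_of_nonneg_left ?_ hc.le)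
      exact ih hMa htame _
    · have hpow : s ^ n ≤ ρ ^ n := pow_le_pow_left₀ hs hsρ n
      calc b * (c * (M * s ^ n * a)) + c * (K * (M * a) * ρ ^ n)
          ≤ b * (c * (M * ρ ^ n * a)) + c * (K * (M * a) * ρ ^ n) := by gcongr
        _ = (c * b * a + c * a * K) * (M * ρ ^ n) := by ring
        _ ≤ (K * ρ) * (M * ρ ^ n) := by gcongr
        _ = K * M * ρ ^ (n + 1) := by ring

/-- The limit of the cascade. -/
def lim (c : ℝ) (e : List (Fin b) → ℝ) (x : ℝ) : ℝ := limUnder atTop fun n => cas c n e x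

/-- The numerical conditions under which tame signs have a convergent cascade. -/
structure Rates (c s a ρ : ℝ) : Prop where
  c_pos : 0 < c
  one_le_a : 1 ≤ a
  s_nonneg : 0 ≤ s
  s_le : s ≤ ρ
  ca_lt : c * a < ρ
  rho_lt : ρ < 1

lemma Rates.rho_pos (h : Rates c s a ρ) : 0 < ρ :=
  lt_of_le_of_lt (mul_nonneg h.c_pos.le (zero_le_one.trans h.one_le_a)) h.ca_lt

lemma diffConst_nonneg (b : ℕ) (h : Rates c s a ρ) : 0 ≤ diffConst b c a ρ := by
  have := h.c_pos
  exact le_trans (by positivity) (le_max_right _ _)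

variable {M : ℝ} {e : List (Fin b) → ℝ}

lemma Tame.dist_cas_le (he : Tame c M s a e) (hr : Rates c s a ρ) (hM : 1 ≤ M) (x : ℝ) (n : ℕ) :
    dist (cas c n e x) (cas c (n + 1) e x) ≤ diffConst b c a ρ * M * ρ ^ n := by
  rw [dist_comm, Real.dist_eq]
  exact he.abs_cas_succ_sub_le hr.c_pos hr.s_nonneg hr.s_le
    hr.ca_lt hM n hr.one_le_a x

lemma Tame.tendsto_lim (he : Tame c M s a e) (hr : Rates c s a ρ) (hM : 1 ≤ M) (x : ℝ) :
    Tendsto (fun n => cas c n e x) atTop (𝓝 (lim c e x)) :=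
  CauchySeq.tendsto_limUnder (cauchySeq_of_le_geometric ρ _ hr.rho_lt (he.dist_cas_le hr hM x))

lemma Tame.abs_cas_sub_lim_le (he : Tame c M s a e) (hr : Rates c s a ρ) (hM : 1 ≤ M) (x : ℝ)
    (n : ℕ) : |cas c n e x - lim c e x| ≤ diffConst b c a ρ * M * ρ ^ n / (1 - ρ) :=
  dist_le_of_le_geometric_of_tendsto ρ _ hr.rho_lt (he.dist_cas_le hr hM x)
    (he.tendsto_lim hr hM x) n

/-- The constant in the bound of the limit of the cascade. -/
def limConst (b : ℕ) (c a ρ : ℝ) : ℝ := 1 + diffConst b c a ρ / (1 - ρ)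

lemma limConst_nonneg (b : ℕ) (h : Rates c s a ρ) : 0 ≤ limConst b c a ρ := by
  have := diffConst_nonneg b h
  have := sub_pos.2 h.rho_lt
  unfold limConst; positivity

lemma Tame.abs_lim_le (he : Tame c M s a e) (hr : Rates c s a ρ) (hM : 1 ≤ M) (x : ℝ) :
    |lim c e x| ≤ limConst b c a ρ * M := by
  have h := he.abs_cas_sub_lim_le hr hM x 0
  have h1 : |cas c 0 e x| ≤ 1 := abs_clamp_le x
  have h2 : |lim c e x| ≤ |cas c 0 e x| + |cas c 0 e x - lim c e x| := by
    have := abs_sub (cas c 0 e x) (cas c 0 e x - lim c e x)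
    simpa using this
  calc |lim c e x| ≤ 1 + diffConst b c a ρ * M * ρ ^ 0 / (1 - ρ) := by linarith
    _ ≤ M + diffConst b c a ρ * M * ρ ^ 0 / (1 - ρ) := by gcongr
    _ = limConst b c a ρ * M := by unfold limConst; ring

lemma Tame.one_le_mul_pow (hr : Rates c s a ρ) (hM : 1 ≤ M) (n : ℕ) : 1 ≤ M * a ^ n :=
  one_le_mul_of_one_le_of_one_le hM (one_le_pow₀ hr.one_le_a)

lemma Tame.lim_eq (he : Tame c M s a e) (hr : Rates c s a ρ) (hM : 1 ≤ M) (x : ℝ) :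
    lim c e x = ∑ i : Fin b, c * (SignCascade.shift [i] e []) *
      lim c (SignCascade.shift [i] e) (b * x - (i : ℕ)) := by
  have h1 := (tendsto_add_atTop_iff_nat 1).2 (he.tendsto_lim hr hM x)
  refine tendsto_nhds_unique h1 ?_
  simp only [cas_succ]
  exact tendsto_finsetSum _ fun i _ =>
    ((he.shift [i]).tendsto_lim hr (one_le_mul_pow hr hM _) _).const_mul _

lemma lim_of_nonpos (c : ℝ) (e : List (Fin b) → ℝ) {x : ℝ} (hx : x ≤ 0) : lim c e x = 0 := by
  simp only [lim, cas_of_nonpos _ _ _ hx]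
  exact tendsto_const_nhds.limUnder_eq

lemma lim_of_one_le (c : ℝ) (e : List (Fin b) → ℝ) {x : ℝ} (hx : 1 ≤ x) :
    lim c e x = lim c e 1 := by
  simp only [lim, cas_of_one_le _ _ _ hx]

/-- By self-similarity the oscillation over an interval of generation `n` is `c ^ n` times that of a
subtree limit, and the bound on the latter grows by the factor `a ^ n`. -/
lemma Tame.abs_lim_sub_le_of_mem_Icc [NeZero b] (he : Tame c M s a e) (hr : Rates c s a ρ)
    (hM : 1 ≤ M) (n : ℕ) (k : ℤ) {x y : ℝ} (hx : x * b ^ n ∈ Set.Icc (k : ℝ) (k + 1))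
    (hy : y * b ^ n ∈ Set.Icc (k : ℝ) (k + 1)) :
    |lim c e x - lim c e y| ≤ 2 * limConst b c a ρ * M * (c * a) ^ n := by
  have hL := limConst_nonneg b hr
  have hc := hr.c_pos
  have ha := hr.one_le_a
  have hb : (0 : ℝ) < b := Nat.cast_pos.2 (NeZero.pos b)
  induction n generalizing e x y k M with
  | zero =>
    have h1 := he.abs_lim_le hr hM x
    have h2 := he.abs_lim_le hr hM y
    calc |lim c e x - lim c e y| ≤ |lim c e x| + |lim c e y| := abs_sub _ _
      _ ≤ 2 * limConst b c a ρ * M * (c * a) ^ 0 := by rw [pow_zero]; linarith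
  | succ n ih =>
    have hMa := Tame.one_le_mul_pow hr hM 1
    rw [he.lim_eq hr hM, he.lim_eq hr hM y, ← Finset.sum_sub_distrib]
    refine (Finset.abs_sum_le_sum_abs _ _).trans ?_
    -- The integer quotient `k / b ^ n` is the index of the child that contains the `k`-th interval
    -- of generation `n + 1`. All other children are constant on that interval, hence `A = 0`.
    refine (sum_le_of_le_ite (A := 0) (D := c * (2 * limConst b c a ρ * (M * a ^ 1) * (c * a) ^ n))
      (by positivity) (k / (b : ℤ) ^ n) _ fun j => ?_).trans (le_of_eq (by ring))
    rw [← mul_sub, abs_mul, abs_mul, he.abs_shift, abs_of_pos hc, mul_one, zero_add]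
    have hbn : (0 : ℝ) < (b : ℝ) ^ n := by positivity
    have hx' : (b * x - (j : ℕ)) * b ^ n ∈ Set.Icc (((k - j * (b : ℤ) ^ n : ℤ)) : ℝ)
        ((k - j * (b : ℤ) ^ n : ℤ) + 1) := by
      push_cast
      obtain ⟨h1, h2⟩ := hx
      rw [pow_succ] at h1 h2
      constructor <;> nlinarith
    have hy' : (b * y - (j : ℕ)) * b ^ n ∈ Set.Icc (((k - j * (b : ℤ) ^ n : ℤ)) : ℝ)
        ((k - j * (b : ℤ) ^ n : ℤ) + 1) := by
      push_cast
      obtain ⟨h1, h2⟩ := hy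
      rw [pow_succ] at h1 h2
      constructor <;> nlinarith
    set m : ℤ := k - j * (b : ℤ) ^ n with hm
    by_cases h0 : m + 1 ≤ 0
    · have h0' : (m : ℝ) + 1 ≤ 0 := by exact_mod_cast h0
      rw [lim_of_nonpos, lim_of_nonpos, sub_zero, abs_zero, mul_zero]
      · split_ifs <;> positivity
      · by_contra h
        push Not at h
        have := mul_pos h hbn
        linarith [hy'.2]
      · by_contra h
        push Not at h
        have := mul_pos h hbn
        linarith [hx'.2]
    by_cases h1 : (b : ℤ) ^ n ≤ m
    · have h1' : (b : ℝ) ^ n ≤ m := by exact_mod_cast h1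
      rw [lim_of_one_le c _ (x := b * x - (j : ℕ)), lim_of_one_le c _ (x := b * y - (j : ℕ)),
        sub_self, abs_zero, mul_zero]
      · split_ifs <;> positivity
      · exact le_of_mul_le_mul_right (by linarith [hy'.1]) hbn
      · exact le_of_mul_le_mul_right (by linarith [hx'.1]) hbn
    have hbz : (0 : ℤ) < (b : ℤ) ^ n := by exact_mod_cast hbn
    rw [if_pos]
    · exact mul_le_mul_of_nonneg_left (ih (he.shift [j]) hMa m hx' hy') hc.le
    · symm
      rw [Int.ediv_eq_iff_of_pos hbz]
      constructor <;> [skip; skip] <;> push Not at h0 h1 <;> nlinarith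

/-- Two points at distance at most `b ^ (-n)` lie in the same interval of generation `n` or in two
neighbouring ones. In the second case the common end point `z` is inserted, which doubles the
constant. -/
lemma Tame.abs_lim_sub_le_of_abs_sub_le [NeZero b] (he : Tame c M s a e) (hr : Rates c s a ρ)
    (hM : 1 ≤ M) (n : ℕ) {x y : ℝ} (hxy : |x - y| * b ^ n ≤ 1) :
    |lim c e x - lim c e y| ≤ 4 * limConst b c a ρ * M * (c * a) ^ n := by
  have hbn : (0 : ℝ) < (b : ℝ) ^ n := pow_pos (Nat.cast_pos.2 (NeZero.pos b)) n
  have hL := limConst_nonneg b hr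
  have hca : 0 ≤ c * a := mul_nonneg hr.c_pos.le (zero_le_one.trans hr.one_le_a)
  wlog h : x ≤ y generalizing x y
  · rw [abs_sub_comm]
    exact this (by rwa [abs_sub_comm]) (le_of_not_ge h)
  rw [abs_sub_comm, abs_of_nonneg (sub_nonneg.2 h)] at hxy
  set k : ℤ := ⌊x * b ^ n⌋
  have hk1 : (k : ℝ) ≤ x * b ^ n := Int.floor_le _
  have hk2 : x * b ^ n < k + 1 := Int.lt_floor_add_one _
  have hxy' : x * b ^ n ≤ y * b ^ n := by gcongr
  set z : ℝ := (k + 1) / b ^ n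
  have hz : z * b ^ n = k + 1 := div_mul_cancel₀ _ hbn.ne'
  have h1 := he.abs_lim_sub_le_of_mem_Icc hr hM n k (x := x) (y := z) ⟨hk1, hk2.le⟩
    (by rw [hz]; constructor <;> linarith)
  by_cases hy : y * b ^ n ≤ k + 1
  · refine (he.abs_lim_sub_le_of_mem_Icc hr hM n k (x := x) (y := y) ⟨hk1, hk2.le⟩
      ⟨by linarith, hy⟩).trans ?_
    have : 0 ≤ limConst b c a ρ * M * (c * a) ^ n := by positivity
    linarith
  · push Not at hy
    have h2 := he.abs_lim_sub_le_of_mem_Icc hr hM n (k + 1) (x := z) (y := y)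
      (by rw [hz]; push_cast; constructor <;> linarith)
      (by push_cast; constructor <;> linarith)
    calc |lim c e x - lim c e y| ≤ |lim c e x - lim c e z| + |lim c e z - lim c e y| :=
          abs_sub_le _ _ _
      _ ≤ _ := by linarith

/-- Hölder estimate for the limit of a cascade with tame signs. -/
lemma Tame.abs_lim_sub_le_rpow (hb : 2 ≤ b) (he : Tame c M s a e) (hr : Rates c s a ρ)
    (hM : 1 ≤ M) {h : ℝ} (hh : 0 < h) (hca : c * a = (b : ℝ) ^ (-h)) {x y : ℝ}
    (hxy : |x - y| ≤ 1) :
    |lim c e x - lim c e y| ≤ 4 * limConst b c a ρ * M * (b : ℝ) ^ h * |x - y| ^ h := by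
  have : NeZero b := ⟨by lia⟩
  have hb1 : (1 : ℝ) < b := by exact_mod_cast hb
  have hb0 : (0 : ℝ) < b := by linarith
  have hL := limConst_nonneg b hr
  rcases eq_or_lt_of_le (abs_nonneg (x - y)) with h0 | h0
  · rw [sub_eq_zero.1 (abs_eq_zero.1 h0.symm)]
    simp [Real.zero_rpow hh.ne']
  -- The scale satisfies `b ^ n ≤ 1 / |x - y| < b ^ (n + 1)`: the first inequality allows the
  -- previous lemma, the second turns `(c * a) ^ n = b ^ (-h n)` into `b ^ h * |x - y| ^ h`.
  obtain ⟨n, hn1, hn2⟩ := exists_nat_pow_near (one_le_inv_iff₀.2 ⟨h0, hxy⟩) hb1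
  refine (he.abs_lim_sub_le_of_abs_sub_le hr hM n ?_).trans ?_
  · calc |x - y| * b ^ n ≤ |x - y| * |x - y|⁻¹ := by gcongr
      _ = 1 := mul_inv_cancel₀ h0.ne'
  · rw [mul_assoc _ ((b : ℝ) ^ h)]
    refine mul_le_mul_of_nonneg_left ?_ (by positivity)
    rw [hca, ← Real.mul_rpow hb0.le h0.le, ← Real.rpow_natCast, ← Real.rpow_mul hb0.le, mul_comm,
      Real.rpow_mul hb0.le, Real.rpow_natCast, Real.rpow_neg (by positivity), ← Real.inv_rpow
      (by positivity)]
    refine Real.rpow_le_rpow (by positivity) ?_ hh.le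
    rw [inv_le_iff_one_le_mul₀ (by positivity)]
    have := mul_lt_mul_of_pos_right hn2 h0
    rw [inv_mul_cancel₀ h0.ne', pow_succ] at this
    linarith

/-! ### The intervals coded by words -/

/-- The affine map of `[0, 1]` onto the interval coded by the word `w`. -/
def pos : List (Fin b) → ℝ → ℝ
  | [], x => x
  | i :: w, x => ((i : ℕ) + pos w x) / b

lemma pos_mem [NeZero b] (w : List (Fin b)) {x : ℝ} (hx : x ∈ Set.Icc (0 : ℝ) 1) :
    pos w x ∈ Set.Icc (0 : ℝ) 1 := by
  induction w with
  | nil => exact hx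
  | cons i w ih =>
    have hb : (0 : ℝ) < b := Nat.cast_pos.2 (NeZero.pos b)
    have h1 : ((i : ℕ) : ℝ) + 1 ≤ b := by exact_mod_cast i.2
    refine ⟨div_nonneg (add_nonneg (Nat.cast_nonneg _) ih.1) hb.le, ?_⟩
    rw [pos, div_le_one hb]
    linarith [ih.2]

lemma pos_sub [NeZero b] (w : List (Fin b)) (x y : ℝ) :
    pos w x - pos w y = (x - y) / b ^ w.length := by
  induction w with
  | nil => simp [pos]
  | cons i w ih =>
    have hb : (b : ℝ) ≠ 0 := Nat.cast_ne_zero.2 (NeZero.ne b)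
    rw [pos, pos, ← sub_div, add_sub_add_left_eq_sub, ih, List.length_cons, pow_succ, div_div]

lemma pos_append (w u : List (Fin b)) (x : ℝ) : pos (w ++ u) x = pos w (pos u x) := by
  induction w with
  | nil => rfl
  | cons i w ih => rw [List.cons_append, pos, pos, ih]

lemma exists_pos_eq [NeZero b] (n : ℕ) {t : ℝ} (ht : t ∈ Set.Icc (0 : ℝ) 1) :
    ∃ (w : List (Fin b)) (x : ℝ), w.length = n ∧ x ∈ Set.Icc (0 : ℝ) 1 ∧ pos w x = t := by
  induction n generalizing t with
  | zero => exact ⟨[], t, rfl, ht, rfl⟩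
  | succ n ih =>
    have hb : (0 : ℝ) < b := Nat.cast_pos.2 (NeZero.pos b)
    have : ∃ i : Fin b, b * t - (i : ℕ) ∈ Set.Icc (0 : ℝ) 1 := by
      rcases eq_or_lt_of_le ht.2 with h | h
      -- At `t = 1` the floor of `b * t` is not a letter; the last letter is used with local
      -- coordinate `1`.
      · refine ⟨⟨b - 1, Nat.sub_lt (NeZero.pos b) one_pos⟩, ?_⟩
        rw [h, Fin.val_mk, Nat.cast_sub (Nat.one_le_iff_ne_zero.2 (NeZero.ne b))]
        simp
      · have h0 : 0 ≤ b * t := mul_nonneg hb.le ht.1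
        have hlt : ⌊b * t⌋₊ < b := by
          rw [Nat.floor_lt h0]
          exact mul_lt_of_lt_one_right hb h
        refine ⟨⟨⌊b * t⌋₊, hlt⟩, sub_nonneg.2 (Nat.floor_le h0), ?_⟩
        have := Nat.lt_floor_add_one (b * t)
        simp only
        linarith
    obtain ⟨i, hi⟩ := this
    obtain ⟨w, x, hw, hx, hwx⟩ := ih hi
    refine ⟨i :: w, x, by simp [hw], hx, ?_⟩
    rw [pos, hwx]
    field_simp
    ring

/-- Signs have modulus one, so self-similarity of increments is an equality and not only an upper
bound. The lower bounds on oscillations rest on this. -/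
lemma Tame.abs_lim_pos_sub [NeZero b] (he : Tame c M s a e) (hr : Rates c s a ρ) (hM : 1 ≤ M)
    (w : List (Fin b)) {x y : ℝ} (hx : x ∈ Set.Icc (0 : ℝ) 1) (hy : y ∈ Set.Icc (0 : ℝ) 1) :
    |lim c e (pos w x) - lim c e (pos w y)| =
      c ^ w.length * |lim c (SignCascade.shift w e) x - lim c (SignCascade.shift w e) y| := by
  induction w generalizing e M with
  | nil => simp [pos]
  | cons i w ih =>
    have hb : (b : ℝ) ≠ 0 := Nat.cast_ne_zero.2 (NeZero.ne b)
    rw [he.lim_eq hr hM, he.lim_eq hr hM (pos (i :: w) y), ← Finset.sum_sub_distrib,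
      Finset.sum_eq_single i]
    · rw [pos, pos, mul_div_cancel₀ _ hb, mul_div_cancel₀ _ hb, add_sub_cancel_left,
        add_sub_cancel_left, ← mul_sub, abs_mul, abs_mul, he.abs_shift, abs_of_pos hr.c_pos,
        ih (he.shift [i]) (one_le_mul_pow hr hM _), shift_cons, List.length_cons, pow_succ]
      ring
    · intro j _ hj
      rw [pos, pos, mul_div_cancel₀ _ hb, mul_div_cancel₀ _ hb, ← mul_sub]
      have h1 := pos_mem w hx
      have h2 := pos_mem w hy
      rcases lt_or_gt_of_ne (fun h => hj (Fin.ext h) : (j : ℕ) ≠ i) with h | h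
      · have h' : ((j : ℕ) : ℝ) + 1 ≤ (i : ℕ) := by exact_mod_cast h
        rw [lim_of_one_le c _ (by linarith [h1.1]),
          lim_of_one_le c _ (x := (i : ℕ) + pos w y - (j : ℕ)) (by linarith [h2.1]), sub_self,
          mul_zero]
      · have h' : ((i : ℕ) : ℝ) + 1 ≤ (j : ℕ) := by exact_mod_cast h
        rw [lim_of_nonpos c _ (by linarith [h1.2]), lim_of_nonpos c _ (by linarith [h2.2]),
          sub_self, mul_zero]
    · simp

end SignCascade

namespace SignCascade

variable {b : ℕ} {H : ℝ}

/-! ### Independent signs -/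

/-- The probability of the sign `1`. -/
def plusProb (b : ℕ) (H : ℝ) : ℝ := (1 + (b : ℝ) ^ (H - 1)) / 2

lemma plusProb_mem (hb : 2 ≤ b) (hH1 : H ≤ 1) : plusProb b H ∈ Set.Ioc (1 / 2 : ℝ) 1 := by
  have hb1 : (1 : ℝ) ≤ b := by exact_mod_cast (by lia : 1 ≤ b)
  have h1 : (b : ℝ) ^ (H - 1) ≤ 1 := Real.rpow_le_one_of_one_le_of_nonpos hb1 (by linarith)
  have h2 : 0 < (b : ℝ) ^ (H - 1) := Real.rpow_pos_of_pos (by linarith) _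
  unfold plusProb
  constructor <;> linarith

lemma signLaw_eq (b : ℕ) (H : ℝ) : signLaw b H =
    ENNReal.ofReal (plusProb b H) • Measure.dirac (1 : ℝ) +
      ENNReal.ofReal (1 - plusProb b H) • Measure.dirac (-1 : ℝ) := rfl

lemma isProbabilityMeasure_signLaw (hb : 2 ≤ b) (hH1 : H ≤ 1) :
    IsProbabilityMeasure (signLaw b H) := by
  have h := plusProb_mem hb hH1
  constructor
  rw [signLaw_eq]
  simp only [Measure.coe_add, Measure.coe_smul, Pi.add_apply, Pi.smul_apply, measure_univ,
    smul_eq_mul, mul_one]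
  rw [← ENNReal.ofReal_add (by linarith [h.1]) (by linarith [h.2])]
  simp

lemma integral_signLaw {𝕜 : Type*} [RCLike 𝕜] (hb : 2 ≤ b) (hH1 : H ≤ 1) (f : ℝ → 𝕜) :
    ∫ x, f x ∂(signLaw b H) = plusProb b H * f 1 + (1 - plusProb b H : ℝ) * f (-1) := by
  have h := plusProb_mem hb hH1
  have hi : ∀ (x y : ℝ), Integrable f (ENNReal.ofReal x • Measure.dirac y) := fun x y =>
    (integrable_dirac (by simp)).smul_measure ENNReal.ofReal_ne_top
  rw [signLaw_eq, integral_add_measure (hi _ _) (hi _ _), integral_smul_measure,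
    integral_smul_measure, integral_dirac, integral_dirac,
    ENNReal.toReal_ofReal (by linarith [h.1]), ENNReal.toReal_ofReal (by linarith [h.2]),
    RCLike.real_smul_eq_coe_mul, RCLike.real_smul_eq_coe_mul]

lemma integral_id_signLaw (hb : 2 ≤ b) (hH1 : H ≤ 1) :
    ∫ x, x ∂(signLaw b H) = (b : ℝ) ^ (H - 1) := by
  rw [integral_signLaw hb hH1 (fun x : ℝ => x)]
  simp only [RCLike.ofReal_real_eq_id, id_eq, plusProb]
  ring

lemma ae_signLaw (b : ℕ) (H : ℝ) : ∀ᵐ x ∂(signLaw b H), |x| = 1 := by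
  have hm : MeasurableSet {x : ℝ | |x| = 1} := measurableSet_eq_fun (by fun_prop) (by fun_prop)
  rw [signLaw_eq, ae_add_measure_iff]
  constructor <;> refine Measure.ae_smul_measure ?_ _ <;> rw [ae_dirac_iff hm] <;> simp

/-- The law of a family of independent signs indexed by all words. -/
def signMeasure (b : ℕ) (H : ℝ) : Measure (List (Fin b) → ℝ) :=
  Measure.infinitePi fun _ => signLaw b H

/-- Replace the sign of the empty word by `1`. -/
def forget (e : List (Fin b) → ℝ) : List (Fin b) → ℝ := fun u => if u = [] then 1 else e u

lemma shift_forget (i : Fin b) (e : List (Fin b) → ℝ) : shift [i] (forget e) = shift [i] e := by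
  funext u; simp [shift, forget]

/-- The recursion starts with the words of one letter, so the sign of the empty word never enters.
In a subtree that sign is therefore independent of the subtree's own cascade. -/
lemma cas_forget (c : ℝ) (n : ℕ) (e : List (Fin b) → ℝ) (x : ℝ) :
    cas c n (forget e) x = cas c n e x := by
  cases n with
  | zero => rfl
  | succ n => simp only [cas_succ, shift_forget]

variable [hprob : IsProbabilityMeasure (signLaw b H)]

instance : IsProbabilityMeasure (signMeasure b H) := by unfold signMeasure; infer_instance

lemma measurePreserving_eval (u : List (Fin b)) :
    MeasurePreserving (fun e : List (Fin b) → ℝ => e u) (signMeasure b H) (signLaw b H) :=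
  measurePreserving_eval_infinitePi _ u

lemma measurePreserving_shift (w : List (Fin b)) :
    MeasurePreserving (shift w) (signMeasure b H) (signMeasure b H) where
  measurable := measurable_shift w
  map_eq := Measure.map_infinitePi_infinitePi_of_inj (P := fun _ : List (Fin b) => signLaw b H)
    (f := fun u => w ++ u) (List.append_right_injective w)

lemma ae_abs_eq_one : ∀ᵐ e ∂(signMeasure b H), ∀ u, |e u| = 1 :=
  ae_all_iff.2 fun u => (measurePreserving_eval u).quasiMeasurePreserving.ae (ae_signLaw b H)

/-- Subtrees with different first letters use disjoint sets of signs: `(i, u) ↦ i :: u` is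
injective, so the family of subtrees, once curried, has a product of product measures as its law. -/
lemma iIndepFun_shift : iIndepFun (fun i : Fin b => shift [i]) (signMeasure b H) := by
  rw [iIndepFun_iff_map_fun_eq_infinitePi_map fun i => measurable_shift [i]]
  have h1 : (fun (e : List (Fin b) → ℝ) (i : Fin b) => shift [i] e) =
      MeasurableEquiv.curry (Fin b) (List (Fin b)) ℝ ∘ fun e p => e (p.1 :: p.2) := rfl
  have hinj : Function.Injective fun p : Fin b × List (Fin b) => p.1 :: p.2 := by
    rintro ⟨i, u⟩ ⟨j, v⟩ h
    simpa using h
  rw [h1, ← Measure.map_map (by fun_prop) (by fun_prop), signMeasure,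
    Measure.map_infinitePi_infinitePi_of_inj (P := fun _ : List (Fin b) => signLaw b H) hinj,
    Measure.infinitePi_map_curry fun _ _ => signLaw b H]
  congr 1
  funext i
  exact (measurePreserving_shift (H := H) [i]).map_eq.symm

lemma indepFun_root_forget :
    IndepFun (fun e : List (Fin b) → ℝ => e []) forget (signMeasure b H) := by
  have hi : iIndep (fun u : List (Fin b) => MeasurableSpace.comap (fun e => e u) (borel ℝ))
      (signMeasure b H) := by
    have := iIndepFun_infinitePi (P := fun _ : List (Fin b) => signLaw b H)
      (X := fun _ x => x) (fun _ => measurable_id)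
    rw [iIndepFun_iff_iIndep, ← BorelSpace.measurable_eq (α := ℝ)] at *
    exact this
  have h := indep_iSup_of_disjoint (fun u => by
    rw [← BorelSpace.measurable_eq (α := ℝ)]; exact (measurable_pi_apply u).comap_le) hi
    (S := {[]}) (T := {[]}ᶜ) disjoint_compl_right
  rw [IndepFun_iff_Indep]
  refine indep_of_indep_of_le_left (indep_of_indep_of_le_right h ?_) ?_
  · simp only [MeasurableSpace.pi, MeasurableSpace.comap_iSup, MeasurableSpace.comap_comp]
    refine iSup_le fun u => ?_
    by_cases hu : u = []
    · have : (fun e : List (Fin b) → ℝ => e u) ∘ forget = fun _ => 1 := by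
        funext e; simp [forget, hu]
      rw [this, MeasurableSpace.comap_const]
      exact bot_le
    · have : (fun e : List (Fin b) → ℝ => e u) ∘ forget = fun e => e u := by
        funext e; simp [forget, hu]
      rw [this]
      refine le_trans ?_ (le_iSup₂_of_le u hu le_rfl)
      rw [BorelSpace.measurable_eq (α := ℝ)]
  · refine le_trans ?_ (le_iSup₂_of_le [] rfl le_rfl)
    rw [BorelSpace.measurable_eq (α := ℝ)]

lemma indepFun_root {φ : (List (Fin b) → ℝ) → ℝ} (hφ : Measurable φ)
    (hf : ∀ e, φ (forget e) = φ e) :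
    IndepFun (fun e : List (Fin b) → ℝ => e []) φ (signMeasure b H) := by
  have h := (indepFun_root_forget (b := b) (H := H)).comp measurable_id hφ
  have : φ ∘ forget = φ := funext hf
  rwa [this] at h

/-- Conditioning on the root sign. It is stated for real and complex `f`, to serve both moment
generating functions and characteristic functions. -/
lemma integral_root_mul {𝕜 : Type*} [RCLike 𝕜] (hb : 2 ≤ b) (hH1 : H ≤ 1)
    {φ : (List (Fin b) → ℝ) → ℝ} (hφ : Measurable φ) (hf : ∀ e, φ (forget e) = φ e)
    {f : ℝ → 𝕜} (hfm : Measurable f) (h1 : Integrable (fun e => f (φ e)) (signMeasure b H))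
    (h2 : Integrable (fun e => f (-φ e)) (signMeasure b H)) :
    ∫ e, f (e [] * φ e) ∂(signMeasure b H) =
      plusProb b H * ∫ e, f (φ e) ∂(signMeasure b H) +
        (1 - plusProb b H : ℝ) * ∫ e, f (-φ e) ∂(signMeasure b H) := by
  have hind := indepFun_root (H := H) hφ hf
  -- On `{1, -1}` the affine functions `(1 + x) / 2` and `(1 - x) / 2` are the indicators of `1` and
  -- of `-1`.
  set g1 : ℝ → 𝕜 := fun x => (((1 + x) / 2 : ℝ) : 𝕜)
  set g2 : ℝ → 𝕜 := fun x => (((1 - x) / 2 : ℝ) : 𝕜)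
  have hg1 : Measurable g1 := by fun_prop
  have hg2 : Measurable g2 := by fun_prop
  have hroot := measurePreserving_eval (b := b) (H := H) []
  have e1 : g1 1 = 1 := by
    change (((1 + 1) / 2 : ℝ) : 𝕜) = 1
    rw [show ((1 + 1) / 2 : ℝ) = 1 by norm_num, RCLike.ofReal_one]
  have e2 : g2 1 = 0 := by simp [g2]
  have e3 : g1 (-1) = 0 := by simp [g1]
  have e4 : g2 (-1) = 1 := by
    change (((1 - (-1)) / 2 : ℝ) : 𝕜) = 1
    rw [show ((1 - (-1)) / 2 : ℝ) = 1 by norm_num, RCLike.ofReal_one]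
  have key : ∀ᵐ e ∂(signMeasure b H), f (e [] * φ e) =
      g1 (e []) * f (φ e) + g2 (e []) * f (-φ e) := by
    filter_upwards [ae_abs_eq_one (b := b) (H := H)] with e he
    rcases (abs_eq zero_le_one).1 (he []) with h | h
    · rw [h, e1, e2]; simp
    · rw [h, e3, e4]; simp
  have hbd : ∀ (g : ℝ → 𝕜), Measurable g → (∀ x, |x| = 1 → ‖g x‖ ≤ 1) →
      ∀ ψ : (List (Fin b) → ℝ) → 𝕜, Integrable ψ (signMeasure b H) →
      Integrable (fun e => g (e []) * ψ e) (signMeasure b H) := by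
    intro g hg hle ψ hψ
    refine hψ.bdd_mul (c := 1) (hg.comp (measurable_pi_apply [])).aestronglyMeasurable ?_
    filter_upwards [ae_abs_eq_one (b := b) (H := H)] with e he
    exact hle _ (he [])
  rw [integral_congr_ae key, integral_add, hind.integral_fun_comp_mul_comp
    (measurable_pi_apply []).aemeasurable hφ.aemeasurable hg1.aestronglyMeasurable
    hfm.aestronglyMeasurable, hind.integral_fun_comp_mul_comp (g := fun x => f (-x))
    (measurable_pi_apply []).aemeasurable hφ.aemeasurable hg2.aestronglyMeasurable
    (hfm.comp measurable_neg).aestronglyMeasurable]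
  · rw [← integral_map (φ := fun e : List (Fin b) → ℝ => e []) (f := g1)
      (measurable_pi_apply []).aemeasurable hg1.aestronglyMeasurable,
      ← integral_map (φ := fun e : List (Fin b) → ℝ => e []) (f := g2)
      (measurable_pi_apply []).aemeasurable hg2.aestronglyMeasurable, hroot.map_eq,
      integral_signLaw hb hH1, integral_signLaw hb hH1, e1, e2, e3, e4]
    simp
  · refine hbd g1 hg1 (fun x hx => ?_) _ h1
    rcases (abs_eq zero_le_one).1 hx with h | h <;> rw [h] <;> simp [e1, e3]
  · refine hbd g2 hg2 (fun x hx => ?_) _ h2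
    rcases (abs_eq zero_le_one).1 hx with h | h <;> rw [h] <;> simp [e2, e4]

/-! ### Sub-Gaussian increments -/

lemma HasSubgaussianMGF.comp_shift {φ : (List (Fin b) → ℝ) → ℝ} {v : ℝ≥0}
    (h : HasSubgaussianMGF φ v (signMeasure b H)) (w : List (Fin b)) :
    HasSubgaussianMGF (fun e => φ (shift w e)) v (signMeasure b H) := by
  have hw := measurePreserving_shift (b := b) (H := H) w
  exact HasSubgaussianMGF.of_map (X := φ) hw.measurable.aemeasurable (by rwa [hw.map_eq])

/-- The bound `exp (v t² / 2)` is even in `t`, hence valid for `φ` and `-φ`, hence for any mixture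
of the two. The sign need not be symmetric. -/
lemma hasSubgaussianMGF_root_mul (hb : 2 ≤ b) (hH1 : H ≤ 1)
    {φ : (List (Fin b) → ℝ) → ℝ} (hφ : Measurable φ) (hf : ∀ e, φ (forget e) = φ e) {v : ℝ≥0}
    (h : HasSubgaussianMGF φ v (signMeasure b H)) :
    HasSubgaussianMGF (fun e => e [] * φ e) v (signMeasure b H) where
  integrable_exp_mul t := by
    refine ((h.integrable_exp_mul t).add (h.integrable_exp_mul (-t))).mono' ?_ ?_
    · exact ((((measurable_pi_apply []).mul hφ).const_mul t).exp).aestronglyMeasurable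
    · filter_upwards [ae_abs_eq_one (b := b) (H := H)] with e he
      have h1 := Real.exp_pos (t * φ e)
      have h2 := Real.exp_pos (-t * φ e)
      simp only [Real.norm_eq_abs, Pi.add_apply, Real.abs_exp]
      rcases (abs_eq zero_le_one).1 (he []) with h | h
      · rw [h, one_mul]; linarith
      · rw [h, show t * (-1 * φ e) = -t * φ e by ring]; linarith
  mgf_le t := by
    have hp := plusProb_mem (H := H) hb hH1
    have h1 : Integrable (fun e => Real.exp (t * φ e)) (signMeasure b H) := h.integrable_exp_mul t
    have h2 : Integrable (fun e => Real.exp (t * -φ e)) (signMeasure b H) := by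
      simpa using h.integrable_exp_mul (-t)
    have e := integral_root_mul hb hH1 hφ hf (f := fun x => Real.exp (t * x)) (by fun_prop) h1 h2
    have m1 := h.mgf_le t
    have m2 := h.mgf_le (-t)
    simp only [mgf, neg_mul, mul_neg, RCLike.ofReal_real_eq_id, id_eq, neg_sq] at e m1 m2 ⊢
    rw [e]
    have := mul_le_mul_of_nonneg_left m1 (by linarith [hp.1] : 0 ≤ plusProb b H)
    have := mul_le_mul_of_nonneg_left m2 (by linarith [hp.2] : 0 ≤ 1 - plusProb b H)
    linarith

/-- The increment between consecutive generations of the total. -/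
def totalDiff (c : ℝ) (n : ℕ) (e : List (Fin b) → ℝ) : ℝ := total c (n + 1) e - total c n e

lemma measurable_totalDiff (c : ℝ) (n : ℕ) : Measurable (totalDiff (b := b) c n) :=
  (measurable_total c _).sub (measurable_total c _)

lemma totalDiff_forget (c : ℝ) (n : ℕ) (e : List (Fin b) → ℝ) :
    totalDiff c n (forget e) = totalDiff c n e := by
  simp only [totalDiff, total, cas_forget]

lemma totalDiff_succ (c : ℝ) (n : ℕ) (e : List (Fin b) → ℝ) : totalDiff c (n + 1) e =
    ∑ i : Fin b, c * (shift [i] e [] * totalDiff c n (shift [i] e)) := by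
  rw [totalDiff, total_succ, total_succ, ← Finset.sum_sub_distrib]
  refine Finset.sum_congr rfl fun i _ => ?_
  rw [totalDiff]; ring

lemma hasSubgaussianMGF_sum {φ : (List (Fin b) → ℝ) → ℝ} (hφ : Measurable φ) {v : ℝ≥0} (c : ℝ≥0)
    (h : HasSubgaussianMGF φ v (signMeasure b H)) :
    HasSubgaussianMGF (fun e => ∑ i : Fin b, (c : ℝ) * φ (shift [i] e)) (b * c ^ 2 * v)
      (signMeasure b H) := by
  have hind : iIndepFun (fun (i : Fin b) e => (c : ℝ) * φ (shift [i] e)) (signMeasure b H) :=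
    (iIndepFun_shift (b := b) (H := H)).comp (fun _ e => (c : ℝ) * φ e) fun _ => hφ.const_mul _
  have := HasSubgaussianMGF.sum_of_iIndepFun hind (s := Finset.univ) (c := fun _ => c ^ 2 * v)
    fun i _ => ?_
  · convert this using 1
    simp [mul_assoc]
  · convert (HasSubgaussianMGF.comp_shift h [i]).const_mul (c : ℝ) using 1
    exact congrArg (· * v) (NNReal.eq (NNReal.coe_pow c 2))

/-- A bounded centred sign has parameter `1` by Hoeffding's lemma. Each generation multiplies the
parameter by `b * c ^ 2`: scaling by `c`, then summing `b` independent copies. -/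
lemma hasSubgaussianMGF_totalDiff (hb : 2 ≤ b) (hH1 : H ≤ 1) (c : ℝ≥0)
    (hc : (c : ℝ) = (b : ℝ) ^ (-H)) (n : ℕ) :
    HasSubgaussianMGF (totalDiff (b := b) c n) ((b * c ^ 2) ^ (n + 1)) (signMeasure b H) := by
  have hb0 : (0 : ℝ) < b := by exact_mod_cast (by lia : 0 < b)
  induction n with
  | zero =>
    have h : HasSubgaussianMGF (fun e : List (Fin b) → ℝ => e [] - (b : ℝ) ^ (H - 1)) 1
        (signMeasure b H) := by
      have := hasSubgaussianMGF_of_mem_Icc (μ := signMeasure b H) (a := -1) (b := 1)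
        (X := fun e : List (Fin b) → ℝ => e []) (measurable_pi_apply []).aemeasurable (by
          filter_upwards [ae_abs_eq_one (b := b) (H := H)] with e he
          exact abs_le.1 (he []).le)
      have e : ∫ e : List (Fin b) → ℝ, e [] ∂(signMeasure b H) = (b : ℝ) ^ (H - 1) := by
        rw [← integral_id_signLaw hb hH1, ← (measurePreserving_eval (b := b) (H := H) []).map_eq,
          integral_map (measurable_pi_apply []).aemeasurable (by fun_prop)]
      rw [e] at this
      convert this using 1
      rw [show (1 - -1 : ℝ) = 2 by norm_num]
      ext; norm_num
    have h2 := hasSubgaussianMGF_sum ((measurable_pi_apply []).sub_const _) c h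
    convert h2 using 1
    · funext e
      simp only [totalDiff, total_succ, total_zero, mul_one, mul_sub, Finset.sum_sub_distrib]
      congr 1
      simp only [Finset.sum_const, Finset.card_univ, Fintype.card_fin, nsmul_eq_mul]
      -- The centring constants add up to `b * c * b ^ (H - 1) = 1`, which is the total of
      -- generation `0`.
      rw [hc, ← Real.rpow_add hb0, show -H + (H - 1) = -1 by ring, Real.rpow_neg_one,
        mul_inv_cancel₀ hb0.ne']
    · simp
  | succ n ih =>
    have h := hasSubgaussianMGF_root_mul hb hH1 (measurable_totalDiff _ n) (totalDiff_forget _ n) ih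
    have h2 := hasSubgaussianMGF_sum ((measurable_pi_apply []).mul (measurable_totalDiff _ n)) c h
    convert h2 using 1
    · funext e; exact totalDiff_succ _ _ _
    · ring

end SignCascade

namespace SignCascade

variable {b : ℕ} {H : ℝ}

/-! ### Random signs are tame -/

/-- Even moments of a sub-Gaussian random variable. -/
lemma lintegral_pow_le_of_hasSubgaussianMGF {Ω : Type*} [MeasurableSpace Ω] {μ : Measure Ω}
    {X : Ω → ℝ} {R : ℝ≥0} (hR : 0 < R) (h : HasSubgaussianMGF X (R ^ 2) μ) (p : ℕ) :
    ∫⁻ ω, ENNReal.ofReal ((X ω / R) ^ (2 * p)) ∂μ ≤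
      ENNReal.ofReal ((2 * p).factorial * (2 * Real.exp (1 / 2))) := by
  have hR' : (0 : ℝ) < R := hR
  have hi := h.integrable_exp_mul
  have h1 : ∀ ω, (X ω / R) ^ (2 * p) ≤ (2 * p).factorial *
      (Real.exp ((R : ℝ)⁻¹ * X ω) + Real.exp (-(R : ℝ)⁻¹ * X ω)) := by
    intro ω
    have h2 := Real.pow_div_factorial_le_exp _ (abs_nonneg (X ω / R)) (2 * p)
    rw [Even.pow_abs (even_two_mul p), div_le_iff₀' (by positivity)] at h2
    refine h2.trans (mul_le_mul_of_nonneg_left ?_ (by positivity))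
    have e1 := Real.exp_pos ((R : ℝ)⁻¹ * X ω)
    have e2 := Real.exp_pos (-(R : ℝ)⁻¹ * X ω)
    rcases abs_choice (X ω / R) with h | h
    · rw [h, div_eq_inv_mul]; linarith
    · rw [h, div_eq_inv_mul, ← neg_mul]; linarith
  calc ∫⁻ ω, ENNReal.ofReal ((X ω / R) ^ (2 * p)) ∂μ
      ≤ ∫⁻ ω, ENNReal.ofReal ((2 * p).factorial *
        (Real.exp ((R : ℝ)⁻¹ * X ω) + Real.exp (-(R : ℝ)⁻¹ * X ω))) ∂μ :=
        lintegral_mono fun ω => ENNReal.ofReal_le_ofReal (h1 ω)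
    _ = ENNReal.ofReal (∫ ω, (2 * p).factorial *
        (Real.exp ((R : ℝ)⁻¹ * X ω) + Real.exp (-(R : ℝ)⁻¹ * X ω)) ∂μ) := by
        refine (ofReal_integral_eq_lintegral_ofReal (((hi _).add (hi _)).const_mul _) ?_).symm
        exact ae_of_all _ fun ω => by simp only [Pi.add_apply, Pi.zero_apply]; positivity
    _ ≤ _ := by
        refine ENNReal.ofReal_le_ofReal ?_
        rw [integral_const_mul, integral_add (hi _) (hi _)]
        refine mul_le_mul_of_nonneg_left ?_ (by positivity)
        have m1 := h.mgf_le (R : ℝ)⁻¹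
        have m2 := h.mgf_le (-(R : ℝ)⁻¹)
        have hR2 : ((R ^ 2 : ℝ≥0) : ℝ) * (R : ℝ)⁻¹ ^ 2 / 2 = 1 / 2 := by
          rw [NNReal.coe_pow]; field_simp
        rw [neg_sq, hR2] at m2
        rw [hR2] at m1
        simp only [mgf] at m1 m2
        linarith

lemma tsum_pow_length_le (b : ℕ) (hb : 2 ≤ b) :
    ∑' w : List (Fin b), ENNReal.ofReal (((b : ℝ) ^ w.length)⁻¹ ^ 2) ≤ 2 := by
  have hb0 : (0 : ℝ) < b := by exact_mod_cast (by lia : 0 < b)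
  rw [← List.equivSigmaTuple.symm.tsum_eq, ENNReal.tsum_sigma (fun n (f : Fin n → Fin b) =>
    ENNReal.ofReal (((b : ℝ) ^ (List.equivSigmaTuple.symm ⟨n, f⟩).length)⁻¹ ^ 2))]
  simp only [List.equivSigmaTuple_symm_apply, List.length_ofFn, tsum_fintype, Finset.sum_const,
    Finset.card_univ, Fintype.card_fun, Fintype.card_fin]
  have h2 : ∑' n : ℕ, ((1 / 2 : ℝ≥0∞)) ^ n = 2 := by
    rw [ENNReal.tsum_geometric, one_div, ENNReal.one_sub_inv_two, inv_inv]
  rw [← h2]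
  refine ENNReal.tsum_le_tsum fun n => ?_
  rw [nsmul_eq_mul, ← ENNReal.ofReal_natCast, ← ENNReal.ofReal_mul (by positivity)]
  have : (1 / 2 : ℝ≥0∞) = ENNReal.ofReal (1 / 2) := by
    rw [ENNReal.ofReal_div_of_pos two_pos]; simp
  rw [this, ← ENNReal.ofReal_pow (by norm_num)]
  refine ENNReal.ofReal_le_ofReal ?_
  push_cast
  have : ((b : ℝ) ^ n) * ((b : ℝ) ^ n)⁻¹ ^ 2 = (1 / b) ^ n := by
    rw [one_div, inv_pow (b : ℝ) n, pow_two, ← mul_assoc, mul_inv_cancel₀ (by positivity), one_mul]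
  rw [this]
  refine pow_le_pow_left₀ (by positivity) (one_div_le_one_div_of_le two_pos ?_) n
  exact_mod_cast hb

variable [hprob : IsProbabilityMeasure (signLaw b H)]

/-- The weighted sum of the even moments of all the increments of totals. -/
def momentSum (c R : ℝ) (p : ℕ) (e : List (Fin b) → ℝ) : ℝ≥0∞ :=
  ∑' w : List (Fin b), ∑' n : ℕ, ENNReal.ofReal (((b : ℝ) ^ w.length)⁻¹ ^ 2) *
    (ENNReal.ofReal (((b : ℝ) ^ n)⁻¹ ^ 2) *
      ENNReal.ofReal ((totalDiff c n (shift w e) / R ^ (n + 1)) ^ (2 * p)))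

lemma measurable_momentSum (c R : ℝ) (p : ℕ) : Measurable (momentSum (b := b) c R p) := by
  refine Measurable.tsum fun w => Measurable.tsum fun n => ?_
  refine Measurable.const_mul (Measurable.const_mul ?_ _) _
  exact ((((measurable_totalDiff c n).comp (measurable_shift w)).div_const _).pow_const _).ennreal_ofReal

/-- After division by the standard deviation proxy `R ^ (n + 1)` the moments are bounded uniformly
in the word and the generation, so only the weights have to be summable; the squares in them beat
the `b ^ k` words of length `k`. -/
lemma lintegral_momentSum_lt_top (hb : 2 ≤ b) (hH1 : H ≤ 1) (c R : ℝ≥0) (hR : 0 < R)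
    (hc : (c : ℝ) = (b : ℝ) ^ (-H)) (hRc : R ^ 2 = b * c ^ 2) (p : ℕ) :
    ∫⁻ e, momentSum (b := b) c R p e ∂(signMeasure b H) < ∞ := by
  have hmeas : ∀ (w : List (Fin b)) (n : ℕ), Measurable fun e : List (Fin b) → ℝ =>
      ENNReal.ofReal ((totalDiff c n (shift w e) / R ^ (n + 1)) ^ (2 * p)) := fun w n =>
    ((((measurable_totalDiff c n).comp
      (measurable_shift w)).div_const _).pow_const _).ennreal_ofReal
  set K := ENNReal.ofReal ((2 * p).factorial * (2 * Real.exp (1 / 2)))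
  have hK : ∀ (w : List (Fin b)) (n : ℕ), ∫⁻ e : List (Fin b) → ℝ,
      ENNReal.ofReal ((totalDiff c n (shift w e) / R ^ (n + 1)) ^ (2 * p)) ∂(signMeasure b H) ≤
      K := by
    intro w n
    have h := HasSubgaussianMGF.comp_shift (hasSubgaussianMGF_totalDiff hb hH1 c hc n) w
    rw [← hRc, ← pow_mul, mul_comm, pow_mul] at h
    have := lintegral_pow_le_of_hasSubgaussianMGF (pow_pos hR (n + 1)) h p
    simpa only [NNReal.coe_pow] using this
  calc ∫⁻ e, momentSum (b := b) c R p e ∂(signMeasure b H)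
      = ∑' w : List (Fin b), ∑' n : ℕ, ENNReal.ofReal (((b : ℝ) ^ w.length)⁻¹ ^ 2) *
        (ENNReal.ofReal (((b : ℝ) ^ n)⁻¹ ^ 2) * ∫⁻ e : List (Fin b) → ℝ,
          ENNReal.ofReal ((totalDiff c n (shift w e) / R ^ (n + 1)) ^ (2 * p))
            ∂(signMeasure b H)) := by
        unfold momentSum
        rw [lintegral_tsum fun w => (Measurable.tsum fun n =>
          ((hmeas w n).const_mul _).const_mul _).aemeasurable]
        refine tsum_congr fun w => ?_
        rw [lintegral_tsum fun n => (((hmeas w n).const_mul _).const_mul _).aemeasurable]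
        refine tsum_congr fun n => ?_
        rw [lintegral_const_mul _ ((hmeas w n).const_mul _), lintegral_const_mul _ (hmeas w n)]
    _ ≤ ∑' w : List (Fin b), ∑' n : ℕ, ENNReal.ofReal (((b : ℝ) ^ w.length)⁻¹ ^ 2) *
        (ENNReal.ofReal (((b : ℝ) ^ n)⁻¹ ^ 2) * K) :=
        ENNReal.tsum_le_tsum fun w => ENNReal.tsum_le_tsum fun n => by gcongr; exact hK w n
    _ = (∑' w : List (Fin b), ENNReal.ofReal (((b : ℝ) ^ w.length)⁻¹ ^ 2)) *
        ((∑' n : ℕ, ENNReal.ofReal (((b : ℝ) ^ n)⁻¹ ^ 2)) * K) := by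
        simp_rw [ENNReal.tsum_mul_left, ENNReal.tsum_mul_right]
    _ < ∞ := by
        refine ENNReal.mul_lt_top ((tsum_pow_length_le b hb).trans_lt (by simp))
          (ENNReal.mul_lt_top ?_ ENNReal.ofReal_lt_top)
        have hb1 : (1 : ℝ) < b := by exact_mod_cast (by lia : 1 < b)
        have hs : Summable fun n : ℕ => ((b : ℝ) ^ n)⁻¹ ^ 2 := by
          have : (fun n : ℕ => ((b : ℝ) ^ n)⁻¹ ^ 2) = fun n => (((b : ℝ)⁻¹) ^ 2) ^ n := by
            funext n; rw [← inv_pow, ← pow_mul, ← pow_mul, mul_comm]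
          rw [this]
          refine summable_geometric_of_lt_one (by positivity) ?_
          exact pow_lt_one₀ (by positivity) (inv_lt_one_of_one_lt₀ hb1) two_ne_zero
        rw [← ENNReal.ofReal_tsum_of_nonneg (fun n => by positivity) hs]
        exact ENNReal.ofReal_lt_top

/-- The random constant in the geometric bound of the increments of totals. -/
def tameConst (c R : ℝ) (p : ℕ) (e : List (Fin b) → ℝ) : ℝ :=
  Real.sqrt (1 + (momentSum c R p e).toReal)

lemma one_le_tameConst (c R : ℝ) (p : ℕ) (e : List (Fin b) → ℝ) : 1 ≤ tameConst c R p e := by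
  rw [tameConst, Real.one_le_sqrt]
  linarith [ENNReal.toReal_nonneg (a := momentSum c R p e)]

lemma measurable_tameConst (c R : ℝ) (p : ℕ) : Measurable (tameConst (b := b) c R p) :=
  ((measurable_momentSum c R p).ennreal_toReal.const_add 1).sqrt

lemma memLp_tameConst (hb : 2 ≤ b) (hH1 : H ≤ 1) (c R : ℝ≥0) (hR : 0 < R)
    (hc : (c : ℝ) = (b : ℝ) ^ (-H)) (hRc : R ^ 2 = b * c ^ 2) (p : ℕ) :
    MemLp (tameConst (b := b) c R p) 2 (signMeasure b H) := by
  rw [memLp_two_iff_integrable_sq (measurable_tameConst _ _ _).aestronglyMeasurable]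
  have : (fun e => tameConst (b := b) c R p e ^ 2) =
      fun e => 1 + (momentSum (b := b) c R p e).toReal := by
    funext e
    rw [tameConst, Real.sq_sqrt]
    linarith [ENNReal.toReal_nonneg (a := momentSum (b := b) c R p e)]
  rw [this]
  refine (integrable_const 1).add (integrable_toReal_of_lintegral_ne_top
    (measurable_momentSum _ _ _).aemeasurable ?_)
  exact (lintegral_momentSum_lt_top hb hH1 c R hR hc hRc p).ne

/-- Each term of the series is at most `M ^ 2`, hence at most `M ^ (2 * p)` as `M ≥ 1`. Taking roots
of order `2 * p` turns the weights into a loss of `b ^ (1 / p)` per letter and per generation. The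
square root in `tameConst` makes `M` square integrable whatever `p` is. -/
lemma tame_of_momentSum_ne_top (hb : 2 ≤ b) {c R : ℝ} (hR : 0 < R) (hR1 : R ≤ 1) {p : ℕ}
    (hp : p ≠ 0) {e : List (Fin b) → ℝ} (he : ∀ u, |e u| = 1) (h : momentSum c R p e ≠ ∞) :
    Tame c (tameConst c R p e) (R * (b : ℝ) ^ (1 / p : ℝ)) ((b : ℝ) ^ (1 / p : ℝ)) e where
  abs_eq := he
  diff_le w n := by
    have hb0 : (0 : ℝ) < b := by exact_mod_cast (by lia : 0 < b)
    set M := tameConst c R p e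
    have hM1 : 1 ≤ M := one_le_tameConst c R p e
    set a : ℝ := (b : ℝ) ^ (1 / p : ℝ) with ha
    have ha0 : 0 < a := Real.rpow_pos_of_pos hb0 _
    have hap : a ^ p = b := by
      rw [ha, ← Real.rpow_natCast, ← Real.rpow_mul hb0.le,
        one_div_mul_cancel (Nat.cast_ne_zero.2 hp), Real.rpow_one]
    set D := totalDiff c n (shift w e)
    have h1 : ENNReal.ofReal (((b : ℝ) ^ w.length)⁻¹ ^ 2 * (((b : ℝ) ^ n)⁻¹ ^ 2 *
        (D / R ^ (n + 1)) ^ (2 * p))) ≤ momentSum c R p e := by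
      rw [ENNReal.ofReal_mul (by positivity), ENNReal.ofReal_mul (by positivity)]
      exact (ENNReal.le_tsum n).trans (ENNReal.le_tsum (f := fun w : List (Fin b) =>
        ∑' n : ℕ, ENNReal.ofReal (((b : ℝ) ^ w.length)⁻¹ ^ 2) *
          (ENNReal.ofReal (((b : ℝ) ^ n)⁻¹ ^ 2) *
          ENNReal.ofReal ((totalDiff c n (shift w e) / R ^ (n + 1)) ^ (2 * p)))) w)
    rw [ENNReal.ofReal_le_iff_le_toReal h] at h1
    have h2 : (momentSum c R p e).toReal ≤ M ^ 2 := by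
      rw [show M ^ 2 = _ from Real.sq_sqrt (by positivity)]; linarith
    have h3 : M ^ 2 ≤ M ^ (2 * p) := pow_le_pow_right₀ hM1 (by lia)
    have h4 : (|D| / R ^ (n + 1) / (a ^ w.length * a ^ n)) ^ (2 * p) ≤ M ^ (2 * p) := by
      refine le_trans (le_of_eq ?_) (h1.trans (h2.trans h3))
      rw [← hap, div_pow, div_pow, div_pow, Even.pow_abs (even_two_mul p), mul_pow]
      field_simp
      rw [← pow_mul, ← pow_mul, ← pow_mul, ← pow_mul, ← pow_mul, ← pow_mul]
      ring
    have h5 := le_of_pow_le_pow_left₀ (by lia) (by linarith) h4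
    rw [div_le_iff₀ (by positivity), div_le_iff₀ (by positivity)] at h5
    refine h5.trans ?_
    calc M * (a ^ w.length * a ^ n) * R ^ (n + 1)
        = M * (R * a) ^ n * a ^ w.length * R := by rw [mul_pow, pow_succ]; ring
      _ ≤ M * (R * a) ^ n * a ^ w.length * 1 := by gcongr
      _ = _ := mul_one _

lemma ae_tame (hb : 2 ≤ b) (hH1 : H ≤ 1) (c R : ℝ≥0) (hR : 0 < R) (hR1 : R ≤ 1)
    (hc : (c : ℝ) = (b : ℝ) ^ (-H)) (hRc : R ^ 2 = b * c ^ 2) {p : ℕ} (hp : p ≠ 0) :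
    ∀ᵐ e ∂(signMeasure b H), Tame (b := b) c (tameConst c R p e) (R * (b : ℝ) ^ (1 / p : ℝ))
      ((b : ℝ) ^ (1 / p : ℝ)) e := by
  filter_upwards [ae_abs_eq_one, ae_lt_top (measurable_momentSum c R p)
    (lintegral_momentSum_lt_top hb hH1 c R hR hc hRc p).ne] with e he hM
  exact tame_of_momentSum_ne_top hb hR hR1 hp he hM.ne

end SignCascade

namespace SignCascade

variable {b : ℕ} {H : ℝ}

/-! ### Convergence of the cascade -/

/-- The ramp of a word as a continuous function. -/
def rampMap {n : ℕ} (w : Fin n → Fin b) : C(I, ℝ) where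
  toFun t := ramp w t
  continuous_toFun := by unfold ramp; fun_prop

lemma path_eq_sum_smul (b : ℕ) (H : ℝ) (e : List (Fin b) → ℝ) (n : ℕ) :
    path b H e n =
      ∑ w : Fin n → Fin b, ((b : ℝ) ^ (-((n : ℝ) * H)) * signProd e w) • rampMap w := by
  ext t
  simp [path, rampMap, ContinuousMap.sum_apply]

lemma length_wordPrefix_le {n : ℕ} (w : Fin n → Fin b) (k : ℕ) : (wordPrefix w k).length ≤ n := by
  simp [wordPrefix]

lemma measurable_signProd {Ω : Type*} [MeasurableSpace Ω] {ε : List (Fin b) → Ω → ℝ} {n : ℕ}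
    (hε : ∀ w, w.length ≤ n → Measurable (ε w)) (w : Fin n → Fin b) :
    Measurable fun ω => signProd (fun u => ε u ω) w :=
  Finset.measurable_prod _ fun _ _ => hε _ (length_wordPrefix_le _ _)

lemma stronglyMeasurable_cascade {Ω : Type*} [MeasurableSpace Ω] {ε : List (Fin b) → Ω → ℝ}
    {n : ℕ} (hε : ∀ w, w.length ≤ n → Measurable (ε w)) :
    StronglyMeasurable (cascade b H ε n) := by
  have : cascade b H ε n = fun ω => ∑ w : Fin n → Fin b,
      ((b : ℝ) ^ (-((n : ℝ) * H)) * signProd (fun u => ε u ω) w) • rampMap w :=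
    funext fun ω => path_eq_sum_smul b H _ n
  rw [this]
  refine Finset.stronglyMeasurable_fun_sum _ fun w _ => ?_
  exact ((measurable_signProd hε w).const_mul _).stronglyMeasurable.smul_const _

lemma stronglyMeasurable_path (b : ℕ) (H : ℝ) (n : ℕ) :
    StronglyMeasurable fun e => path b H e n := by
  have h := stronglyMeasurable_cascade (b := b) (H := H) (n := n)
    (ε := fun w (e : List (Fin b) → ℝ) => e w) fun w _ => measurable_pi_apply w
  exact h

lemma abs_signProd {e : List (Fin b) → ℝ} (he : ∀ u, |e u| = 1) {n : ℕ} (w : Fin n → Fin b) :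
    |signProd e w| = 1 := by
  rw [signProd, Finset.abs_prod]
  exact Finset.prod_eq_one fun k _ => he _

lemma norm_path_le {e : List (Fin b) → ℝ} (he : ∀ u, |e u| = 1) (n : ℕ) :
    ‖path b H e n‖ ≤ ∑ w : Fin n → Fin b, (b : ℝ) ^ (-((n : ℝ) * H)) * ‖rampMap w‖ := by
  rw [path_eq_sum_smul]
  refine (norm_sum_le _ _).trans (Finset.sum_le_sum fun w _ => ?_)
  rw [norm_smul, Real.norm_eq_abs, abs_mul, abs_signProd he, mul_one, abs_of_nonneg]
  positivity

/-- The ratio `b ^ (-H)` of the cascade. -/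
def ratio (b : ℕ) (H : ℝ) : ℝ≥0 := (b : ℝ≥0) ^ (-H)

lemma coe_ratio (b : ℕ) (H : ℝ) : (ratio b H : ℝ) = (b : ℝ) ^ (-H) := by
  rw [ratio, NNReal.coe_rpow, NNReal.coe_natCast]

/-- The rate of decay of the increments of the totals. -/
def rate (b : ℕ) (H : ℝ) : ℝ≥0 := (b : ℝ≥0) ^ (1 / 2 - H)

lemma coe_rate (b : ℕ) (H : ℝ) : (rate b H : ℝ) = (b : ℝ) ^ (1 / 2 - H) := by
  rw [rate, NNReal.coe_rpow, NNReal.coe_natCast]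

lemma rate_sq (hb : 2 ≤ b) : rate b H ^ 2 = b * ratio b H ^ 2 := by
  have hb0 : (0 : ℝ) < b := by exact_mod_cast (by lia : 0 < b)
  refine NNReal.eq ?_
  rw [NNReal.coe_pow, NNReal.coe_mul, NNReal.coe_pow, coe_rate, coe_ratio, NNReal.coe_natCast,
    sub_eq_add_neg, Real.rpow_add hb0, mul_pow, ← Real.sqrt_eq_rpow, Real.sq_sqrt hb0.le]

lemma rate_pos (hb : 2 ≤ b) (H : ℝ) : 0 < rate b H :=
  NNReal.rpow_pos (by exact_mod_cast (by lia : 0 < b))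

lemma rate_lt_one (hb : 2 ≤ b) (hH : 1 / 2 < H) : rate b H < 1 :=
  NNReal.rpow_lt_one_of_one_lt_of_neg (by exact_mod_cast (by lia : 1 < b)) (by linarith)

lemma ratio_le_rate (hb : 2 ≤ b) (H : ℝ) : ratio b H ≤ rate b H :=
  NNReal.rpow_le_rpow_of_exponent_le (by exact_mod_cast (by lia : 1 ≤ b)) (by linarith)

lemma ratio_pos (hb : 2 ≤ b) (H : ℝ) : 0 < ratio b H :=
  NNReal.rpow_pos (by exact_mod_cast (by lia : 0 < b))

/-- The growth in the word of the constants of tame signs, for moments of order `2 * p`. -/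
def growth (b p : ℕ) : ℝ := (b : ℝ) ^ (1 / p : ℝ)

/-- The rate of convergence of the cascade obtained from moments of order `2 * p`. -/
def speed (b : ℕ) (H : ℝ) (p : ℕ) : ℝ := (1 + rate b H * growth b p) / 2

lemma tendsto_growth (hb : 2 ≤ b) : Tendsto (growth b) atTop (𝓝 1) := by
  have h : Tendsto (fun p : ℕ => (1 / p : ℝ)) atTop (𝓝 0) := tendsto_one_div_atTop_nhds_zero_nat
  have hb0 : (b : ℝ) ≠ 0 := by exact_mod_cast (by lia : b ≠ 0)
  have h2 := (tendsto_const_nhds (x := (b : ℝ))).rpow h (Or.inl hb0)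
  rw [Real.rpow_zero] at h2
  exact h2

/-- `H > 1/2` makes `rate` smaller than `1`. As `growth` tends to `1`, the product stays below `1`
for large `p`, and `speed` is the midpoint between that product and `1`. -/
lemma eventually_rates (hb : 2 ≤ b) (hH : 1 / 2 < H) :
    ∀ᶠ p in atTop, p ≠ 0 ∧
      Rates (ratio b H) (rate b H * growth b p) (growth b p) (speed b H p) := by
  have h1 : Tendsto (fun p => rate b H * growth b p) atTop (𝓝 (rate b H * 1)) :=
    (tendsto_growth hb).const_mul _
  have h2 : (rate b H : ℝ) * 1 < 1 := by
    rw [mul_one]; exact_mod_cast rate_lt_one hb hH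
  filter_upwards [h1.eventually_lt_const h2, eventually_ne_atTop 0] with p hp hp0
  have hb1 : (1 : ℝ) ≤ b := by exact_mod_cast (by lia : 1 ≤ b)
  have hg : 1 ≤ growth b p := Real.one_le_rpow hb1 (by positivity)
  have hc : (ratio b H : ℝ) ≤ rate b H := by exact_mod_cast ratio_le_rate hb H
  refine ⟨hp0, ⟨by exact_mod_cast ratio_pos hb H, hg, by positivity, ?_, ?_, ?_⟩⟩
  · unfold speed; linarith
  · have : ratio b H * growth b p ≤ rate b H * growth b p := by gcongr
    unfold speed; linarith
  · unfold speed; linarith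

lemma Tame.norm_path_sub_le {c M s a ρ : ℝ} {e : List (Fin b) → ℝ} [NeZero b]
    (he : Tame c M s a e) (hr : Rates c s a ρ) (hM : 1 ≤ M) (hc : c = (b : ℝ) ^ (-H))
    {f : C(I, ℝ)} (hf : ∀ t : I, f t = lim c e t) (n : ℕ) :
    ‖path b H e n - f‖ ≤ diffConst b c a ρ / (1 - ρ) * ρ ^ n * M := by
  have h1 := diffConst_nonneg b hr
  have h2 := sub_pos.2 hr.rho_lt
  have h3 := hr.rho_pos
  rw [ContinuousMap.norm_le _ (by positivity)]
  intro t
  rw [ContinuousMap.sub_apply, path_apply, ← hc, hf, Real.norm_eq_abs]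
  refine (he.abs_cas_sub_lim_le hr hM t n).trans (le_of_eq (by ring))

lemma Tame.exists_continuousMap {c M s a ρ : ℝ} {e : List (Fin b) → ℝ} [NeZero b]
    (he : Tame c M s a e) (hr : Rates c s a ρ) (hM : 1 ≤ M) (hc : c = (b : ℝ) ^ (-H)) :
    ∃ f : C(I, ℝ), Tendsto (fun n => path b H e n) atTop (𝓝 f) := by
  refine cauchySeq_tendsto_of_complete
    (cauchySeq_of_le_geometric ρ (diffConst b c a ρ * M) hr.rho_lt fun n => ?_)
  have h1 := diffConst_nonneg b hr
  have h3 := hr.rho_pos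
  rw [ContinuousMap.dist_le (by positivity)]
  intro t
  rw [path_apply, path_apply, ← hc]
  exact he.dist_cas_le hr hM t n

lemma Tame.apply_eq_lim_of_tendsto {c : ℝ} {e : List (Fin b) → ℝ} [NeZero b]
    (hc : c = (b : ℝ) ^ (-H)) {f : C(I, ℝ)}
    (hf : Tendsto (fun n => path b H e n) atTop (𝓝 f)) (t : I) : f t = lim c e t := by
  have h : Tendsto (fun n => path b H e n t) atTop (𝓝 (f t)) :=
    ((continuous_eval_const t).tendsto f).comp hf
  simp only [path_apply, ← hc] at h
  exact h.limUnder_eq.symm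

variable [hprob : IsProbabilityMeasure (signLaw b H)]

lemma ae_tame_of_ne_zero (hb : 2 ≤ b) (hH : 1 / 2 < H) (hH1 : H ≤ 1) {p : ℕ} (hp : p ≠ 0) :
    ∀ᵐ e ∂(signMeasure b H), Tame (b := b) (ratio b H) (tameConst (ratio b H) (rate b H) p e)
      (rate b H * growth b p) (growth b p) e :=
  ae_tame hb hH1 _ _ (rate_pos hb H) (rate_lt_one hb hH).le (coe_ratio b H) (rate_sq hb) hp

/-- The uniform error is a deterministic geometric factor times a square integrable constant, so
almost sure and `L²` convergence come from the same estimate. -/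
lemma exists_limit (hb : 2 ≤ b) (hH : 1 / 2 < H) (hH1 : H ≤ 1) :
    ∃ B : (List (Fin b) → ℝ) → C(I, ℝ), StronglyMeasurable B ∧
      (∀ᵐ e ∂(signMeasure b H), Tendsto (fun n => path b H e n) atTop (𝓝 (B e))) ∧
      (∀ n, MemLp (fun e => path b H e n) 2 (signMeasure b H)) ∧
      MemLp B 2 (signMeasure b H) ∧
      Tendsto (fun n => eLpNorm (fun e => path b H e n - B e) 2 (signMeasure b H))
        atTop (𝓝 0) := by
  have : NeZero b := ⟨by lia⟩
  obtain ⟨p, hp, hr⟩ := (eventually_rates hb hH).exists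
  have htame := ae_tame_of_ne_zero (b := b) hb hH hH1 hp
  obtain ⟨B, hB, hlim⟩ := exists_stronglyMeasurable_limit_of_tendsto_ae (μ := signMeasure b H)
    (f := fun n e => path b H e n) (fun n => (stronglyMeasurable_path b H n).aestronglyMeasurable)
    (htame.mono fun e he => he.exists_continuousMap hr (one_le_tameConst _ _ _ _) (coe_ratio b H))
  set C := diffConst b (ratio b H) (growth b p) (speed b H p) / (1 - speed b H p) with hC
  have hbound : ∀ n, ∀ᵐ e ∂(signMeasure b H), ‖path b H e n - B e‖ ≤
      C * speed b H p ^ n * ‖tameConst (ratio b H) (rate b H) p e‖ := by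
    intro n
    filter_upwards [htame, hlim] with e he hl
    refine (he.norm_path_sub_le hr (one_le_tameConst _ _ _ _) (coe_ratio b H)
      (Tame.apply_eq_lim_of_tendsto (coe_ratio b H) hl) n).trans ?_
    have := hr.rho_pos
    have h1 := diffConst_nonneg b hr
    have h2 := sub_pos.2 hr.rho_lt
    gcongr
    exact le_abs_self _
  have hM := memLp_tameConst (b := b) hb hH1 _ _ (rate_pos hb H) (coe_ratio b H) (rate_sq hb) p
  have hpath : ∀ n, MemLp (fun e => path b H e n) 2 (signMeasure b H) := fun n =>
    MemLp.of_bound (stronglyMeasurable_path b H n).aestronglyMeasurable _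
      ((ae_abs_eq_one (b := b) (H := H)).mono fun e he => norm_path_le he n)
  have hsm : ∀ n, AEStronglyMeasurable (fun e => path b H e n - B e) (signMeasure b H) := fun n =>
    ((stronglyMeasurable_path b H n).sub hB).aestronglyMeasurable
  refine ⟨B, hB, hlim, hpath, ?_, ?_⟩
  -- `B` is written as `path 0 - (path 0 - B)`, where the second term is dominated by the tame
  -- constant.
  · have h := (hpath 0).sub (hM.of_le_mul (hsm 0) (hbound 0))
    exact (memLp_congr_ae (ae_of_all _ fun e => by simp)).1 h
  · have h1 : ∀ n, eLpNorm (fun e => path b H e n - B e) 2 (signMeasure b H) ≤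
        ENNReal.ofReal (C * speed b H p ^ n) *
          eLpNorm (tameConst (b := b) (ratio b H) (rate b H) p) 2 (signMeasure b H) := fun n =>
      eLpNorm_le_mul_eLpNorm_of_ae_le_mul (hbound n) 2
    have h2 : Tendsto (fun n => ENNReal.ofReal (C * speed b H p ^ n) *
          eLpNorm (tameConst (b := b) (ratio b H) (rate b H) p) 2 (signMeasure b H)) atTop
          (𝓝 (ENNReal.ofReal (C * 0) *
            eLpNorm (tameConst (b := b) (ratio b H) (rate b H) p) 2 (signMeasure b H))) := by
      refine ENNReal.Tendsto.mul_const ?_ (Or.inr hM.2.ne)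
      exact (ENNReal.continuous_ofReal.tendsto _).comp
        ((tendsto_pow_atTop_nhds_zero_of_lt_one hr.rho_pos.le hr.rho_lt).const_mul C)
    rw [mul_zero, ENNReal.ofReal_zero, zero_mul] at h2
    exact tendsto_of_tendsto_of_tendsto_of_le_of_le tendsto_const_nhds h2 (fun _ => zero_le) h1

end SignCascade

namespace SignCascade

variable {b : ℕ} {H : ℝ}

/-! ### The martingale property -/

lemma sum_range_clamp_sub (N : ℕ) (y : ℝ) :
    ∑ i ∈ Finset.range N, clamp (y - i) = max 0 (min (N : ℝ) y) := by
  induction N with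
  | zero => simp
  | succ N ih =>
    rw [Finset.sum_range_succ, ih, clamp]
    push_cast
    have hN : (0 : ℝ) ≤ N := Nat.cast_nonneg N
    rcases le_total y 0 with h | h
    · rw [max_eq_left, max_eq_left, max_eq_left]
      · simp
      · exact (min_le_right _ _).trans h
      · exact (min_le_right _ _).trans (by linarith)
      · exact (min_le_right _ _).trans h
    rcases le_total y N with h1 | h1
    · rw [min_eq_right h1, min_eq_right (by linarith : y - N ≤ 1),
        min_eq_right (by linarith : y ≤ N + 1), max_eq_left (by linarith : y - N ≤ 0), add_zero]
    rcases le_total y (N + 1) with h2 | h2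
    · rw [min_eq_left h1, min_eq_right (by linarith : y - N ≤ 1), min_eq_right h2,
        max_eq_right hN, max_eq_right (by linarith : 0 ≤ y - N), max_eq_right h]
      ring
    · rw [min_eq_left h1, min_eq_left (by linarith : 1 ≤ y - N), min_eq_left h2,
        max_eq_right hN, max_eq_right zero_le_one, max_eq_right (by linarith)]

/-- A ramp is the average of the ramps of its `b` children. This carries the martingale property,
and also the case `H = 1`. -/
lemma clamp_eq_sum [NeZero b] (y : ℝ) :
    clamp y = ∑ i : Fin b, (b : ℝ)⁻¹ * clamp (b * y - (i : ℕ)) := by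
  have hb : (0 : ℝ) < b := Nat.cast_pos.2 (NeZero.pos b)
  rw [← Finset.mul_sum, Fin.sum_univ_eq_sum_range (fun i : ℕ => clamp (b * y - i)),
    sum_range_clamp_sub, clamp, mul_max_of_nonneg _ _ (by positivity),
    mul_min_of_nonneg _ _ (by positivity), inv_mul_cancel₀ hb.ne', inv_mul_cancel_left₀ hb.ne',
    mul_zero]

lemma leftEnd_snoc {n : ℕ} (w : Fin n → Fin b) (i : Fin b) :
    leftEnd (Fin.snoc w i : Fin (n + 1) → Fin b) = leftEnd w + (i : ℕ) / (b : ℝ) ^ (n + 1) := by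
  rw [leftEnd, Fin.sum_univ_castSucc, leftEnd]
  simp

lemma rampMap_eq_sum [NeZero b] {n : ℕ} (w : Fin n → Fin b) :
    rampMap w =
      ∑ i : Fin b, (b : ℝ)⁻¹ • rampMap (Fin.snoc w i : Fin (n + 1) → Fin b) := by
  have hb : (b : ℝ) ≠ 0 := Nat.cast_ne_zero.2 (NeZero.ne b)
  ext t
  rw [ContinuousMap.sum_apply]
  change ramp w t = ∑ i : Fin b, (b : ℝ)⁻¹ * ramp (Fin.snoc w i : Fin (n + 1) → Fin b) t
  rw [ramp_eq, clamp_eq_sum (b := b)]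
  refine Finset.sum_congr rfl fun i _ => ?_
  rw [ramp_eq, leftEnd_snoc]
  congr 2
  field_simp
  ring

lemma signProd_snoc {n : ℕ} (e : List (Fin b) → ℝ) (w : Fin n → Fin b) (i : Fin b) :
    signProd e (Fin.snoc w i : Fin (n + 1) → Fin b) =
      signProd e w * e (List.ofFn (Fin.snoc w i : Fin (n + 1) → Fin b)) := by
  rw [signProd, Finset.prod_Icc_succ_top (by lia), signProd]
  congr 1
  · refine Finset.prod_congr rfl fun k hk => ?_
    rw [wordPrefix, wordPrefix, List.ofFn_succ']
    simp only [Fin.snoc_castSucc, Fin.snoc_last, List.concat_eq_append]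
    rw [List.take_append_of_le_length]
    simpa using (Finset.mem_Icc.1 hk).2
  · rw [wordPrefix, List.take_of_length_le (by simp)]

/-- Each term is arranged as a factor known at generation `n`, times a new independent sign, times a
deterministic function, ready for pulling out the known factor. -/
lemma cascade_succ {Ω : Type*} (b : ℕ) (H : ℝ) (ε : List (Fin b) → Ω → ℝ) (n : ℕ) :
    cascade b H ε (n + 1) = ∑ p : Fin b × (Fin n → Fin b),
      (fun ω => (b : ℝ) ^ (-((n : ℝ) * H)) * signProd (fun u => ε u ω) p.2) •
        fun ω => ε (List.ofFn (Fin.snoc p.2 p.1 : Fin (n + 1) → Fin b)) ω •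
          ((b : ℝ) ^ (-H) • rampMap (Fin.snoc p.2 p.1 : Fin (n + 1) → Fin b)) := by
  funext ω
  rw [cascade, path_eq_sum_smul, Finset.sum_apply,
    ← (Fin.snocEquiv fun _ : Fin (n + 1) => Fin b).sum_comp]
  refine Finset.sum_congr rfl fun p _ => ?_
  change ((b : ℝ) ^ (-(((n + 1 : ℕ) : ℝ) * H)) *
      signProd (fun u => ε u ω) (Fin.snoc p.2 p.1 : Fin (n + 1) → Fin b)) •
      rampMap (Fin.snoc p.2 p.1 : Fin (n + 1) → Fin b) =
    ((b : ℝ) ^ (-((n : ℝ) * H)) * signProd (fun u => ε u ω) p.2) •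
      ε (List.ofFn (Fin.snoc p.2 p.1 : Fin (n + 1) → Fin b)) ω •
      ((b : ℝ) ^ (-H) • rampMap (Fin.snoc p.2 p.1 : Fin (n + 1) → Fin b))
  rw [signProd_snoc, smul_smul, smul_smul]
  congr 1
  rcases eq_or_ne b 0 with rfl | hb
  · exact p.1.elim0
  have hb0 : (0 : ℝ) < b := Nat.cast_pos.2 (Nat.pos_of_ne_zero hb)
  have : (b : ℝ) ^ (-(((n + 1 : ℕ) : ℝ) * H)) = b ^ (-((n : ℝ) * H)) * b ^ (-H) := by
    rw [← Real.rpow_add hb0]; congr 1; push_cast; ring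
  rw [this]
  ring

variable {Ω : Type*} [mΩ : MeasurableSpace Ω] {P : Measure Ω} {ε : List (Fin b) → Ω → ℝ}

lemma measurable_cascadeFiltration (hε : ∀ w, Measurable (ε w)) (n : ℕ) {w : List (Fin b)}
    (hw : w.length ≤ n) : Measurable[cascadeFiltration ε hε n] (ε w) := by
  rw [measurable_iff_comap_le, BorelSpace.measurable_eq (α := ℝ)]
  exact le_iSup (fun v : {v : List (Fin b) // v.length ≤ n} =>
    MeasurableSpace.comap (ε v.1) (borel ℝ)) ⟨w, hw⟩

lemma indep_cascadeFiltration (hε : ∀ w, Measurable (ε w)) (hindep : iIndepFun ε P) {n : ℕ}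
    {w : List (Fin b)} (hw : n < w.length) :
    Indep (MeasurableSpace.comap (ε w) inferInstance) (cascadeFiltration ε hε n) P := by
  have hle : ∀ u, MeasurableSpace.comap (ε u) (inferInstance : MeasurableSpace ℝ) ≤ mΩ :=
    fun u => (hε u).comap_le
  have h := indep_iSup_of_disjoint hle ((iIndepFun_iff_iIndep _ _ _).1 hindep)
    (S := {w}) (T := {u | u.length ≤ n}) (by
      rw [Set.disjoint_singleton_left]; simpa using hw)
  refine indep_of_indep_of_le_left (indep_of_indep_of_le_right h ?_)
    (le_iSup₂_of_le w rfl le_rfl)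
  refine iSup_le fun v => le_iSup₂_of_le v.1 v.2 ?_
  rw [BorelSpace.measurable_eq (α := ℝ)]

lemma ae_abs_eq_one_of_law (hε : ∀ w, Measurable (ε w))
    (hlaw : ∀ w, P.map (ε w) = signLaw b H) : ∀ᵐ ω ∂P, ∀ w, |ε w ω| = 1 := by
  refine ae_all_iff.2 fun w => ?_
  have := ae_signLaw b H
  rw [← hlaw w] at this
  exact ae_of_ae_map (hε w).aemeasurable this

lemma integrable_cascade [IsProbabilityMeasure P] (hε : ∀ w, Measurable (ε w))
    (hlaw : ∀ w, P.map (ε w) = signLaw b H) (n : ℕ) : Integrable (cascade b H ε n) P := by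
  refine Integrable.of_bound (stronglyMeasurable_cascade fun w _ => hε w).aestronglyMeasurable
    (∑ w : Fin n → Fin b, (b : ℝ) ^ (-((n : ℝ) * H)) * ‖rampMap w‖) ?_
  · filter_upwards [ae_abs_eq_one_of_law hε hlaw] with ω hω
    exact norm_path_le hω n

/-- The new signs have mean `b ^ (H - 1)`; multiplied by the ratio `b ^ (-H)` this leaves `b⁻¹`, and
the average of the child ramps is the parent ramp. -/
theorem martingale_cascade (hb : 2 ≤ b) (hH1 : H ≤ 1) [IsProbabilityMeasure P]
    (hε : ∀ w, Measurable (ε w)) (hindep : iIndepFun ε P)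
    (hlaw : ∀ w, P.map (ε w) = signLaw b H) :
    Martingale (cascade b H ε) (cascadeFiltration ε hε) P := by
  have : NeZero b := ⟨by lia⟩
  have hb0 : (0 : ℝ) < b := Nat.cast_pos.2 (NeZero.pos b)
  have hadp : ∀ n, StronglyMeasurable[cascadeFiltration ε hε n] (cascade b H ε n) := fun n =>
    @stronglyMeasurable_cascade b H Ω (cascadeFiltration ε hε n) ε n fun w hw =>
      measurable_cascadeFiltration hε n hw
  refine martingale_nat hadp (fun n => integrable_cascade hε hlaw n) fun n => ?_
  have hF : cascadeFiltration ε hε n ≤ mΩ := (cascadeFiltration ε hε).le n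
  set A : (Fin n → Fin b) → Ω → ℝ := fun w ω =>
    (b : ℝ) ^ (-((n : ℝ) * H)) * signProd (fun u => ε u ω) w with hA
  set r : Fin b × (Fin n → Fin b) → C(I, ℝ) := fun p =>
    (b : ℝ) ^ (-H) • rampMap (Fin.snoc p.2 p.1 : Fin (n + 1) → Fin b)
  set g : Fin b × (Fin n → Fin b) → Ω → C(I, ℝ) := fun p ω =>
    ε (List.ofFn (Fin.snoc p.2 p.1 : Fin (n + 1) → Fin b)) ω • r p with hg
  have hAm : ∀ w, Measurable[cascadeFiltration ε hε n] (A w) := fun w =>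
    (@measurable_signProd b Ω (cascadeFiltration ε hε n) ε n (fun w hw => measurable_cascadeFiltration hε n hw)
      w).const_mul _
  have hsgn := ae_abs_eq_one_of_law hε hlaw
  have hεint : ∀ w, Integrable (ε w) P := fun w =>
    Integrable.of_bound (hε w).aestronglyMeasurable 1 (hsgn.mono fun ω h => (h w).le)
  have hgint : ∀ p, Integrable (g p) P := fun p => (hεint _).smul_const _
  have hAgint : ∀ p : Fin b × (Fin n → Fin b), Integrable (A p.2 • g p) P := by
    intro p
    refine (hgint p).bdd_smul ((b : ℝ) ^ (-((n : ℝ) * H)))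
      ((hAm p.2).mono hF le_rfl).aestronglyMeasurable ?_
    filter_upwards [hsgn] with ω hω
    rw [hA, Real.norm_eq_abs, abs_mul, abs_signProd hω, mul_one, abs_of_nonneg (by positivity)]
  have hmean : ∀ w, ∫ ω, ε w ω ∂P = (b : ℝ) ^ (H - 1) := by
    intro w
    rw [← integral_id_signLaw hb hH1, ← hlaw w,
      integral_map (hε w).aemeasurable (by fun_prop)]
  have hcond : ∀ p : Fin b × (Fin n → Fin b), P[A p.2 • g p | cascadeFiltration ε hε n] =ᵐ[P]
      fun ω => A p.2 ω • ((b : ℝ) ^ (H - 1) • r p) := by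
    intro p
    have h1 := condExp_smul_of_aestronglyMeasurable_left (m := cascadeFiltration ε hε n)
      (hAm p.2).stronglyMeasurable.aestronglyMeasurable (hAgint p) (hgint p)
    have hsm : StronglyMeasurable[MeasurableSpace.comap
        (ε (List.ofFn (Fin.snoc p.2 p.1 : Fin (n + 1) → Fin b))) inferInstance] (g p) :=
      (comap_measurable _).stronglyMeasurable.smul_const _
    have h2 := condExp_indep_eq (hε _).comap_le hF hsm (indep_cascadeFiltration hε hindep (by simp))
    filter_upwards [h1, h2] with ω h1 h2
    rw [h1, Pi.smul_apply', h2, hg, integral_smul_const, hmean]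
  have h3 : P[cascade b H ε (n + 1) | cascadeFiltration ε hε n] =ᵐ[P] ∑ p : Fin b × (Fin n → Fin b),
      P[A p.2 • g p | cascadeFiltration ε hε n] := by
    rw [cascade_succ]
    exact condExp_finsetSum (fun p _ => hAgint p) _
  have h4 : ∀ᵐ ω ∂P, ∀ p : Fin b × (Fin n → Fin b), (P[A p.2 • g p | cascadeFiltration ε hε n]) ω =
      A p.2 ω • ((b : ℝ) ^ (H - 1) • r p) := ae_all_iff.2 hcond
  filter_upwards [h3, h4] with ω h3 h4
  rw [h3, Finset.sum_apply, Finset.sum_congr rfl fun p _ => h4 p, Fintype.sum_prod_type_right,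
    cascade, path_eq_sum_smul]
  refine Finset.sum_congr rfl fun w _ => ?_
  rw [rampMap_eq_sum, Finset.smul_sum]
  refine Finset.sum_congr rfl fun i _ => ?_
  change _ = A w ω • ((b : ℝ) ^ (H - 1) • (b : ℝ) ^ (-H) •
    rampMap (Fin.snoc w i : Fin (n + 1) → Fin b))
  rw [smul_smul ((b : ℝ) ^ (H - 1)), ← Real.rpow_add hb0, show H - 1 + -H = -1 by ring, Real.rpow_neg_one]

end SignCascade

namespace SignCascade

variable {b : ℕ} {H : ℝ}

/-! ### The total increment of the limit -/

/-- The total increment of the limit of the cascade. -/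
def limTotal (c : ℝ) (e : List (Fin b) → ℝ) : ℝ := lim c e 1

lemma measurable_lim (c : ℝ) (x : ℝ) :
    Measurable fun e : List (Fin b) → ℝ => lim c e x :=
  (StronglyMeasurable.limUnder fun n =>
    ((measurable_cas c n).comp measurable_prodMk_right).stronglyMeasurable).measurable

lemma measurable_limTotal (c : ℝ) : Measurable (limTotal (b := b) c) := measurable_lim c 1

variable [hprob : IsProbabilityMeasure (signLaw b H)]

lemma integrable_total (hb : 2 ≤ b) (n : ℕ) :
    Integrable (total (b := b) (ratio b H) n) (signMeasure b H) := by
  have : NeZero b := ⟨by lia⟩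
  refine Integrable.of_bound (measurable_total _ n).aestronglyMeasurable
    (∑ w : Fin n → Fin b, (b : ℝ) ^ (-((n : ℝ) * H)) * ‖rampMap w‖) ?_
  filter_upwards [ae_abs_eq_one (b := b) (H := H)] with e he
  refine le_trans ?_ (norm_path_le (H := H) he n)
  have := (path b H e n).norm_coe_le_norm 1
  rwa [path_apply, ← coe_ratio] at this

lemma integral_comp_shift (w : List (Fin b)) {E : Type*} [NormedAddCommGroup E] [NormedSpace ℝ E]
    {φ : (List (Fin b) → ℝ) → E} (hφ : AEStronglyMeasurable φ (signMeasure b H)) :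
    ∫ e, φ (shift w e) ∂(signMeasure b H) = ∫ e, φ e ∂(signMeasure b H) := by
  have hw := measurePreserving_shift (b := b) (H := H) w
  conv_rhs => rw [← hw.map_eq]
  rw [integral_map hw.measurable.aemeasurable (by rwa [hw.map_eq])]

lemma integral_total (hb : 2 ≤ b) (hH1 : H ≤ 1) (n : ℕ) :
    ∫ e, total (b := b) (ratio b H) n e ∂(signMeasure b H) = 1 := by
  have hb0 : (0 : ℝ) < b := by exact_mod_cast (by lia : 0 < b)
  induction n with
  | zero => simp [total_zero]
  | succ n ih =>
    have hi := integrable_total (H := H) hb n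
    have hm := measurable_total (b := b) (ratio b H) n
    have hroot : ∫ e : List (Fin b) → ℝ, e [] * total (ratio b H) n e ∂(signMeasure b H) =
        (b : ℝ) ^ (H - 1) := by
      have h := integral_root_mul hb hH1 hm (fun e => cas_forget _ n e 1) (f := fun x : ℝ => x)
        measurable_id hi hi.neg
      rw [h, integral_neg, ih]
      simp only [RCLike.ofReal_real_eq_id, id_eq, plusProb]
      ring
    have hroot_int : Integrable (fun e : List (Fin b) → ℝ => e [] * total (ratio b H) n e)
        (signMeasure b H) := by
      refine hi.bdd_mul (c := 1) (measurable_pi_apply []).aestronglyMeasurable ?_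
      filter_upwards [ae_abs_eq_one (b := b) (H := H)] with e he
      exact (he []).le
    have hshift : ∀ i : Fin b, Integrable (fun e : List (Fin b) → ℝ =>
        shift [i] e [] * total (ratio b H) n (shift [i] e)) (signMeasure b H) := fun i =>
      (measurePreserving_shift (b := b) (H := H) [i]).integrable_comp_of_integrable hroot_int
    simp only [total_succ, mul_assoc]
    rw [integral_finsetSum _ fun i _ => (hshift i).const_mul _]
    have : ∀ i : Fin b, ∫ e : List (Fin b) → ℝ, (ratio b H : ℝ) *
        (shift [i] e [] * total (ratio b H) n (shift [i] e)) ∂(signMeasure b H) =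
        (ratio b H : ℝ) * (b : ℝ) ^ (H - 1) := by
      intro i
      rw [integral_const_mul, integral_comp_shift [i] hroot_int.1, hroot]
    rw [Finset.sum_congr rfl fun i _ => this i]
    simp only [Finset.sum_const, Finset.card_univ, Fintype.card_fin, nsmul_eq_mul]
    rw [coe_ratio, ← Real.rpow_add hb0, show -H + (H - 1) = -1 by ring, Real.rpow_neg_one,
      mul_inv_cancel₀ hb0.ne']

lemma memLp_limTotal (hb : 2 ≤ b) (hH : 1 / 2 < H) (hH1 : H ≤ 1) :
    MemLp (limTotal (b := b) (ratio b H)) 2 (signMeasure b H) := by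
  obtain ⟨p, hp, hr⟩ := (eventually_rates hb hH).exists
  have hM := memLp_tameConst (b := b) hb hH1 _ _ (rate_pos hb H) (coe_ratio b H) (rate_sq hb) p
  refine hM.of_le_mul (c := limConst b (ratio b H) (growth b p) (speed b H p))
    (measurable_limTotal _).aestronglyMeasurable ?_
  filter_upwards [ae_tame_of_ne_zero (b := b) hb hH hH1 hp] with e he
  refine (he.abs_lim_le hr (one_le_tameConst _ _ _ _) 1).trans ?_
  exact mul_le_mul_of_nonneg_left (le_abs_self _) (limConst_nonneg b hr)

/-- Dominated convergence: the totals are all bounded by a multiple of the integrable tame constant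
and all have mean `1`. -/
lemma integral_limTotal (hb : 2 ≤ b) (hH : 1 / 2 < H) (hH1 : H ≤ 1) :
    ∫ e, limTotal (b := b) (ratio b H) e ∂(signMeasure b H) = 1 := by
  obtain ⟨p, hp, hr⟩ := (eventually_rates hb hH).exists
  have hM := memLp_tameConst (b := b) hb hH1 _ _ (rate_pos hb H) (coe_ratio b H) (rate_sq hb) p
  have htame := ae_tame_of_ne_zero (b := b) hb hH hH1 hp
  set C := diffConst b (ratio b H) (growth b p) (speed b H p) / (1 - speed b H p) with hC
  set L := limConst b (ratio b H) (growth b p) (speed b H p)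
  have h1 := diffConst_nonneg b hr
  have h2 := sub_pos.2 hr.rho_lt
  have hC0 : 0 ≤ C := div_nonneg h1 h2.le
  have h : Tendsto (fun n => ∫ e, total (b := b) (ratio b H) n e ∂(signMeasure b H)) atTop
      (𝓝 (∫ e, limTotal (b := b) (ratio b H) e ∂(signMeasure b H))) := by
    refine tendsto_integral_of_dominated_convergence
      (fun e => (C + L) * tameConst (ratio b H) (rate b H) p e)
      (fun n => (measurable_total _ n).aestronglyMeasurable)
      ((hM.integrable one_le_two).const_mul _) (fun n => ?_) ?_
    · filter_upwards [htame] with e he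
      have hM1 := one_le_tameConst (ratio b H) (rate b H) p e
      have g1 := he.abs_lim_le hr hM1 1
      have g2 := he.abs_cas_sub_lim_le hr hM1 1 n
      have g3 : speed b H p ^ n ≤ 1 := pow_le_one₀ hr.rho_pos.le hr.rho_lt.le
      have g4 : diffConst b (ratio b H) (growth b p) (speed b H p) *
          tameConst (ratio b H) (rate b H) p e * speed b H p ^ n / (1 - speed b H p) ≤
          C * tameConst (ratio b H) (rate b H) p e := by
        have : 0 ≤ C * tameConst (ratio b H) (rate b H) p e :=
          mul_nonneg hC0 (zero_le_one.trans hM1)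
        calc _ = C * tameConst (ratio b H) (rate b H) p e * speed b H p ^ n := by
              rw [hC]; ring
          _ ≤ _ := mul_le_of_le_one_right this g3
      rw [Real.norm_eq_abs, total]
      have g5 := abs_add_le (cas (ratio b H : ℝ) n e 1 - lim (ratio b H) e 1)
        (lim (ratio b H) e 1)
      rw [sub_add_cancel] at g5
      linarith
    · filter_upwards [htame] with e he
      exact he.tendsto_lim hr (one_le_tameConst _ _ _ _) 1
  simp only [integral_total hb hH1] at h
  exact tendsto_nhds_unique h tendsto_const_nhds

/-! ### Uniform lower bounds for the oscillations -/

/-- All the limit totals at the words of length `m` are smaller than one half. -/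
def smallTotals (c : ℝ) : ℕ → Set (List (Fin b) → ℝ)
  | 0 => {e | |limTotal c e| < 1 / 2}
  | m + 1 => ⋂ i : Fin b, shift [i] ⁻¹' smallTotals c m

lemma exists_of_notMem_smallTotals {c : ℝ} {m : ℕ} {e : List (Fin b) → ℝ}
    (h : e ∉ smallTotals c m) :
    ∃ u : List (Fin b), u.length = m ∧ 1 / 2 ≤ |limTotal c (shift u e)| := by
  induction m generalizing e with
  | zero => exact ⟨[], rfl, not_lt.1 h⟩
  | succ m ih =>
    rw [smallTotals, Set.mem_iInter] at h
    push Not at h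
    obtain ⟨i, hi⟩ := h
    obtain ⟨u, hu, hle⟩ := ih hi
    exact ⟨i :: u, by simp [hu], by rwa [shift_cons] at hle⟩

lemma measurableSet_smallTotals (c : ℝ) (m : ℕ) :
    MeasurableSet (smallTotals (b := b) c m) := by
  induction m with
  | zero => exact measurableSet_lt (measurable_limTotal c).abs measurable_const
  | succ m ih => exact MeasurableSet.iInter fun i => measurable_shift [i] ih

/-- The subtrees at the `b ^ m` words of length `m` are independent copies of the whole tree; the
induction goes through the first letter. -/
lemma measure_smallTotals (c : ℝ) (m : ℕ) : signMeasure b H (smallTotals c m) =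
    signMeasure b H (smallTotals c 0) ^ b ^ m := by
  induction m with
  | zero => simp
  | succ m ih =>
    have h := (iIndepFun_shift (b := b) (H := H)).measure_inter_preimage_eq_mul Finset.univ
      (sets := fun _ => smallTotals c m) fun _ _ => measurableSet_smallTotals c m
    simp only [Finset.mem_univ, Set.iInter_true] at h
    change signMeasure b H (⋂ i : Fin b, shift [i] ⁻¹' smallTotals c m) = _
    rw [h, Finset.prod_congr rfl fun i _ =>
      (measurePreserving_shift (b := b) (H := H) [i]).measure_preimage
        (measurableSet_smallTotals c m).nullMeasurableSet, ih]
    simp [← pow_mul, pow_succ]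

/-- Otherwise the limit total would have a mean of modulus at most `1/2`, whereas its mean is `1`.
-/
lemma measure_smallTotals_zero_lt_one (hb : 2 ≤ b) (hH : 1 / 2 < H) (hH1 : H ≤ 1) :
    signMeasure b H (smallTotals (ratio b H) 0) < 1 := by
  refine lt_of_le_of_ne prob_le_one fun h => ?_
  replace h : ∀ᵐ e ∂(signMeasure b H), e ∈ smallTotals (ratio b H : ℝ) 0 :=
    (mem_ae_iff_prob_eq_one (measurableSet_smallTotals _ 0)).2 h
  have h1 : ‖∫ e, limTotal (b := b) (ratio b H) e ∂(signMeasure b H)‖ ≤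
      1 / 2 * (signMeasure b H).real Set.univ :=
    norm_integral_le_of_norm_le_const (h.mono fun e he => le_of_lt he)
  rw [integral_limTotal hb hH hH1] at h1
  norm_num at h1

/-- With `x = b ^ m` the left side is at most `x ^ k * exp (-l x)`, and the exponential series gives
`O(1 / x)`. -/
lemma exists_pow_mul_pow_pow_le (hb : 2 ≤ b) (k : ℕ) {q : ℝ} (hq0 : 0 ≤ q) (hq : q < 1) :
    ∃ C : ℝ, 0 ≤ C ∧ ∀ m : ℕ, ((b : ℝ) ^ m) ^ k * q ^ b ^ m ≤ C * ((b : ℝ)⁻¹) ^ m := by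
  have hb0 : (0 : ℝ) < b := by exact_mod_cast (by lia : 0 < b)
  -- For `q = 0` the logarithm carries no information, and any positive `l` serves.
  obtain ⟨l, hl0, hl⟩ : ∃ l : ℝ, 0 < l ∧ q ≤ Real.exp (-l) := by
    rcases hq0.eq_or_lt with h | h
    · exact ⟨1, one_pos, by rw [← h]; positivity⟩
    · exact ⟨-Real.log q, neg_pos.2 (Real.log_neg h hq), by rw [neg_neg, Real.exp_log h]⟩
  refine ⟨(k + 1).factorial / l ^ (k + 1), by positivity, fun m => ?_⟩
  set x : ℝ := (b : ℝ) ^ m with hx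
  have hx0 : 0 < x := by positivity
  have h1 : q ^ b ^ m ≤ Real.exp (-(l * x)) := by
    refine (pow_le_pow_left₀ hq0 hl _).trans (le_of_eq ?_)
    rw [← Real.exp_nat_mul]; push_cast; congr 1; ring
  have h2 := Real.pow_div_factorial_le_exp _ (mul_pos hl0 hx0).le (k + 1)
  have h3 : Real.exp (-(l * x)) ≤ (k + 1).factorial / (l * x) ^ (k + 1) := by
    rw [Real.exp_neg, inv_le_comm₀ (Real.exp_pos _) (by positivity), inv_div]
    exact h2
  calc x ^ k * q ^ b ^ m ≤ x ^ k * ((k + 1).factorial / (l * x) ^ (k + 1)) := by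
        gcongr; exact h1.trans h3
    _ = (k + 1).factorial / l ^ (k + 1) * ((b : ℝ)⁻¹) ^ m := by
        rw [inv_pow, ← hx, mul_pow, pow_succ x k]; field_simp

/-- Borel-Cantelli over all words of length `k * m` at once; the uniformity in the word is what
later handles every point simultaneously. -/
lemma ae_eventually_notMem_smallTotals (hb : 2 ≤ b) (hH : 1 / 2 < H) (hH1 : H ≤ 1) :
    ∀ᵐ e ∂(signMeasure b H), ∀ k : ℕ, ∀ᶠ m in atTop, ∀ w : List (Fin b), w.length = k * m →
      shift w e ∉ smallTotals (ratio b H) m := by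
  refine ae_all_iff.2 fun k => ?_
  set Q := signMeasure b H (smallTotals (ratio b H) 0)
  have hQ1 : Q < 1 := measure_smallTotals_zero_lt_one hb hH hH1
  have hQ : Q = ENNReal.ofReal Q.toReal := (ENNReal.ofReal_toReal hQ1.ne_top).symm
  have hq : Q.toReal < 1 := by
    rw [← ENNReal.toReal_one]
    exact (ENNReal.toReal_lt_toReal hQ1.ne_top ENNReal.one_ne_top).2 hQ1
  obtain ⟨C, hC0, hC⟩ := exists_pow_mul_pow_pow_le hb k ENNReal.toReal_nonneg hq
  have hb1 : (1 : ℝ) < b := by exact_mod_cast (by lia : 1 < b)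
  have hle : ∀ m, signMeasure b H (⋃ w : Fin (k * m) → Fin b,
      shift (List.ofFn w) ⁻¹' smallTotals (ratio b H) m) ≤ ENNReal.ofReal (C * ((b : ℝ)⁻¹) ^ m) := by
    intro m
    refine (measure_iUnion_fintype_le _ _).trans ?_
    rw [Finset.sum_congr rfl fun w _ =>
      (measurePreserving_shift (b := b) (H := H) (List.ofFn w)).measure_preimage
        (measurableSet_smallTotals (ratio b H : ℝ) m).nullMeasurableSet, measure_smallTotals]
    simp only [Finset.sum_const, Finset.card_univ, Fintype.card_fun, Fintype.card_fin,
      nsmul_eq_mul]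
    refine le_trans (le_of_eq ?_) (ENNReal.ofReal_le_ofReal (hC m))
    rw [ENNReal.ofReal_mul (by positivity), ENNReal.ofReal_pow ENNReal.toReal_nonneg, ← hQ,
      ← pow_mul, ENNReal.ofReal_pow (by positivity), ENNReal.ofReal_natCast, mul_comm k m]
    push_cast
    rfl
  have hsum : ∑' m, signMeasure b H (⋃ w : Fin (k * m) → Fin b,
      shift (List.ofFn w) ⁻¹' smallTotals (ratio b H) m) ≠ ∞ := by
    refine ne_top_of_le_ne_top ?_ (ENNReal.tsum_le_tsum hle)
    rw [← ENNReal.ofReal_tsum_of_nonneg (fun m => by positivity)]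
    · exact ENNReal.ofReal_ne_top
    · exact (summable_geometric_of_lt_one (by positivity)
        (inv_lt_one_of_one_lt₀ hb1)).mul_left C
  filter_upwards [ae_eventually_notMem hsum] with e he
  filter_upwards [he] with m hm w hw hmem
  refine hm (Set.mem_iUnion.2 ⟨fun i => w.get (i.cast hw.symm), ?_⟩)
  have : List.ofFn (fun i : Fin (k * m) => w.get (i.cast hw.symm)) = w := by
    apply List.ext_get <;> simp [hw]
  rwa [Set.mem_preimage, this]

end SignCascade

namespace SignCascade

/-! ### Pointwise Hölder exponents -/

lemma le_pointwiseHolderExponent {f : C(I, ℝ)} {H : ℝ} (t₀ : I)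
    (hf : ∀ H' : ℝ≥0, 0 < H' → (H' : ℝ) < H → ∃ C : ℝ≥0, HolderWith C H' f) :
    ENNReal.ofReal H ≤ pointwiseHolderExponent f t₀ := by
  refine le_of_forall_lt_imp_le_of_dense fun x hx => ?_
  lift x to ℝ≥0 using hx.ne_top
  rcases eq_or_lt_of_le (zero_le (a := x)) with rfl | h0
  · simp
  have hxH : (x : ℝ) < H := by
    simpa using (ENNReal.lt_ofReal_iff_toReal_lt ENNReal.coe_ne_top).1 hx
  obtain ⟨C, hC⟩ := hf x h0 hxH
  refine le_iSup₂_of_le (f := fun (α : ℝ≥0) _ => (α : ℝ≥0∞)) x ⟨0, C, fun t ht => ?_⟩ le_rfl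
  have hpos : 0 < |(t : ℝ) - t₀| := abs_pos.2 (sub_ne_zero.2 fun h => ht (Subtype.ext h))
  rw [Polynomial.eval_zero, sub_zero, div_le_iff₀ (by positivity)]
  have := hC.dist_le t t₀
  rwa [Real.dist_eq, Subtype.dist_eq, Real.dist_eq] at this

/-- If the quotients in the definition of the pointwise exponent are bounded for an exponent
`α ≤ 1`, then the Taylor polynomial can be dropped. -/
lemma exists_abs_sub_le_of_polynomial {f : C(I, ℝ)} {t₀ : I} {α β : ℝ} (hα : 0 < α) (hα1 : α ≤ 1)
    (hαβ : α ≤ β) {P : Polynomial ℝ} {C : ℝ}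
    (h : ∀ t : I, t ≠ t₀ → |f t - f t₀ - P.eval (t : ℝ)| / |(t : ℝ) - t₀| ^ β ≤ C) :
    ∃ K : ℝ, 0 ≤ K ∧ ∀ t : I, |f t - f t₀| ≤ K * |(t : ℝ) - t₀| ^ α := by
  have hd : ∀ t : I, |(t : ℝ) - t₀| ≤ 1 := fun t => by
    rw [abs_le]; constructor <;> linarith [t.2.1, t.2.2, t₀.2.1, t₀.2.2]
  set C' := max C 0
  have h1 : ∀ t : I, t ≠ t₀ → |f t - f t₀ - P.eval (t : ℝ)| ≤ C' * |(t : ℝ) - t₀| ^ α := by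
    intro t ht
    have hpos : 0 < |(t : ℝ) - t₀| := abs_pos.2 (sub_ne_zero.2 fun h => ht (Subtype.ext h))
    have h2 := (div_le_iff₀ (Real.rpow_pos_of_pos hpos β)).1 (h t ht)
    refine h2.trans (mul_le_mul (le_max_left _ _)
      (Real.rpow_le_rpow_of_exponent_ge hpos (hd t) hαβ) (by positivity) (le_max_right _ _))
  -- The point `t₀` is not isolated, so continuity extends the estimate to it. There it forces `P`
  -- to vanish, so that `P` is `O(|t - t₀|)`, which is absorbed since `α ≤ 1`.
  have h2 : ∀ t : I, |f t - f t₀ - P.eval (t : ℝ)| ≤ C' * |(t : ℝ) - t₀| ^ α := by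
    intro t
    have hcl : IsClosed {t : I | |f t - f t₀ - P.eval (t : ℝ)| ≤ C' * |(t : ℝ) - t₀| ^ α} := by
      refine isClosed_le (by fun_prop) (continuous_const.mul ?_)
      exact Continuous.rpow_const (by fun_prop) fun _ => Or.inr hα.le
    have hsub : {t₀}ᶜ ⊆ {t : I | |f t - f t₀ - P.eval (t : ℝ)| ≤ C' * |(t : ℝ) - t₀| ^ α} :=
      fun t ht => h1 t ht
    have := hcl.closure_subset_iff.2 hsub
    rw [(dense_compl_singleton t₀).closure_eq] at this
    exact this trivial
  have hroot : P.IsRoot (t₀ : ℝ) := by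
    have := h2 t₀
    rw [sub_self, sub_self, abs_zero, Real.zero_rpow hα.ne', mul_zero, zero_sub, abs_neg] at this
    exact abs_eq_zero.1 (le_antisymm this (abs_nonneg _))
  obtain ⟨Q, hQ⟩ := Polynomial.dvd_iff_isRoot.2 hroot
  obtain ⟨L, hL⟩ := isCompact_univ.exists_bound_of_continuousOn
    (f := fun t : I => Q.eval (t : ℝ)) (by fun_prop)
  have hL0 : 0 ≤ L := (norm_nonneg _).trans (hL 0 trivial)
  refine ⟨C' + L, add_nonneg (le_max_right _ _) hL0, fun t => ?_⟩
  have h3 : |P.eval (t : ℝ)| ≤ L * |(t : ℝ) - t₀| ^ α := by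
    rw [hQ, Polynomial.eval_mul, abs_mul, mul_comm]
    refine mul_le_mul (hL t trivial) ?_ (abs_nonneg _) hL0
    simp only [Polynomial.eval_sub, Polynomial.eval_X, Polynomial.eval_C]
    rcases (abs_nonneg ((t : ℝ) - t₀)).eq_or_lt with h0 | h0
    · rw [← h0]; positivity
    · calc |(t : ℝ) - t₀| = |(t : ℝ) - t₀| ^ (1 : ℝ) := (Real.rpow_one _).symm
        _ ≤ _ := Real.rpow_le_rpow_of_exponent_ge h0 (hd t) hα1
  calc |f t - f t₀| = |(f t - f t₀ - P.eval (t : ℝ)) + P.eval (t : ℝ)| := by rw [sub_add_cancel]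
    _ ≤ _ := abs_add_le _ _
    _ ≤ C' * |(t : ℝ) - t₀| ^ α + L * |(t : ℝ) - t₀| ^ α := add_le_add (h2 t) h3
    _ = _ := by ring

variable {b : ℕ} {H : ℝ}

/-- Close to any `t₀`, at distance `b ^ (-k m)`, there is an interval over which the increment is at
least `c ^ ((k + 1) m) / 2`. For large `k` the extra `m` letters cost too little to be compatible
with an exponent above `H`. -/
lemma Tame.pointwiseHolderExponent_le {c M s a ρ : ℝ} {e : List (Fin b) → ℝ} (hb : 2 ≤ b)
    (he : Tame c M s a e) (hr : Rates c s a ρ) (hM : 1 ≤ M) (hc : c = (b : ℝ) ^ (-H))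
    (hH0 : 0 < H) (hH1 : H < 1) {f : C(I, ℝ)} (hf : ∀ t : I, f t = lim c e t)
    (hlow : ∀ k : ℕ, ∀ᶠ m in atTop, ∀ w : List (Fin b), w.length = k * m →
      SignCascade.shift w e ∉ smallTotals c m) (t₀ : I) :
    pointwiseHolderExponent f t₀ ≤ ENNReal.ofReal H := by
  have : NeZero b := ⟨by lia⟩
  have hb1 : (1 : ℝ) < b := by exact_mod_cast (by lia : 1 < b)
  have hb0 : (0 : ℝ) < b := by linarith
  refine iSup₂_le fun β hβ => ?_
  obtain ⟨P, C, hC⟩ := hβ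
  by_contra hlt
  push Not at hlt
  have hlt' : H < β := by
    simpa using (ENNReal.ofReal_lt_iff_lt_toReal hH0.le ENNReal.coe_ne_top).1 hlt
  -- Since `H < 1`, an exponent `α` above `H` can be kept below `1`, where the polynomial may be
  -- discarded.
  obtain ⟨α, hα1, hα2⟩ := exists_between (lt_min hlt' hH1)
  have hα0 : 0 < α := hH0.trans hα1
  obtain ⟨K, hK0, hK⟩ := exists_abs_sub_le_of_polynomial hα0 (hα2.le.trans (min_le_right _ _))
    (hα2.le.trans (min_le_left _ _)) hC
  -- This `k` makes `α k > H (k + 1)`, so `γ > 0` and the bound on `(b ^ γ) ^ m` fails for large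
  -- `m`.
  obtain ⟨k, hk⟩ := exists_nat_gt (H / (α - H))
  rw [div_lt_iff₀ (by linarith)] at hk
  set γ : ℝ := α * k - H * (k + 1) with hγ
  have hγ0 : 0 < γ := by rw [hγ]; linarith
  have key : ∀ᶠ m : ℕ in atTop, ((b : ℝ) ^ γ) ^ m ≤ 4 * K := by
    filter_upwards [hlow k] with m hm
    -- `w` codes an interval containing `t₀`, and `u` a large increment inside it. Both end points
    -- of the interval of `w ++ u` are within `b ^ (-k m)` of `t₀`, so the triangle inequality
    -- through `f t₀` bounds that increment.
    obtain ⟨w, z, hw, hz, hwz⟩ := exists_pos_eq (b := b) (k * m) t₀.2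
    obtain ⟨u, hu, hle⟩ := exists_of_notMem_smallTotals (hm w hw)
    rw [shift_shift] at hle
    have h01 : (0 : ℝ) ∈ Set.Icc (0 : ℝ) 1 := by simp
    have h11 : (1 : ℝ) ∈ Set.Icc (0 : ℝ) 1 := by simp
    have hinc := he.abs_lim_pos_sub hr hM (w ++ u) h11 h01
    rw [lim_of_nonpos c _ le_rfl, sub_zero] at hinc
    have hd : ∀ x ∈ Set.Icc (0 : ℝ) 1, |lim c e (pos (w ++ u) x) - f t₀| ≤
        K * ((b : ℝ) ^ (-(α * (k * m)))) := by
      intro x hx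
      have hmem := pos_mem (w ++ u) hx
      have := hK ⟨pos (w ++ u) x, hmem⟩
      rw [hf] at this
      refine this.trans (mul_le_mul_of_nonneg_left ?_ hK0)
      simp only
      rw [← hwz, pos_append, pos_sub, hw, abs_div, abs_of_pos (by positivity : (0 : ℝ) < b ^ (k * m)),
        Real.div_rpow (abs_nonneg _) (by positivity), ← Real.rpow_natCast, ← Real.rpow_mul hb0.le,
        Real.rpow_neg hb0.le, div_eq_mul_inv]
      push_cast
      rw [mul_comm α]
      refine mul_le_of_le_one_left (by positivity) (Real.rpow_le_one (abs_nonneg _) ?_ hα0.le)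
      have := pos_mem u hx
      rw [abs_le]
      constructor <;> linarith [this.1, this.2, hz.1, hz.2]
    have h1 := hd 1 h11
    have h0 := hd 0 h01
    have h2 : |lim c e (pos (w ++ u) 1) - lim c e (pos (w ++ u) 0)| ≤
        2 * (K * ((b : ℝ) ^ (-(α * (k * m))))) := by
      have := abs_sub_le (lim c e (pos (w ++ u) 1)) (f t₀) (lim c e (pos (w ++ u) 0))
      rw [abs_sub_comm (f t₀)] at this
      linarith
    rw [hinc, hc, ← Real.rpow_natCast, ← Real.rpow_mul hb0.le, List.length_append, hw, hu] at h2
    rw [hc] at hle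
    have h3 : (b : ℝ) ^ (-H * ((k * m + m : ℕ) : ℝ)) * (1 / 2) ≤
        2 * (K * ((b : ℝ) ^ (-(α * (k * m))))) := by
      refine le_trans (mul_le_mul_of_nonneg_left hle (by positivity)) h2
    have h4 : ((b : ℝ) ^ γ) ^ m = (b : ℝ) ^ (-H * ((k * m + m : ℕ) : ℝ)) *
        (b : ℝ) ^ (α * (k * m)) := by
      rw [← Real.rpow_natCast, ← Real.rpow_mul hb0.le, ← Real.rpow_add hb0]
      congr 1
      push_cast
      rw [hγ]; ring
    have h5 : (b : ℝ) ^ (-(α * (k * m))) * (b : ℝ) ^ (α * (k * m)) = 1 := by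
      rw [← Real.rpow_add hb0]; simp
    rw [h4]
    have h6 := mul_le_mul_of_nonneg_right h3 (by positivity : 0 ≤ (b : ℝ) ^ (α * (k * m)))
    calc _ = 2 * ((b : ℝ) ^ (-H * ((k * m + m : ℕ) : ℝ)) * (1 / 2) * (b : ℝ) ^ (α * (k * m))) := by
          ring
      _ ≤ 2 * (2 * (K * (b : ℝ) ^ (-(α * (k * m)))) * (b : ℝ) ^ (α * (k * m))) := by gcongr
      _ = 4 * K * ((b : ℝ) ^ (-(α * (k * m))) * (b : ℝ) ^ (α * (k * m))) := by ring
      _ = 4 * K := by rw [h5, mul_one]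
  have htop := tendsto_pow_atTop_atTop_of_one_lt (Real.one_lt_rpow hb1 hγ0)
  obtain ⟨m, hm1, hm2⟩ := (key.and (htop.eventually_gt_atTop (4 * K))).exists
  linarith

lemma Tame.holderWith {c M s a ρ : ℝ} {e : List (Fin b) → ℝ} (hb : 2 ≤ b)
    (he : Tame c M s a e) (hr : Rates c s a ρ) (hM : 1 ≤ M) {h : ℝ}
    (hca : c * a = (b : ℝ) ^ (-h)) {f : C(I, ℝ)} (hf : ∀ t : I, f t = lim c e t)
    {H' : ℝ≥0} (hH' : 0 < H') (hH'h : (H' : ℝ) ≤ h) : ∃ C : ℝ≥0, HolderWith C H' f := by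
  have hL := limConst_nonneg b hr
  have hH'0 : (0 : ℝ) < H' := hH'
  set C : ℝ := 4 * limConst b c a ρ * M * (b : ℝ) ^ h
  have hC : 0 ≤ C := by positivity
  refine ⟨C.toNNReal, fun x y => ?_⟩
  have hd : |(x : ℝ) - y| ≤ 1 := by
    rw [abs_le]; constructor <;> linarith [x.2.1, x.2.2, y.2.1, y.2.2]
  have h1 := he.abs_lim_sub_le_rpow hb hr hM (hH'0.trans_le hH'h) hca hd
  have h2 : |(x : ℝ) - y| ^ h ≤ |(x : ℝ) - y| ^ (H' : ℝ) := by
    rcases (abs_nonneg ((x : ℝ) - y)).eq_or_lt with h0 | h0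
    · rw [← h0, Real.zero_rpow (hH'0.trans_le hH'h).ne', Real.zero_rpow hH'0.ne']
    · exact Real.rpow_le_rpow_of_exponent_ge h0 hd hH'h
  rw [edist_dist, edist_dist, Real.dist_eq, Subtype.dist_eq, Real.dist_eq,
    ENNReal.ofReal_rpow_of_nonneg (abs_nonneg _) hH'0.le]
  change _ ≤ ENNReal.ofReal C * _
  rw [← ENNReal.ofReal_mul hC]
  refine ENNReal.ofReal_le_ofReal ?_
  rw [hf, hf]
  exact h1.trans (mul_le_mul_of_nonneg_left h2 hC)

end SignCascade

namespace SignCascade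

/-! ### Characteristic functions -/

section CharFun

variable {Ω : Type*} [MeasurableSpace Ω] {μ : Measure Ω}

/-- The characteristic function of a real random variable. -/
def fourier (μ : Measure Ω) (X : Ω → ℝ) (ξ : ℝ) : ℂ :=
  ∫ ω, Complex.exp ((ξ * X ω : ℝ) * Complex.I) ∂μ

lemma fourier_neg (X : Ω → ℝ) (ξ : ℝ) :
    fourier μ X (-ξ) = starRingEnd ℂ (fourier μ X ξ) := by
  rw [fourier, fourier, ← integral_conj]
  refine integral_congr_ae (ae_of_all _ fun ω => ?_)
  simp only
  rw [← Complex.exp_conj]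
  simp

lemma integrable_exp_mul_I [IsFiniteMeasure μ] {X : Ω → ℝ} (hX : AEMeasurable X μ) (ξ : ℝ) :
    Integrable (fun ω => Complex.exp ((ξ * X ω : ℝ) * Complex.I)) μ := by
  refine Integrable.of_bound (C := 1) ?_ (ae_of_all _ fun ω => ?_)
  · have : AEMeasurable (fun ω => Complex.exp ((ξ * X ω : ℝ) * Complex.I)) μ := by fun_prop
    exact this.aestronglyMeasurable
  · rw [Complex.norm_exp_ofReal_mul_I]

lemma norm_fourier_le_one [IsProbabilityMeasure μ] (X : Ω → ℝ) (ξ : ℝ) :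
    ‖fourier μ X ξ‖ ≤ 1 := by
  refine (norm_integral_le_of_norm_le_const (C := 1) (ae_of_all _ fun ω => ?_)).trans (by simp)
  rw [Complex.norm_exp_ofReal_mul_I]

lemma tendsto_fourier [IsFiniteMeasure μ] {X : ℕ → Ω → ℝ} {Y : Ω → ℝ}
    (hX : ∀ n, AEMeasurable (X n) μ)
    (h : ∀ᵐ ω ∂μ, Tendsto (fun n => X n ω) atTop (𝓝 (Y ω))) (ξ : ℝ) :
    Tendsto (fun n => fourier μ (X n) ξ) atTop (𝓝 (fourier μ Y ξ)) := by
  refine tendsto_integral_of_dominated_convergence (fun _ => 1)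
    (fun n => (integrable_exp_mul_I (hX n) ξ).1) (integrable_const 1)
    (fun n => ae_of_all _ fun ω => ?_) ?_
  · rw [Complex.norm_exp_ofReal_mul_I]
  · filter_upwards [h] with ω hω
    have hc : Continuous fun x : ℝ => Complex.exp ((ξ * x : ℝ) * Complex.I) := by fun_prop
    exact (hc.tendsto _).comp hω

lemma continuous_fourier [IsFiniteMeasure μ] {X : Ω → ℝ} (hX : AEMeasurable X μ) :
    Continuous (fourier μ X) := by
  refine continuous_of_dominated (bound := fun _ => 1)
    (fun ξ => (integrable_exp_mul_I hX ξ).1) (fun ξ => ae_of_all _ fun ω => ?_)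
    (integrable_const 1) (ae_of_all _ fun ω => by fun_prop)
  rw [Complex.norm_exp_ofReal_mul_I]

lemma im_fourier [IsFiniteMeasure μ] {X : Ω → ℝ} (hX : AEMeasurable X μ) (ξ : ℝ) :
    (fourier μ X ξ).im = ∫ ω, Real.sin (ξ * X ω) ∂μ := by
  have h := integral_im (𝕜 := ℂ) (integrable_exp_mul_I hX ξ)
  rw [fourier]
  refine h.symm.trans (integral_congr_ae (ae_of_all _ fun ω => ?_))
  exact Complex.exp_ofReal_mul_I_im _

/-- A quadratic error, weaker than the cubic one near `0`, is chosen because only second moments of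
the limit total are used. -/
lemma abs_sin_sub_le (x : ℝ) : |Real.sin x - x| ≤ 2 * x ^ 2 := by
  rcases le_total |x| 1 with h | h
  · have h1 : |x| ^ 3 ≤ |x| ^ 2 := pow_le_pow_of_le_one (abs_nonneg x) h (by norm_num)
    have h2 : |x| ^ 5 ≤ |x| ^ 2 := pow_le_pow_of_le_one (abs_nonneg x) h (by norm_num)
    have h3 := Real.sin_bound h
    have h4 := abs_add_le (Real.sin x - (x - x ^ 3 / 6)) (-(x ^ 3 / 6))
    rw [abs_neg, abs_div, abs_pow, abs_of_pos (by norm_num : (0 : ℝ) < 6)] at h4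
    rw [show Real.sin x - x = Real.sin x - (x - x ^ 3 / 6) + -(x ^ 3 / 6) by ring, ← sq_abs]
    linarith [sq_nonneg |x|]
  · have h1 : |x| ≤ |x| ^ 2 := le_self_pow₀ h two_ne_zero
    have h2 := abs_sub (Real.sin x) x
    have h3 := Real.abs_sin_le_one x
    rw [← sq_abs]
    linarith

/-- The imaginary part of the characteristic function of a variable with mean `1` does not vanish
close to `0`. -/
lemma im_fourier_pos [IsProbabilityMeasure μ] {X : Ω → ℝ} (hX : MemLp X 2 μ)
    (hmean : ∫ ω, X ω ∂μ = 1) {ξ : ℝ} (hξ : 0 < ξ)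
    (hξ2 : 2 * ξ * ∫ ω, X ω ^ 2 ∂μ < 1) : 0 < (fourier μ X ξ).im := by
  have hXm := hX.1.aemeasurable
  rw [im_fourier hXm]
  have hi := hX.integrable one_le_two
  have hsq := hX.integrable_sq
  have hsin : Integrable (fun ω => Real.sin (ξ * X ω)) μ := by
    refine Integrable.of_bound (C := 1) (by
      have : AEMeasurable (fun ω => Real.sin (ξ * X ω)) μ := by fun_prop
      exact this.aestronglyMeasurable) (ae_of_all _ fun ω => Real.abs_sin_le_one _)
  have h1 : ∫ ω, (ξ * X ω - 2 * ξ ^ 2 * X ω ^ 2) ∂μ ≤ ∫ ω, Real.sin (ξ * X ω) ∂μ := by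
    refine integral_mono ((hi.const_mul _).sub (hsq.const_mul _)) hsin fun ω => ?_
    have := (abs_le.1 (abs_sin_sub_le (ξ * X ω))).1
    simp only
    nlinarith
  rw [integral_sub (hi.const_mul _) (hsq.const_mul _), integral_const_mul, integral_const_mul,
    hmean] at h1
  have h2 : 2 * ξ ^ 2 * ∫ ω, X ω ^ 2 ∂μ = ξ * (2 * ξ * ∫ ω, X ω ^ 2 ∂μ) := by ring
  have h3 := mul_lt_mul_of_pos_left hξ2 hξ
  linarith

/-- A bound of the concentration function by the characteristic function. -/
lemma measureReal_abs_le_le [IsProbabilityMeasure μ] {X : Ω → ℝ} (hX : Measurable X)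
    {g : ℝ → ℝ} (hg : Integrable g) (hle : ∀ ξ, ‖fourier μ X ξ‖ ≤ g ξ) {r : ℝ} (hr : 0 < r) :
    μ.real {ω | |X ω| ≤ r} ≤ 2 * r * ∫ ξ, g ξ := by
  -- `exp (-x² / (2 r²))` is the characteristic function of the centred Gaussian of variance `r⁻¹ ^
  -- 2`. Exchanging the integrals expresses its mean at `X` as the Gaussian average of the
  -- characteristic function of `X`; the Gaussian density is at most `r`.
  set v : ℝ≥0 := (r⁻¹ ^ 2).toNNReal with hv
  have hvr : (v : ℝ) = r⁻¹ ^ 2 := Real.coe_toNNReal _ (by positivity)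
  have hv0 : v ≠ 0 := by
    rw [← NNReal.coe_ne_zero, hvr]; positivity
  have hg0 : ∀ ξ, 0 ≤ g ξ := fun ξ => (norm_nonneg _).trans (hle ξ)
  have h1 : ∀ x : ℝ, ∫ ξ, Complex.exp ((ξ * x : ℝ) * Complex.I) ∂(gaussianReal 0 v) =
      (Real.exp (-(x ^ 2 / (2 * r ^ 2))) : ℝ) := by
    intro x
    have := charFun_gaussianReal (μ := 0) (v := v) x
    rw [charFun_apply_real] at this
    rw [Complex.ofReal_exp]
    convert this using 2
    · funext ξ
      congr 1
      push_cast
      ring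
    · rw [show ((v : ℝ) : ℂ) = ((r⁻¹ ^ 2 : ℝ) : ℂ) by rw [hvr]]
      push_cast
      have : (r : ℂ) ≠ 0 := by exact_mod_cast hr.ne'
      field_simp
      ring
  have h2 : ((∫ ω, Real.exp (-(X ω ^ 2 / (2 * r ^ 2))) ∂μ : ℝ) : ℂ) =
      ∫ ξ, fourier μ X ξ ∂(gaussianReal 0 v) := by
    rw [← integral_complex_ofReal]
    simp_rw [← h1]
    unfold fourier
    rw [integral_integral_swap]
    refine Integrable.of_bound (C := 1) ?_ (ae_of_all _ fun p => ?_)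
    · have : Measurable (Function.uncurry fun (ω : Ω) (ξ : ℝ) =>
          Complex.exp ((ξ * X ω : ℝ) * Complex.I)) := by
        unfold Function.uncurry; fun_prop
      exact this.aestronglyMeasurable
    · rw [Function.uncurry, Complex.norm_exp_ofReal_mul_I]
  have h3 : ∫ ω, Real.exp (-(X ω ^ 2 / (2 * r ^ 2))) ∂μ ≤ r * ∫ ξ, g ξ := by
    calc ∫ ω, Real.exp (-(X ω ^ 2 / (2 * r ^ 2))) ∂μ
        ≤ ‖((∫ ω, Real.exp (-(X ω ^ 2 / (2 * r ^ 2))) ∂μ : ℝ) : ℂ)‖ := by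
          rw [Complex.norm_real]; exact le_abs_self _
      _ = ‖∫ ξ, gaussianPDFReal 0 v ξ • fourier μ X ξ‖ := by
          rw [h2, integral_gaussianReal_eq_integral_smul hv0]
      _ ≤ ∫ ξ, r * g ξ := by
          refine norm_integral_le_of_norm_le (hg.const_mul r) (ae_of_all _ fun ξ => ?_)
          rw [norm_smul, Real.norm_eq_abs, abs_of_nonneg (gaussianPDFReal_nonneg _ _ _)]
          refine mul_le_mul ?_ (hle ξ) (norm_nonneg _) hr.le
          rw [gaussianPDFReal, hvr]
          have e1 : Real.exp (-(ξ - 0) ^ 2 / (2 * r⁻¹ ^ 2)) ≤ 1 := by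
            rw [Real.exp_le_one_iff]
            exact div_nonpos_of_nonpos_of_nonneg (neg_nonpos.2 (sq_nonneg _)) (by positivity)
          have e2 : (√(2 * Real.pi * r⁻¹ ^ 2))⁻¹ ≤ r := by
            rw [inv_le_comm₀ (by positivity) hr]
            refine Real.le_sqrt_of_sq_le ?_
            have := Real.pi_gt_three
            have : 0 < r⁻¹ ^ 2 := by positivity
            nlinarith
          calc _ ≤ r * 1 := mul_le_mul e2 e1 (by positivity) hr.le
            _ = r := mul_one r
      _ = r * ∫ ξ, g ξ := integral_const_mul _ _
  have hint : Integrable (fun ω => Real.exp (-(X ω ^ 2 / (2 * r ^ 2)))) μ := by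
    refine Integrable.of_bound (C := 1) (by
      have : Measurable (fun ω => Real.exp (-(X ω ^ 2 / (2 * r ^ 2)))) := by fun_prop
      exact this.aestronglyMeasurable) (ae_of_all _ fun ω => ?_)
    rw [Real.norm_eq_abs, Real.abs_exp, Real.exp_le_one_iff]
    exact neg_nonpos.2 (by positivity)
  -- Markov's inequality: on `|X| ≤ r` the exponential is at least `exp (-1/2) ≥ 1/2`.
  have h4 := mul_meas_ge_le_integral_of_nonneg (ae_of_all _ fun ω => (Real.exp_pos _).le) hint (1 / 2)
  have h5 : {ω | |X ω| ≤ r} ⊆ {ω | 1 / 2 ≤ Real.exp (-(X ω ^ 2 / (2 * r ^ 2)))} := by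
    intro ω hω
    have h6 : X ω ^ 2 ≤ r ^ 2 := sq_le_sq' (abs_le.1 hω).1 (abs_le.1 hω).2
    have h7 : X ω ^ 2 / (2 * r ^ 2) ≤ 1 / 2 := by
      rw [div_le_div_iff₀ (by positivity) two_pos]; linarith
    have h8 := Real.add_one_le_exp (-(X ω ^ 2 / (2 * r ^ 2)))
    rw [Set.mem_ofPred_eq]
    linarith
  have h9 := measureReal_mono (μ := μ) h5
  linarith

/-- The combination keeps the real part of `z` and multiplies the imaginary part by `2p - 1`. A
genuinely random sign thus shrinks the modulus as soon as `z` is not real. -/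
lemma norm_add_conj_sq (p : ℝ) (z : ℂ) :
    ‖(p : ℂ) * z + ((1 - p : ℝ) : ℂ) * starRingEnd ℂ z‖ ^ 2 =
      ‖z‖ ^ 2 - 4 * p * (1 - p) * z.im ^ 2 := by
  rw [Complex.sq_norm, Complex.sq_norm, Complex.normSq_apply, Complex.normSq_apply]
  simp
  ring

end CharFun

/-! ### Effect of random signs and of branching on characteristic functions. -/

variable {b : ℕ} {H : ℝ} [hprob : IsProbabilityMeasure (signLaw b H)]

lemma fourier_root_mul (hb : 2 ≤ b) (hH1 : H ≤ 1) {φ : (List (Fin b) → ℝ) → ℝ}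
    (hφ : Measurable φ) (hf : ∀ e, φ (forget e) = φ e) (ξ : ℝ) :
    fourier (signMeasure b H) (fun e => e [] * φ e) ξ =
      plusProb b H * fourier (signMeasure b H) φ ξ +
        (1 - plusProb b H : ℝ) * starRingEnd ℂ (fourier (signMeasure b H) φ ξ) := by
  have h := integral_root_mul (𝕜 := ℂ) hb hH1 hφ hf
    (f := fun x => Complex.exp ((ξ * x : ℝ) * Complex.I)) (by fun_prop)
    (integrable_exp_mul_I hφ.aemeasurable ξ) (integrable_exp_mul_I hφ.neg.aemeasurable ξ)
  rw [← fourier_neg]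
  unfold fourier
  simp only [mul_neg, neg_mul] at h ⊢
  exact h

lemma norm_fourier_root_mul_le (hb : 2 ≤ b) (hH1 : H ≤ 1) {φ : (List (Fin b) → ℝ) → ℝ}
    (hφ : Measurable φ) (hf : ∀ e, φ (forget e) = φ e) (ξ : ℝ) :
    ‖fourier (signMeasure b H) (fun e => e [] * φ e) ξ‖ ≤ ‖fourier (signMeasure b H) φ ξ‖ := by
  have hp := plusProb_mem (H := H) hb hH1
  rw [fourier_root_mul hb hH1 hφ hf]
  refine le_of_sq_le_sq ?_ (norm_nonneg _)
  rw [norm_add_conj_sq]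
  have : 0 ≤ 4 * plusProb b H * (1 - plusProb b H) *
      (fourier (signMeasure b H) φ ξ).im ^ 2 := by
    have := hp.1
    have := sub_nonneg.2 hp.2
    positivity
  linarith

lemma fourier_sum_shift (c : ℝ) {ψ : Fin b → (List (Fin b) → ℝ) → ℝ}
    (hψ : ∀ i, Measurable (ψ i)) (ξ : ℝ) :
    fourier (signMeasure b H) (fun e => ∑ i, c * ψ i (shift [i] e)) ξ =
      ∏ i, fourier (signMeasure b H) (ψ i) (c * ξ) := by
  have h := (iIndepFun_shift (b := b) (H := H)).integral_fun_prod_comp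
    (f := fun i e => Complex.exp ((c * ξ * ψ i e : ℝ) * Complex.I))
    (fun i => (measurable_shift [i]).aemeasurable)
    (fun i => by
      have : Measurable fun e => Complex.exp ((c * ξ * ψ i e : ℝ) * Complex.I) := by
        have := hψ i
        fun_prop
      exact this.aestronglyMeasurable)
  rw [fourier]
  have h2 : ∀ e : List (Fin b) → ℝ,
      Complex.exp ((ξ * ∑ i, c * ψ i (shift [i] e) : ℝ) * Complex.I) =
      ∏ i, Complex.exp ((c * ξ * ψ i (shift [i] e) : ℝ) * Complex.I) := by
    intro e
    rw [← Complex.exp_sum, ← Finset.sum_mul, ← Complex.ofReal_sum, Finset.mul_sum]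
    congr 3
    exact Finset.sum_congr rfl fun i _ => by ring
  simp_rw [h2]
  rw [h]
  refine Finset.prod_congr rfl fun i _ => ?_
  rw [fourier, ← integral_comp_shift [i] (integrable_exp_mul_I (hψ i).aemeasurable _).1]

end SignCascade

namespace SignCascade

/-! ### Regularity of the laws of the increments -/

variable {b : ℕ} {H : ℝ}

lemma total_forget (c : ℝ) (n : ℕ) (e : List (Fin b) → ℝ) :
    total c n (forget e) = total c n e := cas_forget c n e 1

lemma measurable_cas_left (c : ℝ) (n : ℕ) (x : ℝ) :
    Measurable fun e : List (Fin b) → ℝ => cas c n e x :=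
  (measurable_cas c n).comp measurable_prodMk_right

variable [hprob : IsProbabilityMeasure (signLaw b H)]

/-- The characteristic function of the increment is a product over the independent children. At each
letter of `w` all factors but that of the child along `w` are bounded by `1`, the sign does not
increase the modulus, and the frequency is multiplied by `c`. -/
lemma norm_fourier_cas_sub_le (hb : 2 ≤ b) (hH1 : H ≤ 1) (c : ℝ) (N : ℕ) (w : List (Fin b))
    {s t : ℝ} (hs : s ≤ pos w 0) (ht : pos w 1 ≤ t) (ξ : ℝ) :
    ‖fourier (signMeasure b H) (fun e => cas c (N + w.length) e t - cas c (N + w.length) e s) ξ‖ ≤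
      ‖fourier (signMeasure b H) (total c N) (c ^ w.length * ξ)‖ := by
  have hb0 : (0 : ℝ) < b := by exact_mod_cast (by lia : 0 < b)
  induction w generalizing s t ξ with
  | nil =>
    rw [List.length_nil, pow_zero, one_mul, add_zero]
    refine le_of_eq (congrArg (fun X => ‖fourier _ X ξ‖) (funext fun e => ?_))
    rw [cas_of_nonpos c N e hs, cas_of_one_le c N e ht, sub_zero, total]
  | cons i w ih =>
    set n := N + w.length with hn
    set ψ : Fin b → (List (Fin b) → ℝ) → ℝ := fun j e =>
      e [] * (cas c n e (b * t - (j : ℕ)) - cas c n e (b * s - (j : ℕ))) with hψ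
    have hdm : ∀ x y : ℝ, Measurable fun e : List (Fin b) → ℝ => cas c n e x - cas c n e y :=
      fun x y => (measurable_cas_left c n x).sub (measurable_cas_left c n y)
    have hψm : ∀ j, Measurable (ψ j) := fun j => (measurable_pi_apply []).mul (hdm _ _)
    have hsum : (fun e : List (Fin b) → ℝ => cas c (N + (i :: w).length) e t -
        cas c (N + (i :: w).length) e s) = fun e => ∑ j, c * ψ j (shift [j] e) := by
      funext e
      rw [List.length_cons, ← add_assoc, cas_succ, cas_succ, ← Finset.sum_sub_distrib]
      refine Finset.sum_congr rfl fun j _ => ?_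
      rw [hψ]
      ring
    rw [hsum, fourier_sum_shift c hψm, norm_prod, ← Finset.mul_prod_erase _ _ (Finset.mem_univ i)]
    refine (mul_le_of_le_one_right (norm_nonneg _) (Finset.prod_le_one
      (fun _ _ => norm_nonneg _) fun _ _ => norm_fourier_le_one _ _)).trans ?_
    refine (norm_fourier_root_mul_le hb hH1 (hdm _ _) (fun e => by
      rw [cas_forget, cas_forget]) _).trans ?_
    rw [pos] at hs ht
    rw [le_div_iff₀ hb0] at hs
    rw [div_le_iff₀ hb0] at ht
    refine (ih (by linarith) (by linarith) (c * ξ)).trans (le_of_eq ?_)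
    rw [List.length_cons, pow_succ, mul_assoc]

lemma ae_tendsto_lim (hb : 2 ≤ b) (hH : 1 / 2 < H) (hH1 : H ≤ 1) :
    ∀ᵐ e ∂(signMeasure b H), ∀ x : ℝ,
      Tendsto (fun n => cas (ratio b H : ℝ) n e x) atTop (𝓝 (lim (ratio b H) e x)) := by
  obtain ⟨p, hp, hr⟩ := (eventually_rates hb hH).exists
  filter_upwards [ae_tame_of_ne_zero (b := b) hb hH hH1 hp] with e he x
  exact he.tendsto_lim hr (one_le_tameConst _ _ _ _) x

lemma tendsto_fourier_total (hb : 2 ≤ b) (hH : 1 / 2 < H) (hH1 : H ≤ 1) (ξ : ℝ) :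
    Tendsto (fun n => fourier (signMeasure b H) (total (b := b) (ratio b H) n) ξ) atTop
      (𝓝 (fourier (signMeasure b H) (limTotal (ratio b H)) ξ)) :=
  tendsto_fourier (fun n => (measurable_total _ n).aemeasurable)
    ((ae_tendsto_lim hb hH hH1).mono fun _ he => he 1) ξ

lemma norm_fourier_lim_sub_le (hb : 2 ≤ b) (hH : 1 / 2 < H) (hH1 : H ≤ 1) (w : List (Fin b))
    {s t : ℝ} (hs : s ≤ pos w 0) (ht : pos w 1 ≤ t) (ξ : ℝ) :
    ‖fourier (signMeasure b H) (fun e => lim (ratio b H) e t - lim (ratio b H) e s) ξ‖ ≤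
      ‖fourier (signMeasure b H) (limTotal (b := b) (ratio b H))
        ((ratio b H : ℝ) ^ w.length * ξ)‖ := by
  have h1 : Tendsto (fun N => fourier (signMeasure b H) (fun e : List (Fin b) → ℝ =>
      cas (ratio b H : ℝ) (N + w.length) e t - cas (ratio b H : ℝ) (N + w.length) e s) ξ) atTop
      (𝓝 (fourier (signMeasure b H) (fun e => lim (ratio b H) e t - lim (ratio b H) e s) ξ)) := by
    refine tendsto_fourier (fun n => ((measurable_cas_left _ _ t).sub
      (measurable_cas_left _ _ s)).aemeasurable) ?_ ξ
    filter_upwards [ae_tendsto_lim (b := b) hb hH hH1] with e he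
    exact ((tendsto_add_atTop_iff_nat w.length).2 (he t)).sub
      ((tendsto_add_atTop_iff_nat w.length).2 (he s))
  exact le_of_tendsto_of_tendsto' h1.norm (tendsto_fourier_total hb hH hH1 _).norm fun N =>
    norm_fourier_cas_sub_le hb hH1 _ N w hs ht ξ

/-- The recursion `total_succ` seen on characteristic functions, in the limit of infinite
generation. -/
lemma fourier_limTotal_eq (hb : 2 ≤ b) (hH : 1 / 2 < H) (hH1 : H ≤ 1) (ξ : ℝ) :
    fourier (signMeasure b H) (limTotal (b := b) (ratio b H)) ξ =
      (plusProb b H * fourier (signMeasure b H) (limTotal (b := b) (ratio b H)) (ratio b H * ξ) +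
        (1 - plusProb b H : ℝ) * starRingEnd ℂ (fourier (signMeasure b H)
          (limTotal (b := b) (ratio b H)) (ratio b H * ξ))) ^ b := by
  have h1 := (tendsto_add_atTop_iff_nat 1).2 (tendsto_fourier_total (b := b) hb hH hH1 ξ)
  refine tendsto_nhds_unique h1 ?_
  have h2 := tendsto_fourier_total (b := b) hb hH hH1 (ratio b H * ξ)
  have h3 := ((h2.const_mul (plusProb b H : ℂ)).add
    (((Complex.continuous_conj.tendsto _).comp h2).const_mul ((1 - plusProb b H : ℝ) : ℂ))).pow b
  refine h3.congr fun n => ?_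
  have hm := measurable_total (b := b) (ratio b H) n
  rw [Function.comp_apply, ← fourier_root_mul hb hH1 hm (total_forget _ n)]
  have hsum : (total (b := b) (ratio b H) (n + 1)) = fun e => ∑ j, (ratio b H : ℝ) *
      (fun (_ : Fin b) (e : List (Fin b) → ℝ) => e [] * total (ratio b H) n e) j
        (shift [j] e) := by
    funext e
    rw [total_succ]
    exact Finset.sum_congr rfl fun j _ => mul_assoc _ _ _
  rw [hsum, fourier_sum_shift (ratio b H : ℝ)
    (ψ := fun _ (e : List (Fin b) → ℝ) => e [] * total (ratio b H) n e)
    (fun _ => (measurable_pi_apply []).mul hm)]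
  simp

lemma norm_fourier_limTotal_le_pow (hb : 2 ≤ b) (hH : 1 / 2 < H) (hH1 : H ≤ 1) (ξ : ℝ) :
    ‖fourier (signMeasure b H) (limTotal (b := b) (ratio b H)) ξ‖ ≤
      ‖fourier (signMeasure b H) (limTotal (b := b) (ratio b H)) (ratio b H * ξ)‖ ^ b := by
  rw [fourier_limTotal_eq hb hH hH1, norm_pow]
  refine pow_le_pow_left₀ (norm_nonneg _) (le_of_sq_le_sq ?_ (norm_nonneg _)) b
  rw [norm_add_conj_sq]
  have hp := plusProb_mem (H := H) hb hH1
  have h1 := hp.1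
  have h2 := sub_nonneg.2 hp.2
  set z := fourier (signMeasure b H) (limTotal (b := b) (ratio b H)) (ratio b H * ξ)
  have : 0 ≤ 4 * plusProb b H * (1 - plusProb b H) * z.im ^ 2 := by positivity
  linarith

/-- Mean `1` and a finite second moment make the imaginary part at `c ξ` positive for small `ξ > 0`.
Since `H < 1`, the probability of the sign `1` lies strictly between `1/2` and `1`, so the modulus
strictly drops. -/
lemma exists_norm_fourier_limTotal_lt_one (hb : 2 ≤ b) (hH : 1 / 2 < H) (hH1 : H < 1) :
    ∃ η : ℝ, 0 < η ∧ ∀ ξ, 0 < ξ → ξ < η →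
      ‖fourier (signMeasure b H) (limTotal (b := b) (ratio b H)) ξ‖ < 1 := by
  set V := ∫ e, limTotal (b := b) (ratio b H) e ^ 2 ∂(signMeasure b H)
  have hV : 0 ≤ V := integral_nonneg fun e => sq_nonneg _
  have hc : (0 : ℝ) < ratio b H := by exact_mod_cast ratio_pos hb H
  refine ⟨((ratio b H : ℝ) * (2 * (V + 1)))⁻¹, by positivity, fun ξ hξ hξη => ?_⟩
  rw [lt_inv_comm₀ hξ (by positivity), ← one_div, lt_div_iff₀ hξ] at hξη
  have him := im_fourier_pos (memLp_limTotal (b := b) hb hH hH1.le)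
    (integral_limTotal hb hH hH1.le) (ξ := ratio b H * ξ) (by positivity)
    (by have : 0 < (ratio b H : ℝ) * ξ := by positivity
        nlinarith)
  rw [fourier_limTotal_eq hb hH hH1.le, norm_pow]
  refine pow_lt_one₀ (norm_nonneg _) ?_ (by lia)
  set z := fourier (signMeasure b H) (limTotal (b := b) (ratio b H)) (ratio b H * ξ)
  have hz : ‖z‖ ≤ 1 := norm_fourier_le_one _ _
  have hp := plusProb_mem (H := H) hb hH1.le
  have h1 := hp.1
  have h2 : plusProb b H < 1 := by
    have hb1 : (1 : ℝ) < b := by exact_mod_cast (by lia : 1 < b)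
    have := Real.rpow_lt_one_of_one_lt_of_neg hb1 (sub_neg.2 hH1)
    unfold plusProb
    linarith
  have h3 : 0 < 4 * plusProb b H * (1 - plusProb b H) * z.im ^ 2 := by
    have := sub_pos.2 h2
    positivity
  have h4 : ‖z‖ ^ 2 ≤ 1 := pow_le_one₀ (norm_nonneg _) hz
  refine lt_of_pow_lt_pow_left₀ 2 zero_le_one ?_
  rw [norm_add_conj_sq, one_pow]
  linarith

lemma exists_norm_fourier_limTotal_le (hb : 2 ≤ b) (hH : 1 / 2 < H) (hH1 : H < 1) :
    ∃ K : ℝ, 0 ≤ K ∧ ∀ ξ,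
      ‖fourier (signMeasure b H) (limTotal (b := b) (ratio b H)) ξ‖ ≤ K * (1 + ξ ^ 2)⁻¹ := by
  obtain ⟨η, hη, hlt⟩ := exists_norm_fourier_limTotal_lt_one (b := b) hb hH hH1
  set φ := fourier (signMeasure b H) (limTotal (b := b) (ratio b H))
  set c := (ratio b H : ℝ)
  have hb1 : (1 : ℝ) < b := by exact_mod_cast (by lia : 1 < b)
  have hb0 : (0 : ℝ) < b := by linarith
  have hc0 : 0 < c := NNReal.coe_pos.2 (ratio_pos hb H)
  have hcb : (b : ℝ)⁻¹ ≤ c := by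
    rw [show c = (b : ℝ) ^ (-H) from coe_ratio b H, ← Real.rpow_neg_one]
    exact Real.rpow_le_rpow_of_exponent_le hb1.le (by linarith)
  have hc1 : c < 1 := by
    have := rate_lt_one (b := b) hb hH
    exact (NNReal.coe_le_coe.2 (ratio_le_rate hb H)).trans_lt (NNReal.coe_lt_one.2 this)
  have hcont : Continuous φ := continuous_fourier (measurable_limTotal _).aemeasurable
  -- A fundamental domain for multiplication by `c` on the positive axis. The maximum `q < 1` there
  -- propagates outwards as `q ^ b ^ m`, by iterating the functional inequality.
  have hK : IsCompact (Set.Icc (c * (η / 2)) (η / 2)) := isCompact_Icc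
  obtain ⟨ξ₀, hξ₀, hmax⟩ := hK.exists_isMaxOn
    ⟨η / 2, by constructor <;> nlinarith⟩ hcont.norm.continuousOn
  set q := ‖φ ξ₀‖
  have hq1 : q < 1 := hlt ξ₀ (lt_of_lt_of_le (by positivity) hξ₀.1) (by linarith [hξ₀.2])
  obtain ⟨C, hC0, hC⟩ := exists_pow_mul_pow_pow_le hb 1 (norm_nonneg (φ ξ₀)) hq1
  have hiter : ∀ (m : ℕ) (ξ : ℝ), ‖φ ξ‖ ≤ ‖φ (c ^ m * ξ)‖ ^ b ^ m := by
    intro m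
    induction m with
    | zero => simp
    | succ m ih =>
      intro ξ
      refine (ih ξ).trans ?_
      rw [pow_succ' c, mul_assoc, pow_succ' b, pow_mul]
      exact pow_le_pow_left₀ (norm_nonneg _) (norm_fourier_limTotal_le_pow hb hH hH1.le _) _
  have hpos : ∀ ξ, η / 2 < ξ → ‖φ ξ‖ * ξ ^ 2 ≤ C * (η / 2) ^ 2 := by
    intro ξ hξ
    have hx : 1 ≤ ξ / (η / 2) := by rw [le_div_iff₀ (by positivity)]; linarith
    obtain ⟨n, hn1, hn2⟩ := exists_nat_pow_near hx (one_lt_inv₀ hc0 |>.2 hc1)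
    have hξ0 : 0 < ξ := by linarith
    rw [le_div_iff₀ (by positivity), inv_pow] at hn1
    rw [div_lt_iff₀ (by positivity), inv_pow] at hn2
    have hcn : 0 < c ^ (n + 1) := by positivity
    have hmem : c ^ (n + 1) * ξ ∈ Set.Icc (c * (η / 2)) (η / 2) := by
      constructor
      · have := mul_le_mul_of_nonneg_left hn1 hcn.le
        rw [pow_succ] at this ⊢
        have hcn' : c ^ n * (c ^ n)⁻¹ = 1 := mul_inv_cancel₀ (by positivity)
        calc c * (η / 2) = c ^ n * c * ((c ^ n)⁻¹ * (η / 2)) := by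
              rw [show c ^ n * c * ((c ^ n)⁻¹ * (η / 2)) = (c ^ n * (c ^ n)⁻¹) * (c * (η / 2)) by
                ring, hcn', one_mul]
          _ ≤ _ := this
      · have := mul_le_mul_of_nonneg_left hn2.le hcn.le
        rwa [mul_inv_cancel_left₀ hcn.ne'] at this
    have h1 : ‖φ ξ‖ ≤ q ^ b ^ (n + 1) :=
      (hiter (n + 1) ξ).trans (pow_le_pow_left₀ (norm_nonneg _) (hmax hmem) _)
    have h2 := hC (n + 1)
    rw [pow_one] at h2
    have hbm : 0 < (b : ℝ) ^ (n + 1) := by positivity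
    -- `H ≤ 1` gives `c ≥ 1 / b`, so `ξ` is at most of order `b ^ (n + 1)`, and `q ^ b ^ (n + 1)`
    -- absorbs its square.
    have h3 : ξ ≤ (b : ℝ) ^ (n + 1) * (η / 2) := by
      refine hn2.le.trans ?_
      have : (c ^ (n + 1))⁻¹ ≤ (b : ℝ) ^ (n + 1) := by
        rw [inv_le_comm₀ hcn hbm, ← inv_pow]
        exact pow_le_pow_left₀ (by positivity) hcb _
      exact mul_le_mul_of_nonneg_right this (by positivity)
    calc ‖φ ξ‖ * ξ ^ 2 ≤ q ^ b ^ (n + 1) * ((b : ℝ) ^ (n + 1) * (η / 2)) ^ 2 :=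
          mul_le_mul h1 (pow_le_pow_left₀ hξ0.le h3 2) (sq_nonneg _)
            (pow_nonneg (norm_nonneg _) _)
      _ = (b : ℝ) ^ (n + 1) * q ^ b ^ (n + 1) * ((b : ℝ) ^ (n + 1) * (η / 2) ^ 2) := by ring
      _ ≤ C * ((b : ℝ)⁻¹) ^ (n + 1) * ((b : ℝ) ^ (n + 1) * (η / 2) ^ 2) :=
          mul_le_mul_of_nonneg_right h2 (by positivity)
      _ = C * (η / 2) ^ 2 * (((b : ℝ)⁻¹) ^ (n + 1) * (b : ℝ) ^ (n + 1)) := by ring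
      _ = C * (η / 2) ^ 2 := by
          rw [← mul_pow, inv_mul_cancel₀ hb0.ne', one_pow, mul_one]
  have hle : ∀ ξ, ‖φ ξ‖ ≤ 1 := fun ξ => norm_fourier_le_one _ _
  have hneg : ∀ ξ, ‖φ (-ξ)‖ = ‖φ ξ‖ := fun ξ => by
    rw [show φ (-ξ) = starRingEnd ℂ (φ ξ) from fourier_neg _ _, RCLike.norm_conj]
  refine ⟨1 + (η / 2) ^ 2 + C * (η / 2) ^ 2, by positivity, fun ξ => ?_⟩
  rw [← div_eq_mul_inv, le_div_iff₀ (by positivity), mul_add, mul_one]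
  have hmain : ‖φ ξ‖ * ξ ^ 2 ≤ (η / 2) ^ 2 + C * (η / 2) ^ 2 := by
    have hC' : 0 ≤ C * (η / 2) ^ 2 := by positivity
    rcases le_or_gt |ξ| (η / 2) with h | h
    · have h1 : ξ ^ 2 ≤ (η / 2) ^ 2 := sq_le_sq' (neg_le_of_abs_le h) (le_of_abs_le h)
      have h2 := mul_le_of_le_one_left (sq_nonneg ξ) (hle ξ)
      linarith
    · have h1 := hpos |ξ| h
      rw [sq_abs] at h1
      have h2 : ‖φ |ξ|‖ = ‖φ ξ‖ := by
        rcases abs_choice ξ with h3 | h3 <;> rw [h3]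
        exact hneg ξ
      rw [h2] at h1
      linarith [sq_nonneg (η / 2)]
  linarith [hle ξ]

end SignCascade

namespace SignCascade

/-! ### Small increments are rare -/

variable {b : ℕ} {H : ℝ} [hprob : IsProbabilityMeasure (signLaw b H)]

/-- `[s, t]` contains a `b`-adic interval of comparable length. The decay of the limit total's
characteristic function, rescaled by `c ^ (n + 1)`, dominates that of the increment, and its
integral is of order `(t - s) ^ (-H)`. -/
lemma exists_measureReal_abs_lim_sub_le (hb : 2 ≤ b) (hH : 1 / 2 < H) (hH1 : H < 1) :
    ∃ K : ℝ, 0 ≤ K ∧ ∀ s t : ℝ, 0 ≤ s → s < t → t ≤ 1 → ∀ r : ℝ, 0 < r →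
      (signMeasure b H).real {e | |lim (ratio b H) e t - lim (ratio b H) e s| ≤ r} ≤
        K * r * (t - s) ^ (-H) := by
  have : NeZero b := ⟨by lia⟩
  obtain ⟨K, hK0, hK⟩ := exists_norm_fourier_limTotal_le (b := b) hb hH hH1
  have hb1 : (1 : ℝ) < b := by exact_mod_cast (by lia : 1 < b)
  have hb0 : (0 : ℝ) < b := by linarith
  refine ⟨2 * (K * Real.pi) * (2 * b) ^ H, by positivity, fun s t hs hst ht r hr => ?_⟩
  have hd : 0 < t - s := sub_pos.2 hst
  -- `b ^ n ≤ 2 / (t - s) < b ^ (n + 1)`: an interval of generation `n + 1` containing the midpoint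
  -- fits inside `[s, t]`, and its length is not much smaller.
  obtain ⟨n, hn1, hn2⟩ := exists_nat_pow_near (x := 2 / (t - s)) (y := b)
    (by rw [le_div_iff₀ hd]; linarith) hb1
  obtain ⟨w, x, hw, hx, hwx⟩ := exists_pos_eq (b := b) (n + 1) (t := (s + t) / 2)
    ⟨by linarith, by linarith⟩
  have hbn : 0 < (b : ℝ) ^ (n + 1) := by positivity
  rw [div_lt_iff₀ hd] at hn2
  have hpos : ∀ z : ℝ, |z| ≤ 1 → |z / (b : ℝ) ^ (n + 1)| ≤ (t - s) / 2 := by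
    intro z hz
    rw [abs_div, abs_of_pos hbn, div_le_iff₀ hbn]
    linarith
  have h0 : s ≤ pos w 0 := by
    have h1 := pos_sub w 0 x
    have h2 := (abs_le.1 (hpos (0 - x) (by rw [abs_le]; constructor <;> linarith [hx.1, hx.2]))).1
    rw [hwx, hw] at h1
    linarith
  have h1 : pos w 1 ≤ t := by
    have h1 := pos_sub w 1 x
    have h2 := (abs_le.1 (hpos (1 - x) (by rw [abs_le]; constructor <;> linarith [hx.1, hx.2]))).2
    rw [hwx, hw] at h1
    linarith
  set c := (ratio b H : ℝ) with hc
  have hc0 : 0 < c := NNReal.coe_pos.2 (ratio_pos hb H)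
  have hcn : 0 < c ^ (n + 1) := by positivity
  have hg : Integrable fun ξ : ℝ => K * (1 + (c ^ (n + 1) * ξ) ^ 2)⁻¹ :=
    (integrable_inv_one_add_sq.comp_mul_left' hcn.ne').const_mul K
  refine (measureReal_abs_le_le ((measurable_lim c t).sub (measurable_lim c s)) hg
    (fun ξ => ?_) hr).trans ?_
  · refine (norm_fourier_lim_sub_le hb hH hH1.le w h0 h1 ξ).trans ?_
    rw [hw]
    exact hK _
  · rw [integral_const_mul, Measure.integral_comp_mul_left (fun x : ℝ => (1 + x ^ 2)⁻¹),
      integral_univ_inv_one_add_sq, abs_of_pos (inv_pos.2 hcn), smul_eq_mul]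
    have h2 : (c ^ (n + 1))⁻¹ ≤ (2 * b) ^ H * (t - s) ^ (-H) := by
      have h3 : (c ^ (n + 1))⁻¹ = ((b : ℝ) ^ (n + 1)) ^ H := by
        rw [hc, coe_ratio, Real.rpow_neg hb0.le, inv_pow, inv_inv, ← Real.rpow_natCast,
          ← Real.rpow_natCast, ← Real.rpow_mul hb0.le, ← Real.rpow_mul hb0.le, mul_comm]
      have h4 : (b : ℝ) ^ (n + 1) ≤ 2 * b * (t - s)⁻¹ := by
        rw [pow_succ]
        calc (b : ℝ) ^ n * b ≤ 2 / (t - s) * b := mul_le_mul_of_nonneg_right hn1 hb0.le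
          _ = _ := by ring
      rw [h3, Real.rpow_neg hd.le, ← Real.inv_rpow hd.le, ← Real.mul_rpow (by positivity)
        (by positivity)]
      exact Real.rpow_le_rpow hbn.le h4 (by linarith)
    calc 2 * r * (K * ((c ^ (n + 1))⁻¹ * Real.pi))
        = 2 * r * K * Real.pi * (c ^ (n + 1))⁻¹ := by ring
      _ ≤ 2 * r * K * Real.pi * ((2 * b) ^ H * (t - s) ^ (-H)) :=
          mul_le_mul_of_nonneg_left h2 (by positivity)
      _ = _ := by ring

end SignCascade

namespace SignCascade

/-! ### The mass distribution principle on a graph -/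

/-- The parameters of the points of the graph of `f` close to the point over `t`. -/
def near (f : C(I, ℝ)) (r : ℝ) (t : I) : Set I := {s | |(s : ℝ) - t| ≤ r ∧ |f s - f t| ≤ r}

/-- The point of the graph of `f` over `t`. -/
def graphPoint (f : C(I, ℝ)) (t : I) : EuclideanSpace ℝ (Fin 2) := !₂[(t : ℝ), f t]

lemma continuous_graphPoint (f : C(I, ℝ)) : Continuous (graphPoint f) := by
  unfold graphPoint
  fun_prop

lemma mem_near_of_dist_le {f : C(I, ℝ)} {r : ℝ} {s t : I}
    (h : dist (graphPoint f s) (graphPoint f t) ≤ r) : s ∈ near f r t := by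
  have h1 := fun i => (PiLp.norm_apply_le (graphPoint f s - graphPoint f t) i).trans
    ((dist_eq_norm _ _).symm.le.trans h)
  exact ⟨by simpa [graphPoint] using h1 0, by simpa [graphPoint] using h1 1⟩

lemma measurable_volume_near (f : C(I, ℝ)) (r : ℝ) :
    Measurable fun t => volume (near f r t) := by
  have h1 : Continuous fun p : I × I => |(p.2 : ℝ) - p.1| := by fun_prop
  have h2 : Continuous fun p : I × I => |f p.2 - f p.1| := by fun_prop
  have hc : IsClosed {p : I × I | |(p.2 : ℝ) - p.1| ≤ r ∧ |f p.2 - f p.1| ≤ r} := by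
    rw [Set.ofPred_and]
    exact (isClosed_le h1 continuous_const).inter (isClosed_le h2 continuous_const)
  exact measurable_measure_prodMk_left hc.measurableSet

/-- The dyadic energy of the lift of the Lebesgue measure at the point of the graph over `t`. -/
def potential (γ : ℝ) (f : C(I, ℝ)) (t : I) : ℝ≥0∞ :=
  ∑' j : ℕ, ((2 : ℝ≥0∞) ^ j) ^ γ * volume (near f (2⁻¹ ^ j) t)

lemma measurable_potential (γ : ℝ) (f : C(I, ℝ)) : Measurable (potential γ f) :=
  Measurable.tsum fun _ => (measurable_volume_near f _).const_mul _

/-- Mass distribution principle: on a set `A` of positive measure the potential is bounded, so the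
lift of Lebesgue measure on `A` gives a set of diameter `d ≤ 1` mass at most a constant times `d ^
γ`. -/
lemma le_dimH_graph {γ : ℝ≥0} (hγ : 0 < γ) {f : C(I, ℝ)}
    (hf : ∫⁻ t, potential γ f t ≠ ∞) : (γ : ℝ≥0∞) ≤ dimH (graph f) := by
  obtain ⟨M, hM⟩ : ∃ M : ℕ, volume {t | potential γ f t ≤ M} ≠ 0 := by
    by_contra! h
    have h1 := measure_iUnion_null h
    have h2 : ∀ᵐ t : I, t ∈ ⋃ M : ℕ, {t | potential γ f t ≤ M} := by
      filter_upwards [ae_lt_top (measurable_potential γ f) hf] with t ht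
      obtain ⟨M, hM⟩ := ENNReal.exists_nat_gt ht.ne
      exact Set.mem_iUnion.2 ⟨M, hM.le⟩
    have h3 : volume (Set.univ : Set I) = 0 := by
      rw [← h1]
      exact (measure_congr (eventuallyEq_univ.2 h2)).symm
    simp at h3
  set A := {t | potential γ f t ≤ M} with hA
  have hAm : MeasurableSet A := measurable_potential γ f measurableSet_Iic
  borelize (EuclideanSpace ℝ (Fin 2))
  set ν : Measure (EuclideanSpace ℝ (Fin 2)) := (volume.restrict A).map (graphPoint f)
  have hg := (continuous_graphPoint f).measurable
  -- The factor `2 ^ γ` pays for rounding a diameter to a dyadic scale; `M + 1` keeps `K` nonzero.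
  set K : ℝ≥0∞ := (M + 1) * 2 ^ (γ : ℝ) with hK
  have hK0 : K ≠ 0 := by simp [hK]
  have hKtop : K ≠ ∞ := ENNReal.mul_ne_top (by simp) (by simp)
  have hγ' : (0 : ℝ) < γ := hγ
  have hscale : ∀ (S : Set (EuclideanSpace ℝ (Fin 2))) (j : ℕ),
      Metric.ediam S ≤ ENNReal.ofReal (2⁻¹ ^ j) → ((2 : ℝ≥0∞) ^ j) ^ (γ : ℝ) * ν S ≤ M := by
    intro S j hS
    -- The closure is measurable and has the same diameter. If it meets the lift of `A`, a point
    -- over `A` serves as centre, and a single term of its potential gives the bound.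
    refine (mul_le_mul_right (measure_mono subset_closure) _).trans ?_
    rw [Measure.map_apply hg isClosed_closure.measurableSet,
      Measure.restrict_apply (hg isClosed_closure.measurableSet)]
    rcases (graphPoint f ⁻¹' closure S ∩ A).eq_empty_or_nonempty with h | ⟨t, htS, htA⟩
    · simp [h]
    have hsub : graphPoint f ⁻¹' closure S ∩ A ⊆ near f (2⁻¹ ^ j) t := by
      rintro s ⟨hs, -⟩
      refine mem_near_of_dist_le ?_
      rw [← edist_le_ofReal (by positivity)]
      refine (Metric.edist_le_ediam_of_mem (Set.mem_preimage.1 hs) (Set.mem_preimage.1 htS)).trans ?_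
      rwa [Metric.ediam_closure]
    exact ((mul_le_mul_right (measure_mono hsub) _).trans
      (ENNReal.le_tsum (f := fun j : ℕ => ((2 : ℝ≥0∞) ^ j) ^ (γ : ℝ) *
        volume (near f (2⁻¹ ^ j) t)) j)).trans htA
  have hle : K⁻¹ • ν ≤ μH[(γ : ℝ)] := by
    refine Measure.le_hausdorffMeasure _ _ 1 one_pos fun S hS => ?_
    rw [Measure.smul_apply, smul_eq_mul, ENNReal.inv_mul_le_iff hK0 hKtop]
    rcases eq_or_ne (Metric.ediam S) 0 with h0 | h0
    -- Sets of diameter zero: positive mass would contradict the bounds at all dyadic scales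
    -- together.
    · rw [h0, ENNReal.zero_rpow_of_pos hγ', mul_zero, nonpos_iff_eq_zero]
      by_contra hν
      have hlim : Tendsto (fun j : ℕ => ((2 : ℝ≥0∞) ^ j) ^ (γ : ℝ) * ν S) atTop (𝓝 ∞) := by
        have h1 : Tendsto (fun j : ℕ => (2 : ℝ≥0∞) ^ j) atTop (𝓝 ∞) :=
          ENNReal.tendsto_pow_atTop_nhds_top_iff.2 (by norm_num)
        have h2 := (ENNReal.continuous_rpow_const (y := (γ : ℝ))).tendsto ∞ |>.comp h1
        rw [ENNReal.top_rpow_of_pos hγ'] at h2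
        have h3 := ENNReal.Tendsto.mul_const (b := ν S) h2 (Or.inl ENNReal.top_ne_zero)
        rwa [ENNReal.top_mul hν] at h3
      have := le_of_tendsto' hlim fun j => hscale S j (by rw [h0]; exact zero_le)
      simp at this
    · have hfin : Metric.ediam S ≠ ∞ := (hS.trans_lt ENNReal.one_lt_top).ne
      set d := (Metric.ediam S).toReal with hd
      have hd0 : 0 < d := ENNReal.toReal_pos h0 hfin
      have hdS : ENNReal.ofReal d = Metric.ediam S := ENNReal.ofReal_toReal hfin
      have hd1 : d ≤ 1 := by
        rw [← hdS] at hS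
        simpa using hS
      obtain ⟨j, hj1, hj2⟩ := exists_nat_pow_near_of_lt_one hd0 hd1 (y := (2⁻¹ : ℝ))
        (by norm_num) (by norm_num)
      have h1 := hscale S j (by rw [← hdS]; exact ENNReal.ofReal_le_ofReal hj2)
      have h2 : 1 ≤ (2 * Metric.ediam S) * (2 : ℝ≥0∞) ^ j := by
        rw [← hdS, show (2 : ℝ≥0∞) = ENNReal.ofReal 2 by simp, ← ENNReal.ofReal_mul (by norm_num),
          ← ENNReal.ofReal_pow (by norm_num), ← ENNReal.ofReal_mul (by positivity),
          ENNReal.one_le_ofReal]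
        have : (2⁻¹ : ℝ) ^ (j + 1) * (2 * 2 ^ j) = 1 := by
          rw [inv_pow, pow_succ]
          field_simp
        nlinarith [pow_pos (two_pos (α := ℝ)) j]
      calc ν S ≤ ((2 * Metric.ediam S) * (2 : ℝ≥0∞) ^ j) ^ (γ : ℝ) * ν S :=
            le_mul_of_one_le_left' (ENNReal.one_le_rpow h2 hγ')
        _ = (2 * Metric.ediam S) ^ (γ : ℝ) * (((2 : ℝ≥0∞) ^ j) ^ (γ : ℝ) * ν S) := by
            rw [ENNReal.mul_rpow_of_nonneg _ _ hγ'.le, mul_assoc]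
        _ ≤ (2 * Metric.ediam S) ^ (γ : ℝ) * (M + 1) :=
            mul_le_mul_right (h1.trans le_self_add) _
        _ = K * Metric.ediam S ^ (γ : ℝ) := by
            rw [ENNReal.mul_rpow_of_nonneg _ _ hγ'.le, hK]
            ring
  refine le_dimH_of_hausdorffMeasure_ne_zero fun h => ?_
  have h1 := hle (graph f)
  rw [h, Measure.smul_apply, smul_eq_mul, nonpos_iff_eq_zero, mul_eq_zero] at h1
  have hrange : ν (graph f) = volume A := by
    have hm : MeasurableSet (graph f) :=
      (isCompact_range (continuous_graphPoint f)).isClosed.measurableSet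
    rw [Measure.map_apply hg hm, Measure.restrict_apply (hg hm),
      show graphPoint f ⁻¹' graph f = Set.univ from Set.preimage_range _, Set.univ_inter]
  rw [hrange] at h1
  exact h1.elim (ENNReal.inv_ne_zero.2 hKtop) hM

end SignCascade

namespace SignCascade

/-! ### The dimension of a random graph whose increments are rarely small -/

lemma setLIntegral_Icc_rpow_neg {H r : ℝ} (hH : H < 1) (hr : 0 < r) :
    ∫⁻ x in Set.Icc 0 r, ENNReal.ofReal (|x| ^ (-H)) = ENNReal.ofReal (r ^ (1 - H) / (1 - H)) := by
  have hi := (intervalIntegral.intervalIntegrable_rpow' (a := 0) (b := r)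
    (by linarith : -1 < -H)).1
  have h1 : ∫⁻ x in Set.Icc 0 r, ENNReal.ofReal (|x| ^ (-H)) =
      ∫⁻ x in Set.Ioc 0 r, ENNReal.ofReal (x ^ (-H)) := by
    rw [setLIntegral_congr Ioc_ae_eq_Icc.symm]
    exact setLIntegral_congr_fun measurableSet_Ioc fun x hx => by
      rw [abs_of_pos hx.1]
  rw [h1, ← ofReal_integral_eq_lintegral_ofReal hi
    ((ae_restrict_iff' measurableSet_Ioc).2 (ae_of_all _ fun x hx => Real.rpow_nonneg hx.1.le _)),
    ← intervalIntegral.integral_of_le hr.le, integral_rpow (Or.inl (by linarith)),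
    show -H + 1 = 1 - H by ring, Real.zero_rpow (by linarith), sub_zero]

lemma setLIntegral_Icc_neg_rpow_neg_le {H r : ℝ} (hH : H < 1) (hr : 0 < r) :
    ∫⁻ x in Set.Icc (-r) r, ENNReal.ofReal (|x| ^ (-H)) ≤
      2 * ENNReal.ofReal (r ^ (1 - H) / (1 - H)) := by
  have h1 : ∫⁻ x in Set.Icc (-r) 0, ENNReal.ofReal (|x| ^ (-H)) =
      ∫⁻ x in Set.Icc 0 r, ENNReal.ofReal (|x| ^ (-H)) := by
    have h := (Measure.measurePreserving_neg (volume : Measure ℝ)).setLIntegral_comp_preimage_emb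
      (MeasurableEquiv.neg ℝ).measurableEmbedding (fun x => ENNReal.ofReal (|x| ^ (-H)))
      (Set.Icc 0 r)
    simpa using h
  rw [← Set.Icc_union_Icc_eq_Icc (neg_nonpos.2 hr.le) hr.le]
  refine (lintegral_union_le _ _ _).trans ?_
  rw [h1, setLIntegral_Icc_rpow_neg hH hr, two_mul]

variable {Ω : Type*} [MeasurableSpace Ω] {μ : Measure Ω} [IsProbabilityMeasure μ]
  {B : Ω → C(I, ℝ)} {H : ℝ}

lemma measurableSet_near (hB : StronglyMeasurable B) (r : ℝ) :
    MeasurableSet {p : Ω × I × I | p.2.2 ∈ near (B p.1) r p.2.1} := by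
  have h1 : ∀ g : I × I → I, Continuous g → Measurable fun p : Ω × I × I => B p.1 (g p.2) :=
    fun g hg => ((continuous_eval (F := C(I, ℝ))).comp_stronglyMeasurable
      ((hB.comp_measurable measurable_fst).prodMk
        (hg.stronglyMeasurable.comp_measurable measurable_snd))).measurable
  have h2 := h1 _ continuous_fst
  have h3 := h1 _ continuous_snd
  have h4 : Measurable fun p : Ω × I × I => |(p.2.2 : ℝ) - p.2.1| := by fun_prop
  exact (measurableSet_le h4 measurable_const).inter
    (measurableSet_le (_root_.continuous_abs.measurable.comp (h3.sub h2)) measurable_const)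

/-- By Fubini this is the integral over `|s - t| ≤ r` of the small increment probability `K r |s -
t| ^ (-H)`, whose singularity is integrable because `H < 1`. -/
lemma lintegral_volume_near_le (hB : StronglyMeasurable B) (hH : H < 1) {K : ℝ} (hK : 0 ≤ K)
    (h : ∀ s t : I, s ≠ t → ∀ r : ℝ, 0 < r →
      μ {ω | |B ω s - B ω t| ≤ r} ≤ ENNReal.ofReal (K * r * |(s : ℝ) - t| ^ (-H)))
    {r : ℝ} (hr : 0 < r) :
    ∫⁻ ω, (∫⁻ t, volume (near (B ω) r t)) ∂μ ≤ ENNReal.ofReal (2 * K / (1 - H) * r ^ (2 - H)) := by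
  have hS := measurableSet_near hB r
  have h1 : ∀ ω, ∫⁻ t, volume (near (B ω) r t) =
      (volume.prod volume) (Prod.mk ω ⁻¹' {p : Ω × I × I | p.2.2 ∈ near (B p.1) r p.2.1}) :=
    fun ω => by
      rw [Measure.prod_apply (measurable_prodMk_left hS)]
      rfl
  simp_rw [h1]
  rw [← Measure.prod_apply hS, Measure.prod_apply_symm hS,
    lintegral_prod _ (measurable_measure_prodMk_right hS).aemeasurable]
  set G : ℝ → ℝ≥0∞ := (Set.Icc (-r) r).indicator fun x =>
    ENNReal.ofReal (K * r) * ENNReal.ofReal (|x| ^ (-H)) with hG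
  have h2 : ∀ t : I, ∫⁻ s : I, μ ((fun ω => (ω, t, s)) ⁻¹'
      {p : Ω × I × I | p.2.2 ∈ near (B p.1) r p.2.1}) ≤
        ENNReal.ofReal (2 * K / (1 - H) * r ^ (2 - H)) := by
    intro t
    calc _ ≤ ∫⁻ s : I, G ((s : ℝ) - t) := by
          refine lintegral_mono_ae ?_
          have hne : ∀ᵐ s : I, s ≠ t := by
            rw [ae_iff]
            simp
          filter_upwards [hne] with s hs
          by_cases hst : |(s : ℝ) - t| ≤ r
          · rw [hG, Set.indicator_of_mem (Set.mem_Icc.2 (abs_le.1 hst)), ← ENNReal.ofReal_mul (by positivity)]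
            exact (measure_mono fun ω hω => hω.2).trans (h s t hs r hr)
          · refine (measure_mono_null (t := ∅) (fun ω hω => hst hω.1) measure_empty).le.trans ?_
            exact zero_le
      _ = ∫⁻ x in Set.Icc (0 : ℝ) 1, G (x - t) :=
          lintegral_subtype_comap measurableSet_Icc (fun x : ℝ => G (x - t))
      _ ≤ ∫⁻ x, G (x - t) := setLIntegral_le_lintegral _ _
      _ = ∫⁻ x, G x := lintegral_sub_right_eq_self G (t : ℝ)
      _ = ENNReal.ofReal (K * r) * ∫⁻ x in Set.Icc (-r) r, ENNReal.ofReal (|x| ^ (-H)) := by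
          rw [hG, lintegral_indicator measurableSet_Icc, lintegral_const_mul _ (by fun_prop)]
      _ ≤ ENNReal.ofReal (K * r) * (2 * ENNReal.ofReal (r ^ (1 - H) / (1 - H))) :=
          mul_le_mul_right (setLIntegral_Icc_neg_rpow_neg_le hH hr) _
      _ = _ := by
          rw [show (2 : ℝ≥0∞) = ENNReal.ofReal 2 by simp, ← ENNReal.ofReal_mul (by norm_num),
            ← ENNReal.ofReal_mul (by positivity), show 2 - H = 1 + (1 - H) by ring,
            Real.rpow_add hr, Real.rpow_one]
          congr 1
          ring
  exact (lintegral_mono h2).trans (by simp)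

/-- The expected energy is dominated by the series of `2 ^ (j (γ - (2 - H)))`, which converges below
the critical exponent. -/
lemma ae_le_dimH_graph_of_lt (hB : StronglyMeasurable B) (hH : H < 1) {K : ℝ} (hK : 0 ≤ K)
    (h : ∀ s t : I, s ≠ t → ∀ r : ℝ, 0 < r →
      μ {ω | |B ω s - B ω t| ≤ r} ≤ ENNReal.ofReal (K * r * |(s : ℝ) - t| ^ (-H)))
    {γ : ℝ≥0} (hγ : 0 < γ) (hγH : (γ : ℝ) < 2 - H) :
    ∀ᵐ ω ∂μ, (γ : ℝ≥0∞) ≤ dimH (graph (B ω)) := by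
  have hS := fun j : ℕ => measurableSet_near hB (2⁻¹ ^ j)
  have hm1 : ∀ j : ℕ, Measurable fun p : Ω × I => volume (near (B p.1) (2⁻¹ ^ j) p.2) := by
    intro j
    have := measurable_measure_prodMk_left (ν := (volume : Measure I))
      (MeasurableEquiv.prodAssoc.measurable (hS j))
    exact this
  have hm2 : Measurable fun p : Ω × I => potential γ (B p.1) p.2 :=
    Measurable.tsum fun j => (hm1 j).const_mul _
  have hm3 : ∀ j : ℕ, Measurable fun ω => ∫⁻ t, volume (near (B ω) (2⁻¹ ^ j) t) := fun j =>
    (hm1 j).lintegral_prod_right'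
  have hfin : ∫⁻ ω, (∫⁻ t, potential γ (B ω) t) ∂μ ≠ ∞ := by
    simp only [potential]
    have h1 : ∀ ω, ∫⁻ t, ∑' j : ℕ, ((2 : ℝ≥0∞) ^ j) ^ (γ : ℝ) * volume (near (B ω) (2⁻¹ ^ j) t) =
        ∑' j : ℕ, ((2 : ℝ≥0∞) ^ j) ^ (γ : ℝ) * ∫⁻ t, volume (near (B ω) (2⁻¹ ^ j) t) := by
      intro ω
      rw [lintegral_tsum fun j => ((measurable_volume_near _ _).const_mul _).aemeasurable]
      exact tsum_congr fun j => lintegral_const_mul _ (measurable_volume_near _ _)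
    simp_rw [h1]
    rw [lintegral_tsum fun j => ((hm3 j).const_mul _).aemeasurable]
    simp_rw [lintegral_const_mul _ (hm3 _)]
    set q : ℝ := 2 ^ ((γ : ℝ) - (2 - H)) with hq
    have hq0 : 0 < q := by positivity
    have hq1 : q < 1 := Real.rpow_lt_one_of_one_lt_of_neg (by norm_num) (by linarith)
    have hK' : 0 ≤ 2 * K / (1 - H) := div_nonneg (by linarith) (by linarith)
    have h2 : ∀ j : ℕ, ((2 : ℝ≥0∞) ^ j) ^ (γ : ℝ) *
        ∫⁻ ω, (∫⁻ t, volume (near (B ω) (2⁻¹ ^ j) t)) ∂μ ≤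
          ENNReal.ofReal (2 * K / (1 - H) * q ^ j) := by
      intro j
      refine (mul_le_mul_right (lintegral_volume_near_le hB hH hK h (by positivity)) _).trans
        (le_of_eq ?_)
      rw [show (2 : ℝ≥0∞) = ENNReal.ofReal 2 by simp, ← ENNReal.ofReal_pow (by norm_num),
        ENNReal.ofReal_rpow_of_pos (by positivity), ← ENNReal.ofReal_mul (by positivity)]
      congr 1
      rw [inv_pow, Real.inv_rpow (by positivity), ← Real.rpow_neg (by positivity), hq,
        ← Real.rpow_natCast, ← Real.rpow_natCast, ← Real.rpow_mul (by norm_num),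
        ← Real.rpow_mul (by norm_num), ← Real.rpow_mul (by norm_num), mul_left_comm,
        ← Real.rpow_add (by norm_num)]
      congr 2
      ring
    refine ((ENNReal.tsum_le_tsum h2).trans_lt ?_).ne
    rw [← ENNReal.ofReal_tsum_of_nonneg (fun j => by positivity)
      ((summable_geometric_of_lt_one hq0.le hq1).mul_left _)]
    exact ENNReal.ofReal_lt_top
  filter_upwards [ae_lt_top hm2.lintegral_prod_right' hfin] with ω hω
  exact le_dimH_graph hγ hω.ne

lemma ae_le_dimH_graph (hB : StronglyMeasurable B) (hH : H < 1) {K : ℝ} (hK : 0 ≤ K)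
    (h : ∀ s t : I, s ≠ t → ∀ r : ℝ, 0 < r →
      μ {ω | |B ω s - B ω t| ≤ r} ≤ ENNReal.ofReal (K * r * |(s : ℝ) - t| ^ (-H))) :
    ∀ᵐ ω ∂μ, ENNReal.ofReal (2 - H) ≤ dimH (graph (B ω)) := by
  have h1 : ∀ n : ℕ, ∀ᵐ ω ∂μ,
      ENNReal.ofReal (2 - H - (1 - H) / (n + 1)) ≤ dimH (graph (B ω)) := by
    intro n
    have h2 : (1 - H) / (n + 1) ≤ 1 - H := div_le_self (by linarith) (by linarith [n.cast_nonneg' (α := ℝ)])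
    have h3 : 0 < (1 - H) / (n + 1) := div_pos (by linarith) (by positivity)
    refine ae_le_dimH_graph_of_lt hB hH hK h (γ := Real.toNNReal _) ?_ ?_
    · rw [Real.toNNReal_pos]; linarith
    · rw [Real.coe_toNNReal _ (by linarith)]; linarith
  filter_upwards [ae_all_iff.2 h1] with ω hω
  have h2 : Tendsto (fun n : ℕ => ENNReal.ofReal (2 - H - (1 - H) / (n + 1))) atTop
      (𝓝 (ENNReal.ofReal (2 - H))) := by
    refine ENNReal.tendsto_ofReal ?_
    have h3 := (tendsto_one_div_add_atTop_nhds_zero_nat (𝕜 := ℝ)).const_mul (1 - H)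
    simpa [div_eq_mul_inv] using h3.const_sub (2 - H)
  exact le_of_tendsto' h2 hω

end SignCascade

namespace SignCascade

/-! ### Box dimensions -/

section BoxDimension

variable {X : Type*} [EMetricSpace X] {A : Set X} {δ : ℝ≥0} {d : ℝ}

lemma log_rpow_neg (hδ : 0 < δ) (d : ℝ) :
    ENNReal.log ((δ : ℝ≥0∞) ^ (-d)) = (d : EReal) * ((-Real.log δ : ℝ) : EReal) := by
  rw [ENNReal.log_rpow, ENNReal.log_of_nnreal hδ.ne', ← EReal.coe_mul, ← EReal.coe_mul]
  congr 1
  ring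

lemma boxRatio_lt_iff (hδ : 0 < δ) (hδ1 : δ < 1) :
    boxRatio A δ < d ↔ ((Metric.coveringNumber δ A : ℕ∞) : ℝ≥0∞) < (δ : ℝ≥0∞) ^ (-d) := by
  have hlog : 0 < -Real.log δ := neg_pos.2 (Real.log_neg hδ hδ1)
  rw [boxRatio, EReal.div_lt_iff (EReal.coe_pos.2 hlog) (EReal.coe_ne_top _),
    ← log_rpow_neg hδ, ENNReal.log_lt_log_iff]

lemma boxRatio_le_iff (hδ : 0 < δ) (hδ1 : δ < 1) :
    boxRatio A δ ≤ d ↔ ((Metric.coveringNumber δ A : ℕ∞) : ℝ≥0∞) ≤ (δ : ℝ≥0∞) ^ (-d) := by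
  have hlog : 0 < -Real.log δ := neg_pos.2 (Real.log_neg hδ hδ1)
  rw [boxRatio, EReal.div_le_iff_le_mul (EReal.coe_pos.2 hlog) (EReal.coe_ne_top _), mul_comm,
    ← log_rpow_neg hδ, ENNReal.log_le_log_iff]

lemma eventually_pos_and_lt_one : ∀ᶠ δ : ℝ≥0 in 𝓝[>] 0, 0 < δ ∧ δ < 1 := by
  filter_upwards [self_mem_nhdsWithin, nhdsWithin_le_nhds (Iio_mem_nhds one_pos)] with δ h1 h2
  exact ⟨h1, h2⟩

/-- Along radii `δ` tending to `0` fewer than `δ ^ (-d)` balls suffice. Their diameters to the power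
`d` sum to at most `2 ^ d`, so the `d`-dimensional Hausdorff measure is finite. -/
lemma dimH_le_of_lowerBoxDim_lt {d : ℝ≥0} (h : lowerBoxDim A < ((d : ℝ) : EReal)) :
    dimH A ≤ d := by
  borelize X
  obtain ⟨δ, hδ, hP⟩ := exists_seq_forall_of_frequently
    ((frequently_lt_of_liminf_lt isCobounded_ge_of_top h).and_eventually
      eventually_pos_and_lt_one)
  have hN : ∀ n, ((Metric.coveringNumber (δ n) A : ℕ∞) : ℝ≥0∞) <
      (δ n : ℝ≥0∞) ^ (-(d : ℝ)) := fun n =>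
    (boxRatio_lt_iff (hP n).2.1 (hP n).2.2).1 (hP n).1
  have htop : ∀ n, Metric.coveringNumber (δ n) A ≠ ⊤ := by
    intro n hn
    have := hN n
    simp [hn] at this
  have hcount : ∀ n, Countable (Metric.minimalCover (δ n) A) := fun n =>
    Metric.finite_minimalCover.countable.to_subtype
  have hδ0 : Tendsto (fun n => 2 * (δ n : ℝ≥0∞)) atTop (𝓝 0) := by
    have h1 : Tendsto (fun n => (δ n : ℝ≥0∞)) atTop (𝓝 0) :=
      ENNReal.tendsto_coe.2 (hδ.mono_right nhdsWithin_le_nhds)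
    simpa using ENNReal.Tendsto.const_mul h1 (Or.inr (by norm_num : (2 : ℝ≥0∞) ≠ ∞))
  have hle := Measure.hausdorffMeasure_le_liminf_tsum (d : ℝ) A _ hδ0
    (fun n (x : Metric.minimalCover (δ n) A) => Metric.closedEBall (x : X) (δ n))
    (Eventually.of_forall fun n x => Metric.ediam_closedEBall_le)
    (Eventually.of_forall fun n => by
      have := Metric.isCover_iff_subset_iUnion_closedEBall.1
        (Metric.isCover_minimalCover (htop n))
      rwa [Set.biUnion_eq_iUnion] at this)
  refine dimH_le_of_hausdorffMeasure_ne_top (ne_top_of_le_ne_top (b := 2 ^ (d : ℝ)) (by simp)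
    (hle.trans ?_))
  refine (liminf_le_liminf (v := fun _ => (2 : ℝ≥0∞) ^ (d : ℝ))
    (Eventually.of_forall fun n => ?_)).trans (liminf_const _).le
  have hδn : (δ n : ℝ≥0∞) ≠ 0 := ENNReal.coe_ne_zero.2 (hP n).2.1.ne'
  calc ∑' x : Metric.minimalCover (δ n) A, Metric.ediam (Metric.closedEBall (x : X) (δ n)) ^ (d : ℝ)
      ≤ ∑' _ : Metric.minimalCover (δ n) A, (2 * (δ n : ℝ≥0∞)) ^ (d : ℝ) :=
        ENNReal.tsum_le_tsum fun x =>
          ENNReal.rpow_le_rpow Metric.ediam_closedEBall_le d.2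
    _ = ((Metric.coveringNumber (δ n) A : ℕ∞) : ℝ≥0∞) * (2 * (δ n : ℝ≥0∞)) ^ (d : ℝ) := by
        rw [ENNReal.tsum_set_const, Metric.encard_minimalCover (htop n)]
    _ ≤ (δ n : ℝ≥0∞) ^ (-(d : ℝ)) * (2 * (δ n : ℝ≥0∞)) ^ (d : ℝ) :=
        mul_le_mul_left (hN n).le _
    _ = 2 ^ (d : ℝ) := by
        rw [ENNReal.mul_rpow_of_nonneg _ _ (NNReal.coe_nonneg d), mul_left_comm,
          ← ENNReal.rpow_add _ _ hδn ENNReal.coe_ne_top, neg_add_cancel, ENNReal.rpow_zero, mul_one]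

lemma dimH_boxDim_eq {D : ℝ} (hD : 0 < D) (h1 : ENNReal.ofReal D ≤ dimH A)
    (h2 : upperBoxDim A ≤ D) :
    dimH A = ENNReal.ofReal D ∧ lowerBoxDim A = D ∧ upperBoxDim A = D := by
  have hlu : lowerBoxDim A ≤ upperBoxDim A := liminf_le_limsup
  have hl : (D : EReal) ≤ lowerBoxDim A := by
    by_contra! h
    obtain ⟨x, hx1, hx2⟩ := EReal.lt_iff_exists_real_btwn.1 h
    have hx3 : x < D := EReal.coe_lt_coe_iff.1 hx2
    have h3 : dimH A ≤ ENNReal.ofReal x := dimH_le_of_lowerBoxDim_lt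
      (hx1.trans_le (EReal.coe_le_coe_iff.2 (Real.le_coe_toNNReal x)))
    exact (h1.trans h3).not_gt ((ENNReal.ofReal_lt_ofReal_iff hD).2 hx3)
  refine ⟨le_antisymm ?_ h1, le_antisymm (hlu.trans h2) hl, le_antisymm h2 (hl.trans hlu)⟩
  by_contra! h
  obtain ⟨x, hx1, hx2⟩ := ENNReal.lt_iff_exists_nnreal_btwn.1 h
  refine hx2.not_ge (dimH_le_of_lowerBoxDim_lt ((hlu.trans h2).trans_lt ?_))
  rw [EReal.coe_lt_coe_iff]
  exact (ENNReal.ofReal_lt_iff_lt_toReal hD.le ENNReal.coe_ne_top).1 hx1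

end BoxDimension

/-! ### The graph of a Hölder function -/

/-- Centres must lie in the covered set, so one point is picked for each value of `q` that is
attained. -/
lemma coveringNumber_range_le {α β X : Type*} [PseudoEMetricSpace X] {g : α → X} (q : α → β)
    (S : Finset β) (hS : ∀ t, q t ∈ S) {δ : ℝ≥0} (h : ∀ s t, q s = q t → edist (g s) (g t) ≤ δ) :
    Metric.coveringNumber δ (Set.range g) ≤ S.card := by
  set C : Set X := Set.range fun y : Set.range q => g y.2.choose
  have hC : Metric.IsCover δ (Set.range g) C := by
    rintro _ ⟨t, rfl⟩
    refine ⟨_, ⟨⟨q t, t, rfl⟩, rfl⟩, ?_⟩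
    exact h _ _ (Set.mem_range_self (f := q) t).choose_spec.symm
  have hsub : C ⊆ Set.range g := by
    rintro _ ⟨y, rfl⟩
    exact ⟨_, rfl⟩
  calc Metric.coveringNumber δ (Set.range g) ≤ C.encard := hC.coveringNumber_le_encard hsub
    _ ≤ (Set.range q).encard := by
        rw [show C = (fun y : Set.range q => g y.2.choose) '' Set.univ from Set.image_univ.symm]
        exact (Set.encard_image_le _ _).trans (Set.encard_univ _).le
    _ ≤ (S : Set β).encard := Set.encard_le_encard (by rintro _ ⟨t, rfl⟩; exact hS t)
    _ = S.card := Set.encard_coe_eq_coe_finsetCard S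

lemma abs_sub_lt_one_of_floor_eq {x y : ℝ} (h : ⌊x⌋ = ⌊y⌋) : |x - y| < 1 :=
  Int.abs_sub_lt_one_of_floor_eq_floor h

/-- The square grid of mesh about `δ / 2` has of order `1 / δ` columns, and in each the graph meets
of order `δ ^ (h - 1)` cells. Points of the same cell are within `δ`. -/
lemma exists_coveringNumber_graph_le {C h : ℝ≥0} (hh : h ≤ 1) {f : C(I, ℝ)}
    (hf : HolderWith C h f) :
    ∃ K : ℝ, 0 ≤ K ∧ ∀ δ : ℝ≥0, 0 < δ → δ < 1 →
      ((Metric.coveringNumber δ (graph f) : ℕ∞) : ℝ≥0∞) ≤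
        ENNReal.ofReal (K * (δ : ℝ) ^ ((h : ℝ) - 2)) := by
  refine ⟨4 * (4 * C + 5), by positivity, fun δ hδ hδ1 => ?_⟩
  have hd : (0 : ℝ) < δ := hδ
  have hd1 : (δ : ℝ) < 1 := hδ1
  have hh' : (h : ℝ) ≤ 1 := hh
  set n := ⌈2 / (δ : ℝ)⌉₊ with hn
  have hn1 : 2 / (δ : ℝ) ≤ n := Nat.le_ceil _
  have hn2 : (n : ℝ) < 2 / δ + 1 := Nat.ceil_lt_add_one (by positivity)
  have hn0 : (0 : ℝ) < n := lt_of_lt_of_le (by positivity) hn1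
  rw [div_le_iff₀ hd] at hn1
  -- `C * δ ^ h`, the possible variation over a column, measured in units of `δ / 2`. The range `L +
  -- 1` used in `S` allows for rounding by the floors.
  set L : ℕ := ⌈2 * C * (δ : ℝ) ^ ((h : ℝ) - 1)⌉₊ with hL
  have hL1 : 2 * C * (δ : ℝ) ^ ((h : ℝ) - 1) ≤ L := Nat.le_ceil _
  have hL2 : (L : ℝ) < 2 * C * (δ : ℝ) ^ ((h : ℝ) - 1) + 1 := Nat.ceil_lt_add_one (by positivity)
  -- Left end points of the columns as elements of the unit interval; the value `0` for indices
  -- beyond `n` is never used.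
  have hproj : ∀ k : ℕ, ∃ t : I, (k : ℕ) ≤ n → (t : ℝ) = k / n := by
    intro k
    by_cases hk : k ≤ n
    · exact ⟨⟨k / n, by positivity, div_le_one_of_le₀ (by exact_mod_cast hk) hn0.le⟩, fun _ => rfl⟩
    · exact ⟨0, fun h => absurd h hk⟩
  choose τ hτ using hproj
  set m : ℕ → ℤ := fun k => ⌊2 * f (τ k) / δ⌋ with hm
  set S : Finset (Σ _ : ℕ, ℤ) := (Finset.range (n + 1)).sigma fun k =>
    Finset.Icc (m k - (L + 1 : ℕ)) (m k + (L + 1 : ℕ)) with hS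
  set q : I → Σ _ : ℕ, ℤ := fun t => ⟨⌊n * (t : ℝ)⌋₊, ⌊2 * f t / δ⌋⟩ with hq
  have hqS : ∀ t, q t ∈ S := by
    intro t
    have ht0 := t.2.1
    have hk : ⌊n * (t : ℝ)⌋₊ ≤ n :=
      Nat.floor_le_of_le (mul_le_of_le_one_right hn0.le t.2.2)
    rw [hS, Finset.mem_sigma, Finset.mem_range]
    refine ⟨Nat.lt_succ_of_le hk, ?_⟩
    change ⌊2 * f t / δ⌋ ∈ Finset.Icc (m ⌊n * (t : ℝ)⌋₊ - (L + 1 : ℕ))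
      (m ⌊n * (t : ℝ)⌋₊ + (L + 1 : ℕ))
    set k := ⌊n * (t : ℝ)⌋₊
    have h1 : (k : ℝ) ≤ n * t := Nat.floor_le (by positivity)
    have h2 : n * (t : ℝ) < k + 1 := Nat.lt_floor_add_one _
    have h3 : dist t (τ k) ≤ δ := by
      rw [Subtype.dist_eq, Real.dist_eq, hτ k hk, abs_le]
      have : (t : ℝ) - k / n = (n * t - k) / n := by field_simp
      rw [this, le_div_iff₀ hn0, div_le_iff₀ hn0]
      constructor <;> nlinarith
    have h4 : |f t - f (τ k)| ≤ C * (δ : ℝ) ^ (h : ℝ) :=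
      (hf.dist_le t (τ k)).trans (mul_le_mul_of_nonneg_left
        (Real.rpow_le_rpow dist_nonneg h3 h.2) C.2)
    have h5 : |2 * f t / δ - 2 * f (τ k) / δ| ≤ L := by
      have : 2 * f t / δ - 2 * f (τ k) / δ = 2 / δ * (f t - f (τ k)) := by ring
      rw [this, abs_mul, abs_of_pos (by positivity)]
      refine (mul_le_mul_of_nonneg_left h4 (by positivity)).trans ?_
      refine le_trans (le_of_eq ?_) hL1
      rw [Real.rpow_sub hd, Real.rpow_one]
      ring
    rw [abs_le] at h5
    have h6 := Int.floor_le (2 * f t / δ)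
    have h7 := Int.lt_floor_add_one (2 * f t / δ)
    have h8 := Int.floor_le (2 * f (τ k) / δ)
    have h9 := Int.lt_floor_add_one (2 * f (τ k) / δ)
    rw [Finset.mem_Icc]
    constructor
    · have : ((m k : ℤ) : ℝ) - (L + 1) < (⌊2 * f t / δ⌋ : ℝ) + 1 := by linarith
      have : m k - (L + 1 : ℕ) < ⌊2 * f t / δ⌋ + 1 := by exact_mod_cast this
      linarith
    · have : (⌊2 * f t / δ⌋ : ℝ) < (m k : ℝ) + (L + 1) := by linarith
      have : ⌊2 * f t / δ⌋ < m k + (L + 1 : ℕ) := by exact_mod_cast this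
      linarith
  have hclose : ∀ s t, q s = q t → edist (graphPoint f s) (graphPoint f t) ≤ δ := by
    intro s t hst
    have h1 : ⌊n * (s : ℝ)⌋₊ = ⌊n * (t : ℝ)⌋₊ := congrArg Sigma.fst hst
    have h2 : ⌊2 * f s / δ⌋ = ⌊2 * f t / δ⌋ := by
      have := (Sigma.mk.inj_iff.1 hst).2
      exact eq_of_heq this
    have h3 : |(s : ℝ) - t| ≤ δ / 2 := by
      have hs := Nat.floor_le (mul_nonneg hn0.le s.2.1)
      have hs' := Nat.lt_floor_add_one (n * (s : ℝ))
      have ht := Nat.floor_le (mul_nonneg hn0.le t.2.1)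
      have ht' := Nat.lt_floor_add_one (n * (t : ℝ))
      rw [h1] at hs hs'
      rw [abs_le]
      constructor <;> nlinarith
    have h4 : |f s - f t| ≤ δ / 2 := by
      have h5 := abs_sub_lt_one_of_floor_eq h2
      have : 2 * f s / δ - 2 * f t / δ = 2 / δ * (f s - f t) := by ring
      rw [this, abs_mul, abs_of_pos (by positivity), div_mul_eq_mul_div, div_lt_one hd] at h5
      linarith
    rw [show (δ : ℝ≥0∞) = ENNReal.ofReal δ from (ENNReal.ofReal_coe_nnreal).symm,
      edist_le_ofReal hd.le, EuclideanSpace.dist_eq, Real.sqrt_le_left hd.le]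
    simp only [Fin.sum_univ_two, graphPoint, Real.dist_eq]
    have h5 := pow_le_pow_left₀ (abs_nonneg _) h3 2
    have h6 := pow_le_pow_left₀ (abs_nonneg _) h4 2
    simp only [Matrix.cons_val_zero, Matrix.cons_val_one]
    nlinarith
  have hcard : S.card = (n + 1) * (2 * L + 3) := by
    rw [hS, Finset.card_sigma]
    have : ∀ k, (Finset.Icc (m k - (L + 1 : ℕ)) (m k + (L + 1 : ℕ))).card = 2 * L + 3 := by
      intro k
      rw [Int.card_Icc]
      lia
    rw [Finset.sum_congr rfl fun k _ => this k]
    simp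
  have hle : Metric.coveringNumber δ (graph f) ≤ S.card :=
    coveringNumber_range_le (g := graphPoint f) q S hqS hclose
  have hle' : ((Metric.coveringNumber δ (graph f) : ℕ∞) : ℝ≥0∞) ≤ ENNReal.ofReal S.card := by
    rw [ENNReal.ofReal_natCast]
    exact_mod_cast ENat.toENNReal_le.2 hle
  refine hle'.trans (ENNReal.ofReal_le_ofReal ?_)
  rw [hcard]
  push_cast
  have h1 : (n : ℝ) + 1 ≤ 4 * (δ : ℝ)⁻¹ := by
    have : 1 ≤ (δ : ℝ)⁻¹ := (one_le_inv₀ hd).2 hd1.le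
    rw [div_eq_mul_inv] at hn2
    linarith
  have h2 : 1 ≤ (δ : ℝ) ^ ((h : ℝ) - 1) :=
    Real.one_le_rpow_of_pos_of_le_one_of_nonpos hd hd1.le (by linarith)
  have h3 : 2 * (L : ℝ) + 3 ≤ (4 * C + 5) * (δ : ℝ) ^ ((h : ℝ) - 1) := by linarith
  calc ((n : ℝ) + 1) * (2 * L + 3)
      ≤ 4 * (δ : ℝ)⁻¹ * ((4 * C + 5) * (δ : ℝ) ^ ((h : ℝ) - 1)) :=
        mul_le_mul h1 h3 (by positivity) (by positivity)
    _ = 4 * (4 * C + 5) * ((δ : ℝ) ^ (-1 : ℝ) * (δ : ℝ) ^ ((h : ℝ) - 1)) := by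
        rw [Real.rpow_neg_one]; ring
    _ = _ := by
        rw [← Real.rpow_add hd]
        congr 2
        ring

lemma upperBoxDim_graph_le {C h : ℝ≥0} (hh : h ≤ 1) {f : C(I, ℝ)} (hf : HolderWith C h f)
    {d : ℝ} (hd : 2 - (h : ℝ) < d) : upperBoxDim (graph f) ≤ d := by
  obtain ⟨K, hK0, hK⟩ := exists_coveringNumber_graph_le hh hf
  have hlim : Tendsto (fun δ : ℝ≥0 => K * (δ : ℝ) ^ ((h : ℝ) - 2 + d)) (𝓝[>] 0) (𝓝 0) := by
    have h1 : Tendsto (fun δ : ℝ≥0 => (δ : ℝ)) (𝓝[>] 0) (𝓝 0) :=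
      (NNReal.tendsto_coe.2 tendsto_id).mono_left nhdsWithin_le_nhds
    have h2 := h1.rpow_const (p := (h : ℝ) - 2 + d) (Or.inr (by linarith))
    rw [Real.zero_rpow (by linarith)] at h2
    simpa using h2.const_mul K
  refine limsup_le_of_le isCobounded_le_of_bot ?_
  filter_upwards [eventually_pos_and_lt_one, hlim.eventually (gt_mem_nhds one_pos)] with δ hδ hδK
  rw [boxRatio_le_iff hδ.1 hδ.2]
  have hd0 : (0 : ℝ) < δ := hδ.1
  refine (hK δ hδ.1 hδ.2).trans ?_
  rw [show (δ : ℝ≥0∞) = ENNReal.ofReal δ from (ENNReal.ofReal_coe_nnreal).symm,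
    ENNReal.ofReal_rpow_of_pos hd0]
  refine ENNReal.ofReal_le_ofReal ?_
  rw [show (h : ℝ) - 2 = (h : ℝ) - 2 + d + -d by ring, Real.rpow_add hd0, ← mul_assoc]
  exact mul_le_of_le_one_left (by positivity) hδK.le

lemma upperBoxDim_graph_le_of_forall {H : ℝ} (hH : 0 < H) (hH1 : H ≤ 1) {f : C(I, ℝ)}
    (hf : ∀ H' : ℝ≥0, 0 < H' → (H' : ℝ) < H → ∃ C : ℝ≥0, HolderWith C H' f) :
    upperBoxDim (graph f) ≤ ((2 - H : ℝ) : EReal) := by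
  refine EReal.le_of_forall_lt_iff_le.1 fun d hd => ?_
  rw [EReal.coe_lt_coe_iff] at hd
  obtain ⟨x, hx1, hx2⟩ := exists_between (max_lt hH (by linarith : 2 - d < H))
  have hx0 : 0 < x := (le_max_left _ _).trans_lt hx1
  have hxd : 2 - d < x := (le_max_right _ _).trans_lt hx1
  lift x to ℝ≥0 using hx0.le
  obtain ⟨C, hC⟩ := hf x hx0 hx2
  exact upperBoxDim_graph_le (NNReal.coe_le_one.1 (hx2.le.trans hH1)) hC (by linarith)

end SignCascade

namespace SignCascade

/-! ### Sample path properties of the limit -/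

/-- Projection to the first axis is `1`-Lipschitz and maps the graph onto `[0, 1]`. This replaces
the Fourier argument when `H = 1`. -/
lemma one_le_dimH_graph (f : C(I, ℝ)) : 1 ≤ dimH (graph f) := by
  have h1 : LipschitzWith 1 fun x : EuclideanSpace ℝ (Fin 2) => x 0 :=
    LipschitzWith.of_dist_le_mul fun x y => by
      rw [NNReal.coe_one, one_mul, dist_eq_norm, dist_eq_norm]
      exact PiLp.norm_apply_le (x - y) 0
  have h2 : (fun x : EuclideanSpace ℝ (Fin 2) => x 0) '' graph f = Set.Icc (0 : ℝ) 1 := by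
    rw [graph, ← Set.range_comp]
    exact Subtype.range_coe
  have h3 : dimH (Set.Icc (0 : ℝ) 1) = 1 := by
    rw [Real.dimH_of_nonempty_interior (by simp)]
    simp
  rw [← h3, ← h2]
  exact h1.dimH_image_le _

variable {b : ℕ} {H : ℝ}

/-- With ratio `1 / b` and no sign changes, the recursion is the subdivision identity
`clamp_eq_sum`. -/
lemma cas_of_forall_eq_one [NeZero b] {e : List (Fin b) → ℝ} (he : ∀ u, e u = 1) (n : ℕ)
    (x : ℝ) : cas (b : ℝ)⁻¹ n e x = clamp x := by
  induction n generalizing e x with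
  | zero => rfl
  | succ n ih =>
    have h : ∀ i : Fin b, ∀ u, shift [i] e u = 1 := fun i u => he _
    rw [cas_succ, clamp_eq_sum (b := b)]
    refine Finset.sum_congr rfl fun i _ => ?_
    rw [h i, ih (h i), mul_one]

lemma signLaw_one (b : ℕ) : signLaw b 1 = Measure.dirac 1 := by
  simp [signLaw]

lemma ae_eq_one [IsProbabilityMeasure (signLaw b 1)] :
    ∀ᵐ e ∂(signMeasure b 1), ∀ u, e u = 1 := by
  refine ae_all_iff.2 fun u => (measurePreserving_eval u).quasiMeasurePreserving.ae
    (p := fun x => x = 1) ?_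
  rw [signLaw_one]
  exact (ae_dirac_iff (measurableSet_singleton (1 : ℝ))).2 rfl

variable [hprob : IsProbabilityMeasure (signLaw b H)]

/-- Moments of order `2 * p` yield the exponent `H - 1 / p`, since `c * b ^ (1 / p) = b ^ (-(H - 1 /
p))`. Only countably many `p` are involved, so one null set serves all exponents. -/
lemma ae_holderWith (hb : 2 ≤ b) (hH : 1 / 2 < H) (hH1 : H ≤ 1)
    {B : (List (Fin b) → ℝ) → C(I, ℝ)}
    (hB : ∀ᵐ e ∂(signMeasure b H), ∀ t : I, B e t = lim (ratio b H) e t) :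
    ∀ᵐ e ∂(signMeasure b H), ∀ H' : ℝ≥0, 0 < H' → (H' : ℝ) < H →
      ∃ C : ℝ≥0, HolderWith C H' (B e) := by
  have h1 : ∀ᵐ e ∂(signMeasure b H), ∀ p : ℕ, p ≠ 0 →
      Tame (b := b) (ratio b H) (tameConst (ratio b H) (rate b H) p e)
        (rate b H * growth b p) (growth b p) e :=
    ae_all_iff.2 fun p => by
      by_cases hp : p = 0
      · exact ae_of_all _ fun e h => absurd hp h
      · filter_upwards [ae_tame_of_ne_zero (b := b) hb hH hH1 hp] with e he _ using he
  filter_upwards [h1, hB] with e he hBe H' hH'0 hH'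
  have hlim : Tendsto (fun p : ℕ => (1 / p : ℝ)) atTop (𝓝 0) := tendsto_one_div_atTop_nhds_zero_nat
  obtain ⟨p, ⟨hp, hr⟩, hpH⟩ := ((eventually_rates (b := b) hb hH).and
    (hlim.eventually (gt_mem_nhds (sub_pos.2 hH')))).exists
  have hb0 : (0 : ℝ) < b := by exact_mod_cast (by lia : 0 < b)
  refine (he p hp).holderWith hb hr (one_le_tameConst _ _ _ _) (h := H - 1 / p) ?_ hBe hH'0
    (by linarith)
  rw [coe_ratio, growth, ← Real.rpow_add hb0]
  congr 1
  ring

lemma ae_pointwiseHolderExponent_eq (hb : 2 ≤ b) (hH : 1 / 2 < H) (hH1 : H < 1)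
    {B : (List (Fin b) → ℝ) → C(I, ℝ)}
    (hB : ∀ᵐ e ∂(signMeasure b H), ∀ t : I, B e t = lim (ratio b H) e t) :
    ∀ᵐ e ∂(signMeasure b H), ∀ t₀ : I,
      pointwiseHolderExponent (B e) t₀ = ENNReal.ofReal H := by
  obtain ⟨p, hp, hr⟩ := (eventually_rates hb hH).exists
  filter_upwards [hB, ae_holderWith hb hH hH1.le hB, ae_tame_of_ne_zero (b := b) hb hH hH1.le hp,
    ae_eventually_notMem_smallTotals hb hH hH1.le] with e hBe hholder htame hlow t₀
  exact le_antisymm (htame.pointwiseHolderExponent_le hb hr (one_le_tameConst _ _ _ _)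
    (coe_ratio b H) (by linarith) hH1 hBe hlow t₀) (le_pointwiseHolderExponent t₀ hholder)

lemma ae_apply_eq_of_eq_one (hb : 2 ≤ b) (hH : H = 1)
    {B : (List (Fin b) → ℝ) → C(I, ℝ)}
    (hB : ∀ᵐ e ∂(signMeasure b H), ∀ t : I, B e t = lim (ratio b H) e t) :
    ∀ᵐ e ∂(signMeasure b H), ∀ t : I, B e t = t := by
  subst hH
  have : NeZero b := ⟨by lia⟩
  filter_upwards [hB, ae_eq_one] with e hBe he t
  have h1 : ((ratio b 1 : ℝ≥0) : ℝ) = (b : ℝ)⁻¹ := by rw [coe_ratio, Real.rpow_neg_one]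
  have h2 : clamp (t : ℝ) = t := by
    rw [clamp, min_eq_right t.2.2, max_eq_right t.2.1]
  rw [hBe, lim, h1]
  simp_rw [cas_of_forall_eq_one he, h2]
  exact tendsto_const_nhds.limUnder_eq

lemma ae_ofReal_le_dimH_graph (hb : 2 ≤ b) (hH : 1 / 2 < H) (hH1 : H ≤ 1)
    {B : (List (Fin b) → ℝ) → C(I, ℝ)} (hBm : StronglyMeasurable B)
    (hB : ∀ᵐ e ∂(signMeasure b H), ∀ t : I, B e t = lim (ratio b H) e t) :
    ∀ᵐ e ∂(signMeasure b H), ENNReal.ofReal (2 - H) ≤ dimH (graph (B e)) := by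
  rcases hH1.eq_or_lt with h1 | h1
  · refine ae_of_all _ fun e => ?_
    rw [h1, show (2 - 1 : ℝ) = 1 by norm_num, ENNReal.ofReal_one]
    exact one_le_dimH_graph _
  obtain ⟨K, hK0, hK⟩ := exists_measureReal_abs_lim_sub_le (b := b) hb hH h1
  refine ae_le_dimH_graph hBm h1 hK0 fun s t hst r hr => ?_
  have key : ∀ s t : I, s < t → signMeasure b H {e | |B e t - B e s| ≤ r} ≤
      ENNReal.ofReal (K * r * |(t : ℝ) - s| ^ (-H)) := by
    intro s t hst
    have hlt : (s : ℝ) < t := hst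
    have hae : ({e | |B e t - B e s| ≤ r} : Set (List (Fin b) → ℝ)) =ᵐ[signMeasure b H]
        {e | |lim (ratio b H) e t - lim (ratio b H) e s| ≤ r} := by
      filter_upwards [hB] with e he
      change (|B e t - B e s| ≤ r) = (|lim (ratio b H) e t - lim (ratio b H) e s| ≤ r)
      rw [he, he]
    rw [measure_congr hae, abs_of_pos (sub_pos.2 hlt), ← ofReal_measureReal]
    exact ENNReal.ofReal_le_ofReal (hK s t s.2.1 hlt t.2.2 r hr)
  rcases lt_or_gt_of_ne hst with h | h
  · have := key s t h
    simpa only [abs_sub_comm] using this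
  · exact key t s h

end SignCascade

end

/-! ### Transfer to the given probability space and conclusion. -/

theorem theorem3 (b : ℕ) (hb : 2 ≤ b) (H : ℝ) (hH : 1 / 2 < H) (hH1 : H ≤ 1)
    {Ω : Type*} [MeasurableSpace Ω] (P : Measure Ω) [IsProbabilityMeasure P]
    (ε : List (Fin b) → Ω → ℝ) (hmeas : ∀ w, Measurable (ε w))
    (hindep : iIndepFun ε P)
    (hlaw : ∀ w, P.map (ε w) = SignCascade.signLaw b H) :
    Martingale (SignCascade.cascade b H ε) (SignCascade.cascadeFiltration ε hmeas) P ∧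
    ∃ B : Ω → C(I, ℝ),
      StronglyMeasurable B ∧
      -- almost sure uniform convergence
      (∀ᵐ ω ∂P, Tendsto (fun n => SignCascade.cascade b H ε n ω) atTop (𝓝 (B ω))) ∧
      -- convergence in `L²` for the supremum norm
      (∀ n, MemLp (SignCascade.cascade b H ε n) 2 P) ∧ MemLp B 2 P ∧
      Tendsto (fun n => eLpNorm (SignCascade.cascade b H ε n - B) 2 P) atTop (𝓝 0) ∧
      ∀ᵐ ω ∂P,
        (∀ H' : ℝ≥0, 0 < H' → (H' : ℝ) < H → ∃ C : ℝ≥0, HolderWith C H' (B ω)) ∧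
        (H < 1 → ∀ t₀ : I,
          SignCascade.pointwiseHolderExponent (B ω) t₀ = ENNReal.ofReal H) ∧
        (H = 1 → ∀ t : I, B ω t = t) ∧
        dimH (SignCascade.graph (B ω)) = ENNReal.ofReal (2 - H) ∧
        SignCascade.lowerBoxDim (SignCascade.graph (B ω)) = ((2 - H : ℝ) : EReal) ∧
        SignCascade.upperBoxDim (SignCascade.graph (B ω)) = ((2 - H : ℝ) : EReal) := by
  have hNe : NeZero b := ⟨by lia⟩
  have hprob := SignCascade.isProbabilityMeasure_signLaw (b := b) (H := H) hb hH1
  refine ⟨SignCascade.martingale_cascade hb hH1 hmeas hindep hlaw, ?_⟩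
  -- Independence and the common law say that the family of signs has law `signMeasure`. All claims
  -- about the limit are pulled back along this map.
  have henv : MeasurePreserving (fun ω w => ε w ω) P (SignCascade.signMeasure b H) := by
    refine ⟨measurable_pi_lambda _ hmeas, ?_⟩
    rw [(iIndepFun_iff_map_fun_eq_infinitePi_map hmeas).1 hindep, SignCascade.signMeasure]
    simp_rw [hlaw]
  obtain ⟨B, hBm, hlim, hLp, hBLp, hconv⟩ := SignCascade.exists_limit (b := b) hb hH hH1
  have hBlim : ∀ᵐ e ∂(SignCascade.signMeasure b H), ∀ t : I,
      B e t = SignCascade.lim (SignCascade.ratio b H) e t := by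
    filter_upwards [hlim] with e he t
    exact SignCascade.Tame.apply_eq_lim_of_tendsto (SignCascade.coe_ratio b H) he t
  refine ⟨fun ω => B fun w => ε w ω, hBm.comp_measurable henv.measurable,
    henv.quasiMeasurePreserving.ae hlim, fun n => (hLp n).comp_measurePreserving henv,
    hBLp.comp_measurePreserving henv, ?_, ?_⟩
  · refine hconv.congr fun n => ?_
    exact (eLpNorm_comp_measurePreserving ((hLp n).1.sub hBLp.1) henv).symm
  have hall : ∀ᵐ e ∂(SignCascade.signMeasure b H),
      (∀ H' : ℝ≥0, 0 < H' → (H' : ℝ) < H → ∃ C : ℝ≥0, HolderWith C H' (B e)) ∧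
      (H < 1 → ∀ t₀ : I, SignCascade.pointwiseHolderExponent (B e) t₀ = ENNReal.ofReal H) ∧
      (H = 1 → ∀ t : I, B e t = t) ∧
      dimH (SignCascade.graph (B e)) = ENNReal.ofReal (2 - H) ∧
      SignCascade.lowerBoxDim (SignCascade.graph (B e)) = ((2 - H : ℝ) : EReal) ∧
      SignCascade.upperBoxDim (SignCascade.graph (B e)) = ((2 - H : ℝ) : EReal) := by
    have h1 : ∀ᵐ e ∂(SignCascade.signMeasure b H), H < 1 → ∀ t₀ : I,
        SignCascade.pointwiseHolderExponent (B e) t₀ = ENNReal.ofReal H := by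
      by_cases h : H < 1
      · filter_upwards [SignCascade.ae_pointwiseHolderExponent_eq hb hH h hBlim] with e he _
          using he
      · exact ae_of_all _ fun e h' => absurd h' h
    have h2 : ∀ᵐ e ∂(SignCascade.signMeasure b H), H = 1 → ∀ t : I, B e t = t := by
      by_cases h : H = 1
      · filter_upwards [SignCascade.ae_apply_eq_of_eq_one hb h hBlim] with e he _ using he
      · exact ae_of_all _ fun e h' => absurd h' h
    filter_upwards [SignCascade.ae_holderWith hb hH hH1 hBlim, h1, h2,
      SignCascade.ae_ofReal_le_dimH_graph hb hH hH1 hBm hBlim] with e he1 he2 he3 he4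
    exact ⟨he1, he2, he3, SignCascade.dimH_boxDim_eq (by linarith) he4
      (SignCascade.upperBoxDim_graph_le_of_forall (by linarith) hH1 he1)⟩
  exact henv.quasiMeasurePreserving.ae hall
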